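/- Conventions. All categories are small. A C*-category is a $\mathbb{C}$-linear category whose morphism spaces are complex Banach spaces, with an antilinear contravariant involution $f\mapsto f^*$ such that $f^{**}=f$, $(gf)^*=f^*g^*$, $\|gf\|\le\|g\|\,\|f\|$, $\|f^*f\|=\|f\|^2$ and $f^*f\ge 0$. A multitensor C*-category is a monoidal C*-category $\mathcal C$ (the tensor product of morphisms is bilinear and satisfies $(s\otimes t)^*=s^*\otimes t^*$; associators and unitors are unitary), closed under finite orthogonal direct sums and subobjects, such that $\mathrm{End}(\mathbb 1)$ is finite-dimensional and every object $X$ has a dual $\overline X$, i.e. there is a solution $\omega:\mathbb 1\to\overline X\otimes X$, $\overline\omega:\mathbb 1\to X\otimes\overline X$ of the conjugate equations $(\overline\omega^*\otimes 1_X)(1_X\otimes\omega)=1_X$, $(1_{\overline X}\otimes\overline\omega^*)(\omega\otimes 1_{\overline X})=1_{\overline X}$ (associators and unitors suppressed, here and below). It is a tensor C*-category if moreover $\mathbb 1$ is simple. It is indecomposable if it is nonzero and is not equivalent to a direct sum of two nonzero multitensor C*-categories. Two multitensor C*-categories are equivalent if there is a $\mathbb C$-linear monoidal $*$-functor between them which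 is an equivalence of categories and whose monoidal structure isomorphisms are unitary. A special C*-Frobenius algebra is an algebra $(H,m:H\otimes H\to H,\iota:\mathbb 1\to H)$ with $(1_H\otimes m)(m^*\otimes 1_H)=m^*m=(m\otimes 1_H)(1_H\otimes m^*)$ and $mm^*=1_H$. It is standard if $(m^*\iota,m^*\iota)$ is a standard solution of the conjugate equations for the self-dual object $H$. Here an object $Y$ is connected if $(1_Y\otimes\mathrm{End}(\mathbb 1))\cap(\mathrm{End}(\mathbb 1)\otimes 1_Y)=\mathbb C1_Y$; for connected $Y$ with dual $\overline Y$ a solution $(\gamma,\overline\gamma)$ is standard if $\|\gamma\|^2=\|\overline\gamma\|^2=\inf\|\omega\|\,\|\overline\omega\|$ over all solutions $(\omega,\overline\omega)$ for $Y,\overline Y$; and a solution for a general object $X$ with dual $\overline X$ is standard if it is the direct sum of standard solutions for connected $Y_i$ with duals $\overline Y_i$, where $X=\bigoplus_iY_i$ and $\overline X=\bigoplus_i\overline Y_i$ are finite orthogonal direct sums with $Y_i\otimes\overline Y_j=0=\overline Y_j\otimes Y_i$ for $i\ne j$. A special $H$-$H$-bimodule is an $H$-$H$-bimodule $(X,l,r)$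 with $ll^*=1_X=rr^*$. Special $H$-$H$-bimodules and bimodule maps form a category $\mathrm{sBMod}_{\mathcal C_0}(H,H)$ with the $*$-operation and norm of $\mathcal C_0$; its tensor product $Y\otimes_HX$ is the subobject of $Y\otimes X$ given by the projection $(r_Y\otimes1_X)(1_Y\otimes l_X^*)$, and its tensor unit is $H$. Statement. For every indecomposable multitensor C*-category $\mathcal C$ there exist a tensor C*-category $\mathcal C_0$ and a standard C*-Frobenius algebra $(H,m,\iota)$ in $\mathcal C_0$ such that $\mathrm{sBMod}_{\mathcal C_0}(H,H)$ is a multitensor C*-category and $\mathcal C$ is equivalent to $\mathrm{sBMod}_{\mathcal C_0}(H,H)$ as a multitensor C*-category. -/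

import Mathlib

open CategoryTheory CategoryTheory.Limits MonoidalCategory

universe v u v₂ u₂

set_option linter.unusedSectionVars false

namespace CStarTensor

/-- The `*`-operation and the norm on the morphism spaces of a C*-category. The laws are stated in
`CStarCategory` below. -/
class StarNorm (C : Type u) [Category.{v} C] where
  /-- the adjoint `f*` of a morphism `f` -/
  dag {X Y : C} (f : X ⟶ Y) : Y ⟶ X
  /-- the norm of a morphism -/
  nrm {X Y : C} (f : X ⟶ Y) : ℝ

postfix:max "†" => StarNorm.dag

/-- The norm of a morphism in a C*-category. -/
abbrev nrm {C : Type u} [Category.{v} C] [StarNorm C] {X Y : C} (f : X ⟶ Y) : ℝ :=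
  StarNorm.nrm f

section Basic

variable (C : Type u) [Category.{v} C] [StarNorm C]

/-- A C*-category: the morphism spaces are complex Banach spaces, with an antilinear contravariant
involution, a submultiplicative norm satisfying the C*-identity, and `f* f` is positive in the
C*-algebra of endomorphisms. (In Mathlib's order of composition, `f ≫ f†` is `f* f`.) -/
class CStarCategory [Preadditive C] [Linear ℂ C] : Prop where
  dag_add {X Y : C} (f g : X ⟶ Y) : (f + g)† = f† + g†
  dag_smul {X Y : C} (c : ℂ) (f : X ⟶ Y) : (c • f)† = (starRingEnd ℂ c) • f†
  dag_dag {X Y : C} (f : X ⟶ Y) : f†† = f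
  dag_comp {X Y Z : C} (f : X ⟶ Y) (g : Y ⟶ Z) : (f ≫ g)† = g† ≫ f†
  nrm_add_le {X Y : C} (f g : X ⟶ Y) : nrm (f + g) ≤ nrm f + nrm g
  nrm_smul {X Y : C} (c : ℂ) (f : X ⟶ Y) : nrm (c • f) = ‖c‖ * nrm f
  eq_zero_of_nrm {X Y : C} (f : X ⟶ Y) : nrm f = 0 → f = 0
  complete {X Y : C} (u : ℕ → (X ⟶ Y))
    (hu : ∀ ε : ℝ, 0 < ε → ∃ N, ∀ m n, N ≤ m → N ≤ n → nrm (u m - u n) < ε) :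
    ∃ f : X ⟶ Y, ∀ ε : ℝ, 0 < ε → ∃ N, ∀ n, N ≤ n → nrm (u n - f) < ε
  nrm_comp_le {X Y Z : C} (f : X ⟶ Y) (g : Y ⟶ Z) : nrm (f ≫ g) ≤ nrm f * nrm g
  nrm_comp_dag {X Y : C} (f : X ⟶ Y) : nrm (f ≫ f†) = nrm f ^ 2
  comp_dag_nonneg {X Y : C} (f : X ⟶ Y) : ∃ g : X ⟶ X, f ≫ f† = g ≫ g†

variable {C}

/-- Unitary morphisms. -/
def IsUnitary {X Y : C} (f : X ⟶ Y) : Prop := f ≫ f† = 𝟙 X ∧ f† ≫ f = 𝟙 Y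

/-- `Z` is the orthogonal direct sum of the finite family `X`, through the isometries
`s i : X i ⟶ Z`. -/
def IsOrthogonalSum [Preadditive C] {n : ℕ} {X : Fin n → C} {Z : C} (s : ∀ i, X i ⟶ Z) : Prop :=
  (∀ i, s i ≫ (s i)† = 𝟙 (X i)) ∧ (∀ i j, i ≠ j → s i ≫ (s j)† = 0) ∧
    ∑ i, (s i)† ≫ s i = 𝟙 Z

variable (C)

/-- A C*-bicategory with one object: a monoidal category which is a C*-category closed under finite
direct sums (the empty one included) and subobjects, with bilinear tensor product compatible with
the involution, and with unitary associators and unitors. -/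
class CStarMonoidal [Preadditive C] [Linear ℂ C] [MonoidalCategory C] : Prop
    extends CStarCategory C, MonoidalPreadditive C, MonoidalLinear ℂ C where
  exists_sum {n : ℕ} (X : Fin n → C) : ∃ (Z : C) (s : ∀ i, X i ⟶ Z), IsOrthogonalSum s
  exists_sub {X : C} (p : X ⟶ X) (hp : p ≫ p = p) (hp' : p† = p) :
    ∃ (Y : C) (s : Y ⟶ X), s ≫ s† = 𝟙 Y ∧ s† ≫ s = p
  dag_tensor {X Y Z W : C} (f : X ⟶ Y) (g : Z ⟶ W) : (f ⊗ₘ g)† = f† ⊗ₘ g†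
  associator_unitary (X Y Z : C) : IsUnitary (α_ X Y Z).hom
  leftUnitor_unitary (X : C) : IsUnitary (λ_ X).hom
  rightUnitor_unitary (X : C) : IsUnitary (ρ_ X).hom

variable {C}

/-- The conjugate equations for `ω : 𝟙 ⟶ X̄ ⊗ X` and `ω' : 𝟙 ⟶ X ⊗ X̄`. -/
def ConjugateEquations [MonoidalCategory C] {X Xb : C} (ω : 𝟙_ C ⟶ Xb ⊗ X)
    (ω' : 𝟙_ C ⟶ X ⊗ Xb) : Prop :=
  (ρ_ X).inv ≫ X ◁ ω ≫ (α_ X Xb X).inv ≫ ω'† ▷ X ≫ (λ_ X).hom = 𝟙 X ∧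
  (λ_ Xb).inv ≫ ω ▷ Xb ≫ (α_ Xb X Xb).hom ≫ Xb ◁ ω'† ≫ (ρ_ Xb).hom = 𝟙 Xb

variable (C)

/-- Multitensor C*-categories: rigid C*-bicategories with one object and with finite-dimensional
center. -/
class MultitensorCStar [Preadditive C] [Linear ℂ C] [MonoidalCategory C] : Prop
    extends CStarMonoidal C where
  rigid (X : C) : ∃ (Xb : C) (ω : 𝟙_ C ⟶ Xb ⊗ X) (ω' : 𝟙_ C ⟶ X ⊗ Xb), ConjugateEquations ω ω'
  finite_center : Module.Finite ℂ (𝟙_ C ⟶ 𝟙_ C)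

/-- Tensor C*-categories: multitensor C*-categories with simple tensor unit. -/
class TensorCStar [Preadditive C] [Linear ℂ C] [MonoidalCategory C] : Prop
    extends MultitensorCStar C where
  simple_unit : Simple (𝟙_ C)

/-- `C` and `D` are equivalent as multitensor C*-categories: there is a linear `*`-functor which is
an equivalence of categories and carries a monoidal structure with unitary structure
isomorphisms. -/
def EquivalentMultitensor [Preadditive C] [Linear ℂ C] [MonoidalCategory C]
    (D : Type u₂) [Category.{v₂} D] [StarNorm D] [Preadditive D] [Linear ℂ D]
    [MonoidalCategory D] : Prop :=
  ∃ (F : C ⥤ D) (_ : F.Monoidal), F.IsEquivalence ∧ F.Additive ∧ F.Linear ℂ ∧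
    (∀ {X Y : C} (f : X ⟶ Y), F.map (f†) = (F.map f)†) ∧
    IsUnitary (Functor.LaxMonoidal.ε F) ∧
    ∀ X Y : C, IsUnitary (Functor.LaxMonoidal.μ F X Y)

end Basic

section DirectSum

variable {C₁ : Type u} [Category.{v} C₁] {C₂ : Type u₂} [Category.{v₂} C₂]

/-- The direct sum of two C*-categories is the product category, with componentwise operations and
the maximum norm. -/
instance [StarNorm C₁] [StarNorm C₂] : StarNorm (C₁ × C₂) where
  dag f := (f.1†, f.2†)
  nrm f := max (nrm f.1) (nrm f.2)

instance [Preadditive C₁] [Preadditive C₂] : Preadditive (C₁ × C₂) where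
  homGroup X Y := inferInstanceAs (AddCommGroup ((X.1 ⟶ Y.1) × (X.2 ⟶ Y.2)))
  add_comp _ _ _ _ _ _ := Prod.ext (Preadditive.add_comp _ _ _ _ _ _)
    (Preadditive.add_comp _ _ _ _ _ _)
  comp_add _ _ _ _ _ _ := Prod.ext (Preadditive.comp_add _ _ _ _ _ _)
    (Preadditive.comp_add _ _ _ _ _ _)

instance [Preadditive C₁] [Preadditive C₂] [Linear ℂ C₁] [Linear ℂ C₂] : Linear ℂ (C₁ × C₂) where
  homModule X Y := inferInstanceAs (Module ℂ ((X.1 ⟶ Y.1) × (X.2 ⟶ Y.2)))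
  smul_comp _ _ _ _ _ _ := Prod.ext (Linear.smul_comp _ _ _ _ _ _) (Linear.smul_comp _ _ _ _ _ _)
  comp_smul _ _ _ _ _ _ := Prod.ext (Linear.comp_smul _ _ _ _ _ _) (Linear.comp_smul _ _ _ _ _ _)

end DirectSum

/-- A category is nonzero if it has an object which is not a zero object. -/
def NonzeroCategory (C : Type u) [Category.{v} C] : Prop := ∃ X : C, ¬ IsZero X

/-- A multitensor C*-category is indecomposable if it is nonzero and not equivalent to the direct
sum of two nonzero multitensor C*-categories. -/
def Indecomposable (C : Type u) [Category.{v} C] [StarNorm C] [Preadditive C] [Linear ℂ C]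
    [MonoidalCategory C] : Prop :=
  NonzeroCategory C ∧
  ¬ ∃ (C₁ : Type u) (_ : Category.{v} C₁) (_ : StarNorm C₁) (_ : Preadditive C₁)
      (_ : Linear ℂ C₁) (_ : MonoidalCategory C₁)
      (C₂ : Type u) (_ : Category.{v} C₂) (_ : StarNorm C₂) (_ : Preadditive C₂)
      (_ : Linear ℂ C₂) (_ : MonoidalCategory C₂),
      MultitensorCStar C₁ ∧ MultitensorCStar C₂ ∧ NonzeroCategory C₁ ∧ NonzeroCategory C₂ ∧
        EquivalentMultitensor C (C₁ × C₂)

section Standard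

variable {C : Type u} [Category.{v} C] [StarNorm C] [Preadditive C] [Linear ℂ C]
  [MonoidalCategory C]

/-- Connected objects: `(1_Y ⊗ End 𝟙) ∩ (End 𝟙 ⊗ 1_Y) = ℂ 1_Y`. -/
def IsConnectedObj (Y : C) : Prop :=
  Set.range (fun z : 𝟙_ C ⟶ 𝟙_ C => (ρ_ Y).inv ≫ Y ◁ z ≫ (ρ_ Y).hom) ∩
      Set.range (fun z : 𝟙_ C ⟶ 𝟙_ C => (λ_ Y).inv ≫ z ▷ Y ≫ (λ_ Y).hom) =
    Set.range (fun c : ℂ => c • 𝟙 Y)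

/-- A solution of the conjugate equations with `‖γ‖² = ‖γ'‖² = inf ‖ω‖ ‖ω'‖`, the infimum being
over all solutions. This is standardness when `Y` is connected. -/
def IsMinimalSolution {Y Yb : C} (γ : 𝟙_ C ⟶ Yb ⊗ Y) (γ' : 𝟙_ C ⟶ Y ⊗ Yb) : Prop :=
  ConjugateEquations γ γ' ∧ nrm γ ^ 2 = nrm γ' ^ 2 ∧
  IsGLB {d : ℝ | ∃ (ω : 𝟙_ C ⟶ Yb ⊗ Y) (ω' : 𝟙_ C ⟶ Y ⊗ Yb),
    ConjugateEquations ω ω' ∧ d = nrm ω * nrm ω'} (nrm γ ^ 2)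

/-- Standard solutions of the conjugate equations for a general object: direct sums of standard
solutions for the connected components. -/
def IsStandardSolution {X Xb : C} (γ : 𝟙_ C ⟶ Xb ⊗ X) (γ' : 𝟙_ C ⟶ X ⊗ Xb) : Prop :=
  ∃ (n : ℕ) (Y Yb : Fin n → C) (s : ∀ i, Y i ⟶ X) (t : ∀ i, Yb i ⟶ Xb)
    (g : ∀ i, 𝟙_ C ⟶ Yb i ⊗ Y i) (g' : ∀ i, 𝟙_ C ⟶ Y i ⊗ Yb i),
    IsOrthogonalSum s ∧ IsOrthogonalSum t ∧
    (∀ i, IsConnectedObj (Y i) ∧ IsMinimalSolution (g i) (g' i)) ∧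
    (∀ i j, i ≠ j → IsZero (Y i ⊗ Yb j) ∧ IsZero (Yb j ⊗ Y i)) ∧
    γ = ∑ i, g i ≫ (t i ⊗ₘ s i) ∧ γ' = ∑ i, g' i ≫ (s i ⊗ₘ t i)

end Standard

section Algebra

variable {C : Type u} [Category.{v} C] [StarNorm C] [Preadditive C] [Linear ℂ C]
  [MonoidalCategory C]

open MonObj

variable (C) in
/-- Special C*-Frobenius algebras `(A, m, ι)` in `C`. -/
structure SpecialFrobenius where
  /-- the underlying algebra -/
  alg : Mon C
  frobenius_left : (μ[alg.X])† ▷ alg.X ≫ (α_ alg.X alg.X alg.X).hom ≫ alg.X ◁ μ[alg.X] =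
    μ[alg.X] ≫ (μ[alg.X])†
  frobenius_right : alg.X ◁ (μ[alg.X])† ≫ (α_ alg.X alg.X alg.X).inv ≫ μ[alg.X] ▷ alg.X =
    μ[alg.X] ≫ (μ[alg.X])†
  special : (μ[alg.X])† ≫ μ[alg.X] = 𝟙 alg.X

/-- Standard C*-Frobenius algebras: special ones for which `(m* ι, m* ι)` is a standard solution
of the conjugate equations. -/
def SpecialFrobenius.IsStandard (H : SpecialFrobenius C) : Prop :=
  IsStandardSolution (X := H.alg.X) (Xb := H.alg.X)
    (η[H.alg.X] ≫ (μ[H.alg.X])†) (η[H.alg.X] ≫ (μ[H.alg.X])†)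

/-- Special `H`-`H`-bimodules. -/
structure SpecialBimod (H : SpecialFrobenius C) where
  /-- the underlying bimodule -/
  toBimod : Bimod H.alg H.alg
  special_left : toBimod.actLeft† ≫ toBimod.actLeft = 𝟙 toBimod.X
  special_right : toBimod.actRight† ≫ toBimod.actRight = 𝟙 toBimod.X

end Algebra

namespace CStarMonoidal

variable {C : Type u} [Category.{v} C] [StarNorm C] [Preadditive C] [Linear ℂ C]
  [MonoidalCategory C] [CStarMonoidal C]

open CStarCategory

attribute [simp] dag_dag dag_comp dag_add dag_smul

@[simp] lemma dag_id (X : C) : (𝟙 X)† = 𝟙 X := by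
  have h := dag_comp (𝟙 X)† (𝟙 X)
  simpa using h.symm

@[simp] lemma dag_whiskerLeft (X : C) {Y Z : C} (f : Y ⟶ Z) : (X ◁ f)† = X ◁ f† := by
  rw [← id_tensorHom, dag_tensor, dag_id, id_tensorHom]

@[simp] lemma dag_whiskerRight {Y Z : C} (f : Y ⟶ Z) (X : C) : (f ▷ X)† = f† ▷ X := by
  rw [← tensorHom_id, dag_tensor, dag_id, tensorHom_id]

lemma dag_iso {X Y : C} (e : X ≅ Y) (h : IsUnitary e.hom) : e.hom† = e.inv := by
  rw [← cancel_epi e.hom, h.1, e.hom_inv_id]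

lemma dag_iso_inv {X Y : C} (e : X ≅ Y) (h : IsUnitary e.hom) : e.inv† = e.hom := by
  rw [← dag_iso e h, dag_dag]

@[simp] lemma dag_associator_hom (X Y Z : C) : (α_ X Y Z).hom† = (α_ X Y Z).inv :=
  dag_iso _ (associator_unitary X Y Z)

@[simp] lemma dag_associator_inv (X Y Z : C) : (α_ X Y Z).inv† = (α_ X Y Z).hom :=
  dag_iso_inv _ (associator_unitary X Y Z)

@[simp] lemma dag_leftUnitor_hom (X : C) : (λ_ X).hom† = (λ_ X).inv :=
  dag_iso _ (leftUnitor_unitary X)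

@[simp] lemma dag_leftUnitor_inv (X : C) : (λ_ X).inv† = (λ_ X).hom :=
  dag_iso_inv _ (leftUnitor_unitary X)

@[simp] lemma dag_rightUnitor_hom (X : C) : (ρ_ X).hom† = (ρ_ X).inv :=
  dag_iso _ (rightUnitor_unitary X)

@[simp] lemma dag_rightUnitor_inv (X : C) : (ρ_ X).inv† = (ρ_ X).hom :=
  dag_iso_inv _ (rightUnitor_unitary X)

lemma dag_injective {X Y : C} {f g : X ⟶ Y} (h : f† = g†) : f = g := by
  rw [← dag_dag f, h, dag_dag]

end CStarMonoidal

namespace SpecialBimod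

open CStarCategory CStarMonoidal MonObj

variable {C : Type u} [Category.{v} C] [StarNorm C] [Preadditive C] [Linear ℂ C]
  [MonoidalCategory C] {H : SpecialFrobenius C}

instance : Category (SpecialBimod H) where
  Hom M N := M.toBimod ⟶ N.toBimod
  id M := 𝟙 M.toBimod
  comp f g := Bimod.comp f g

/-- The underlying object. -/
abbrev X (M : SpecialBimod H) : C := M.toBimod.X

/-- The left action. -/
abbrev l (M : SpecialBimod H) : H.alg.X ⊗ M.X ⟶ M.X := M.toBimod.actLeft

/-- The right action. -/
abbrev r (M : SpecialBimod H) : M.X ⊗ H.alg.X ⟶ M.X := M.toBimod.actRight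

/-- The underlying morphism of a bimodule map. -/
abbrev hom {M N : SpecialBimod H} (f : M ⟶ N) : M.X ⟶ N.X := Bimod.Hom.hom f

@[ext] lemma hom_ext {M N : SpecialBimod H} {f g : M ⟶ N} (h : hom f = hom g) : f = g :=
  Bimod.Hom.ext h

@[simp] lemma hom_id (M : SpecialBimod H) : hom (𝟙 M) = 𝟙 M.X := rfl

@[simp] lemma hom_comp {M N O : SpecialBimod H} (f : M ⟶ N) (g : N ⟶ O) :
    hom (f ≫ g) = hom f ≫ hom g := rfl

lemma l_hom {M N : SpecialBimod H} (f : M ⟶ N) : M.l ≫ hom f = H.alg.X ◁ hom f ≫ N.l :=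
  Bimod.Hom.left_act_hom f

lemma r_hom {M N : SpecialBimod H} (f : M ⟶ N) : M.r ≫ hom f = hom f ▷ H.alg.X ≫ N.r :=
  Bimod.Hom.right_act_hom f

variable [CStarMonoidal C]

lemma left_frob (M : SpecialBimod H) :
    (μ[H.alg.X])† ▷ M.X ≫ (α_ _ _ _).hom ≫ H.alg.X ◁ M.l = M.l ≫ M.l† := by
  set B := (μ[H.alg.X])† ▷ M.X ≫ (α_ _ _ _).hom ≫ H.alg.X ◁ M.l with hB
  have hBd : B† = H.alg.X ◁ M.l† ≫ (α_ _ _ _).inv ≫ μ[H.alg.X] ▷ M.X := by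
    simp [hB]
  have h1 : B† ≫ B = B := by
    calc B† ≫ B = H.alg.X ◁ M.l† ⊗≫ (μ[H.alg.X] ≫ (μ[H.alg.X])†) ▷ M.X ⊗≫ H.alg.X ◁ M.l := by
          rw [hBd, hB]; monoidal
      _ = H.alg.X ◁ M.l† ⊗≫ (μ[H.alg.X])† ▷ (H.alg.X ⊗ M.X) ⊗≫
            H.alg.X ◁ (μ[H.alg.X] ▷ M.X ≫ M.l) := by
          rw [← H.frobenius_left]; monoidal
      _ = H.alg.X ◁ M.l† ⊗≫ ((μ[H.alg.X])† ▷ (H.alg.X ⊗ M.X) ≫ (H.alg.X ⊗ H.alg.X) ◁ M.l) ⊗≫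
            H.alg.X ◁ M.l := by
          rw [M.toBimod.left_assoc]; monoidal
      _ = H.alg.X ◁ (M.l† ≫ M.l) ⊗≫ (μ[H.alg.X])† ▷ M.X ⊗≫ H.alg.X ◁ M.l := by
          rw [← whisker_exchange]; monoidal
      _ = B := by
          rw [M.special_left, hB]; monoidal
  have hsa : B† = B := by
    have := congrArg StarNorm.dag h1
    rw [dag_comp, dag_dag, h1] at this
    exact this.symm
  have h2 : (λ_ M.X).inv ≫ η[H.alg.X] ▷ M.X ≫ B = M.l† := by
    calc (λ_ M.X).inv ≫ η[H.alg.X] ▷ M.X ≫ B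
        = 𝟙 _ ⊗≫ (η[H.alg.X] ▷ M.X ≫ H.alg.X ◁ M.l†) ⊗≫ μ[H.alg.X] ▷ M.X := by
          rw [← hsa, hBd]; monoidal
      _ = M.l† ⊗≫ (η[H.alg.X] ▷ H.alg.X ≫ μ[H.alg.X]) ▷ M.X := by
          rw [← whisker_exchange]; monoidal
      _ = M.l† := by
          rw [MonObj.one_mul]; monoidal
  calc B = (λ_ (H.alg.X ⊗ M.X)).inv ⊗≫ ((η[H.alg.X] ▷ H.alg.X ≫ μ[H.alg.X]) ▷ M.X) ⊗≫ B := by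
        rw [MonObj.one_mul]; monoidal
    _ = 𝟙 _ ⊗≫ (η[H.alg.X] ▷ H.alg.X ▷ M.X) ⊗≫ (μ[H.alg.X] ≫ (μ[H.alg.X])†) ▷ M.X ⊗≫
          H.alg.X ◁ M.l := by
        rw [hB]; monoidal
    _ = 𝟙 _ ⊗≫ (η[H.alg.X] ▷ (H.alg.X ⊗ M.X)) ⊗≫ (μ[H.alg.X])† ▷ (H.alg.X ⊗ M.X) ⊗≫
          H.alg.X ◁ (μ[H.alg.X] ▷ M.X ≫ M.l) := by
        rw [← H.frobenius_left]; monoidal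
    _ = 𝟙 _ ⊗≫ (η[H.alg.X] ▷ (H.alg.X ⊗ M.X)) ⊗≫
          ((μ[H.alg.X])† ▷ (H.alg.X ⊗ M.X) ≫ (H.alg.X ⊗ H.alg.X) ◁ M.l) ⊗≫ H.alg.X ◁ M.l := by
        rw [M.toBimod.left_assoc]; monoidal
    _ = 𝟙 _ ⊗≫ (η[H.alg.X] ▷ (H.alg.X ⊗ M.X) ≫ H.alg.X ◁ M.l) ⊗≫
          (μ[H.alg.X])† ▷ M.X ⊗≫ H.alg.X ◁ M.l := by
        rw [← whisker_exchange]; monoidal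
    _ = M.l ≫ (λ_ M.X).inv ≫ η[H.alg.X] ▷ M.X ≫ B := by
        rw [← whisker_exchange, hB]; monoidal
    _ = M.l ≫ M.l† := by rw [h2]

lemma right_frob (M : SpecialBimod H) :
    M.X ◁ (μ[H.alg.X])† ≫ (α_ _ _ _).inv ≫ M.r ▷ H.alg.X = M.r ≫ M.r† := by
  set B := M.X ◁ (μ[H.alg.X])† ≫ (α_ _ _ _).inv ≫ M.r ▷ H.alg.X with hB
  have hBd : B† = M.r† ▷ H.alg.X ≫ (α_ _ _ _).hom ≫ M.X ◁ μ[H.alg.X] := by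
    simp [hB]
  have h1 : B† ≫ B = B := by
    calc B† ≫ B = M.r† ▷ H.alg.X ⊗≫ M.X ◁ (μ[H.alg.X] ≫ (μ[H.alg.X])†) ⊗≫ M.r ▷ H.alg.X := by
          rw [hBd, hB]; monoidal
      _ = M.r† ▷ H.alg.X ⊗≫ (M.X ⊗ H.alg.X) ◁ (μ[H.alg.X])† ⊗≫
            (M.X ◁ μ[H.alg.X] ≫ M.r) ▷ H.alg.X := by
          rw [← H.frobenius_right]; monoidal
      _ = M.r† ▷ H.alg.X ⊗≫ ((M.X ⊗ H.alg.X) ◁ (μ[H.alg.X])† ≫ M.r ▷ (H.alg.X ⊗ H.alg.X)) ⊗≫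
            M.r ▷ H.alg.X := by
          rw [M.toBimod.right_assoc]; monoidal
      _ = (M.r† ≫ M.r) ▷ H.alg.X ⊗≫ M.X ◁ (μ[H.alg.X])† ⊗≫ M.r ▷ H.alg.X := by
          rw [whisker_exchange]; monoidal
      _ = B := by
          rw [M.special_right, hB]; monoidal
  have hsa : B† = B := by
    have := congrArg StarNorm.dag h1
    rw [dag_comp, dag_dag, h1] at this
    exact this.symm
  have h2 : (ρ_ M.X).inv ≫ M.X ◁ η[H.alg.X] ≫ B = M.r† := by
    calc (ρ_ M.X).inv ≫ M.X ◁ η[H.alg.X] ≫ B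
        = 𝟙 _ ⊗≫ (M.X ◁ η[H.alg.X] ≫ M.r† ▷ H.alg.X) ⊗≫ M.X ◁ μ[H.alg.X] := by
          rw [← hsa, hBd]; monoidal
      _ = M.r† ⊗≫ M.X ◁ (H.alg.X ◁ η[H.alg.X] ≫ μ[H.alg.X]) := by
          rw [whisker_exchange]; monoidal
      _ = M.r† := by
          rw [MonObj.mul_one]; monoidal
  calc B = (ρ_ (M.X ⊗ H.alg.X)).inv ⊗≫ (M.X ◁ (H.alg.X ◁ η[H.alg.X] ≫ μ[H.alg.X])) ⊗≫ B := by
        rw [MonObj.mul_one]; monoidal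
    _ = 𝟙 _ ⊗≫ (M.X ◁ H.alg.X ◁ η[H.alg.X]) ⊗≫ M.X ◁ (μ[H.alg.X] ≫ (μ[H.alg.X])†) ⊗≫
          M.r ▷ H.alg.X := by
        rw [hB]; monoidal
    _ = 𝟙 _ ⊗≫ ((M.X ⊗ H.alg.X) ◁ η[H.alg.X]) ⊗≫ (M.X ⊗ H.alg.X) ◁ (μ[H.alg.X])† ⊗≫
          (M.X ◁ μ[H.alg.X] ≫ M.r) ▷ H.alg.X := by
        rw [← H.frobenius_right]; monoidal
    _ = 𝟙 _ ⊗≫ ((M.X ⊗ H.alg.X) ◁ η[H.alg.X]) ⊗≫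
          ((M.X ⊗ H.alg.X) ◁ (μ[H.alg.X])† ≫ M.r ▷ (H.alg.X ⊗ H.alg.X)) ⊗≫ M.r ▷ H.alg.X := by
        rw [M.toBimod.right_assoc]; monoidal
    _ = 𝟙 _ ⊗≫ ((M.X ⊗ H.alg.X) ◁ η[H.alg.X] ≫ M.r ▷ H.alg.X) ⊗≫
          M.X ◁ (μ[H.alg.X])† ⊗≫ M.r ▷ H.alg.X := by
        rw [whisker_exchange]; monoidal
    _ = M.r ≫ (ρ_ M.X).inv ≫ M.X ◁ η[H.alg.X] ≫ B := by
        rw [whisker_exchange, hB]; monoidal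
    _ = M.r ≫ M.r† := by rw [h2]

lemma l_dag (M : SpecialBimod H) :
    M.l† = (λ_ M.X).inv ≫ (η[H.alg.X] ≫ (μ[H.alg.X])†) ▷ M.X ≫ (α_ _ _ _).hom ≫
      H.alg.X ◁ M.l := by
  rw [comp_whiskerRight, Category.assoc, left_frob, M.toBimod.one_actLeft_assoc,
    Iso.inv_hom_id_assoc]

lemma r_dag (M : SpecialBimod H) :
    M.r† = (ρ_ M.X).inv ≫ M.X ◁ (η[H.alg.X] ≫ (μ[H.alg.X])†) ≫ (α_ _ _ _).inv ≫
      M.r ▷ H.alg.X := by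
  rw [whiskerLeft_comp, Category.assoc, right_frob, M.toBimod.actRight_one_assoc,
    Iso.inv_hom_id_assoc]

lemma l_dag_hom {M N : SpecialBimod H} (f : M ⟶ N) :
    M.l† ≫ H.alg.X ◁ hom f = hom f ≫ N.l† := by
  rw [l_dag, l_dag]
  simp only [Category.assoc]
  rw [← whiskerLeft_comp, l_hom, whiskerLeft_comp, leftUnitor_inv_naturality_assoc,
    whisker_exchange_assoc]
  monoidal

lemma r_dag_hom {M N : SpecialBimod H} (f : M ⟶ N) :
    M.r† ≫ hom f ▷ H.alg.X = hom f ≫ N.r† := by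
  rw [r_dag, r_dag]
  simp only [Category.assoc]
  rw [← comp_whiskerRight, r_hom, comp_whiskerRight, rightUnitor_inv_naturality_assoc,
    ← whisker_exchange_assoc]
  monoidal

/-- The adjoint of a map between special bimodules is a bimodule map. -/
def dagHom {M N : SpecialBimod H} (f : M ⟶ N) : N ⟶ M where
  hom := (hom f)†
  left_act_hom := dag_injective (by simpa using (l_dag_hom f).symm)
  right_act_hom := dag_injective (by simpa using (r_dag_hom f).symm)

/-- The `*`-operation and the norm are inherited from the underlying category. -/
instance : StarNorm (SpecialBimod H) where
  dag f := dagHom f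
  nrm f := nrm (hom f)

@[simp] lemma hom_dag {M N : SpecialBimod H} (f : M ⟶ N) : hom (f†) = (hom f)† := rfl

/-- The projection onto the relative tensor product of `M` and `N` inside `M ⊗ N`. -/
def proj (M N : SpecialBimod H) : M.X ⊗ N.X ⟶ M.X ⊗ N.X :=
  M.X ◁ N.l† ≫ (α_ _ _ _).inv ≫ M.r ▷ N.X

lemma proj_eq (M N : SpecialBimod H) :
    proj M N = M.r† ▷ N.X ≫ (α_ _ _ _).hom ≫ M.X ◁ N.l := by
  calc proj M N = 𝟙 _ ⊗≫ M.X ◁ (η[H.alg.X] ≫ (μ[H.alg.X])†) ▷ N.X ⊗≫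
        ((M.X ⊗ H.alg.X) ◁ N.l ≫ M.r ▷ N.X) := by
        rw [proj, l_dag]; monoidal
    _ = M.r† ▷ N.X ≫ (α_ _ _ _).hom ≫ M.X ◁ N.l := by
        rw [whisker_exchange, r_dag]; monoidal

lemma proj_dag (M N : SpecialBimod H) : (proj M N)† = proj M N := by
  have h : (proj M N)† = M.r† ▷ N.X ≫ (α_ _ _ _).hom ≫ M.X ◁ N.l := by simp [proj]
  rw [h, proj_eq]

lemma proj_idem (M N : SpecialBimod H) : proj M N ≫ proj M N = proj M N := by
  have h : N.l† ≫ (μ[H.alg.X])† ▷ N.X ≫ (α_ _ _ _).hom ≫ H.alg.X ◁ N.l = N.l† := by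
    rw [left_frob, ← Category.assoc, N.special_left, Category.id_comp]
  calc proj M N ≫ proj M N = M.X ◁ N.l† ⊗≫ (M.r ≫ M.r†) ▷ N.X ⊗≫ M.X ◁ N.l := by
        conv_lhs => rw [proj_eq M N]
        rw [← proj_eq M N]
        conv_lhs => arg 2; rw [proj_eq M N]
        rw [proj]; monoidal
    _ = M.X ◁ N.l† ⊗≫ M.X ◁ (μ[H.alg.X])† ▷ N.X ⊗≫
          (M.r ▷ (H.alg.X ⊗ N.X) ≫ M.X ◁ N.l) := by
        rw [← right_frob]; monoidal
    _ = M.X ◁ (N.l† ≫ (μ[H.alg.X])† ▷ N.X ≫ (α_ _ _ _).hom ≫ H.alg.X ◁ N.l) ⊗≫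
          M.r ▷ N.X := by
        rw [← whisker_exchange]; monoidal
    _ = proj M N := by
        rw [h, proj]; monoidal

lemma proj_left {M M' : SpecialBimod H} (f : M ⟶ M') (N : SpecialBimod H) :
    proj M N ≫ hom f ▷ N.X = hom f ▷ N.X ≫ proj M' N := by
  calc proj M N ≫ hom f ▷ N.X = M.X ◁ N.l† ⊗≫ (M.r ≫ hom f) ▷ N.X := by
        rw [proj]; monoidal
    _ = (M.X ◁ N.l† ≫ hom f ▷ (H.alg.X ⊗ N.X)) ⊗≫ M'.r ▷ N.X := by
        rw [r_hom]; monoidal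
    _ = _ := by rw [whisker_exchange, proj]; monoidal

lemma proj_right (M : SpecialBimod H) {N N' : SpecialBimod H} (g : N ⟶ N') :
    proj M N ≫ M.X ◁ hom g = M.X ◁ hom g ≫ proj M N' := by
  calc proj M N ≫ M.X ◁ hom g = M.r† ▷ N.X ⊗≫ M.X ◁ (N.l ≫ hom g) := by
        rw [proj_eq]; monoidal
    _ = (M.r† ▷ N.X ≫ (M.X ⊗ H.alg.X) ◁ hom g) ⊗≫ M.X ◁ N'.l := by
        rw [l_hom]; monoidal
    _ = _ := by rw [← whisker_exchange, proj_eq]; monoidal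

lemma proj_l (M N : SpecialBimod H) :
    H.alg.X ◁ proj M N ≫ (α_ _ _ _).inv ≫ M.l ▷ N.X =
      ((α_ _ _ _).inv ≫ M.l ▷ N.X) ≫ proj M N := by
  calc H.alg.X ◁ proj M N ≫ (α_ _ _ _).inv ≫ M.l ▷ N.X
      = (H.alg.X ◁ M.X ◁ N.l†) ⊗≫ ((α_ _ _ _).hom ≫ H.alg.X ◁ M.r ≫ M.l) ▷ N.X := by
        rw [proj]; monoidal
    _ = 𝟙 _ ⊗≫ ((H.alg.X ⊗ M.X) ◁ N.l† ≫ M.l ▷ (H.alg.X ⊗ N.X)) ⊗≫ M.r ▷ N.X := by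
        rw [← M.toBimod.middle_assoc]; monoidal
    _ = _ := by rw [whisker_exchange, proj]; monoidal

lemma proj_r (M N : SpecialBimod H) :
    proj M N ▷ H.alg.X ≫ (α_ _ _ _).hom ≫ M.X ◁ N.r =
      ((α_ _ _ _).hom ≫ M.X ◁ N.r) ≫ proj M N := by
  calc proj M N ▷ H.alg.X ≫ (α_ _ _ _).hom ≫ M.X ◁ N.r
      = (M.r† ▷ N.X ▷ H.alg.X) ⊗≫ M.X ◁ (N.l ▷ H.alg.X ≫ N.r) := by
        rw [proj_eq]; monoidal
    _ = 𝟙 _ ⊗≫ (M.r† ▷ (N.X ⊗ H.alg.X) ≫ (M.X ⊗ H.alg.X) ◁ N.r) ⊗≫ M.X ◁ N.l := by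
        rw [N.toBimod.middle_assoc]; monoidal
    _ = _ := by rw [← whisker_exchange, proj_eq]; monoidal

/-- The underlying object of the relative tensor product `M ⊗_H N`: a chosen subobject of `M ⊗ N`
with range projection `proj M N`. -/
noncomputable def relObj (M N : SpecialBimod H) : C :=
  (exists_sub (proj M N) (proj_idem M N) (proj_dag M N)).choose

/-- The chosen isometry `M ⊗_H N ⟶ M ⊗ N`. -/
noncomputable def incl (M N : SpecialBimod H) : relObj M N ⟶ M.X ⊗ N.X :=
  (exists_sub (proj M N) (proj_idem M N) (proj_dag M N)).choose_spec.choose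

@[simp] lemma incl_dag (M N : SpecialBimod H) : incl M N ≫ (incl M N)† = 𝟙 _ :=
  (exists_sub (proj M N) (proj_idem M N) (proj_dag M N)).choose_spec.choose_spec.1

@[simp] lemma dag_incl (M N : SpecialBimod H) : (incl M N)† ≫ incl M N = proj M N :=
  (exists_sub (proj M N) (proj_idem M N) (proj_dag M N)).choose_spec.choose_spec.2

@[simp] lemma incl_dag_assoc (M N : SpecialBimod H) {Z : C} (f : relObj M N ⟶ Z) :
    incl M N ≫ (incl M N)† ≫ f = f := by
  rw [← Category.assoc, incl_dag, Category.id_comp]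

@[simp] lemma incl_proj (M N : SpecialBimod H) : incl M N ≫ proj M N = incl M N := by
  rw [← dag_incl, incl_dag_assoc]

instance (M N : SpecialBimod H) : Mono (incl M N) :=
  ⟨fun f g h => by simpa using congrArg (· ≫ (incl M N)†) h⟩

/-- The left action on the relative tensor product. -/
noncomputable def relL (M N : SpecialBimod H) : H.alg.X ⊗ relObj M N ⟶ relObj M N :=
  H.alg.X ◁ incl M N ≫ (α_ _ _ _).inv ≫ M.l ▷ N.X ≫ (incl M N)†

/-- The right action on the relative tensor product. -/
noncomputable def relR (M N : SpecialBimod H) : relObj M N ⊗ H.alg.X ⟶ relObj M N :=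
  incl M N ▷ H.alg.X ≫ (α_ _ _ _).hom ≫ M.X ◁ N.r ≫ (incl M N)†

lemma relL_incl (M N : SpecialBimod H) :
    relL M N ≫ incl M N = H.alg.X ◁ incl M N ≫ (α_ _ _ _).inv ≫ M.l ▷ N.X := by
  have h := proj_l M N
  simp only [Category.assoc] at h
  simp only [relL, Category.assoc, dag_incl]
  rw [← h, ← whiskerLeft_comp_assoc, incl_proj]

lemma relR_incl (M N : SpecialBimod H) :
    relR M N ≫ incl M N = incl M N ▷ H.alg.X ≫ (α_ _ _ _).hom ≫ M.X ◁ N.r := by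
  have h := proj_r M N
  simp only [Category.assoc] at h
  simp only [relR, Category.assoc, dag_incl]
  rw [← h, ← comp_whiskerRight_assoc, incl_proj]

lemma relL_special (M N : SpecialBimod H) : (relL M N)† ≫ relL M N = 𝟙 _ := by
  have h : (relL M N)† = incl M N ≫ M.l† ▷ N.X ≫ (α_ _ _ _).hom ≫ H.alg.X ◁ (incl M N)† := by
    simp [relL]
  rw [← cancel_mono (incl M N)]
  rw [Category.assoc, relL_incl, h]
  calc _ = incl M N ⊗≫ M.l† ▷ N.X ≫ (α_ _ _ _).hom ≫ H.alg.X ◁ ((incl M N)† ≫ incl M N) ≫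
          (α_ _ _ _).inv ≫ M.l ▷ N.X := by monoidal
    _ = incl M N ⊗≫ (M.l† ≫ M.l) ▷ N.X ≫ proj M N := by
        rw [dag_incl, proj_l]; monoidal
    _ = incl M N ≫ proj M N := by rw [M.special_left]; monoidal
    _ = _ := by simp

lemma relR_special (M N : SpecialBimod H) : (relR M N)† ≫ relR M N = 𝟙 _ := by
  have h : (relR M N)† = incl M N ≫ M.X ◁ N.r† ≫ (α_ _ _ _).inv ≫ (incl M N)† ▷ H.alg.X := by
    simp [relR]
  rw [← cancel_mono (incl M N)]
  rw [Category.assoc, relR_incl, h]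
  calc _ = incl M N ⊗≫ M.X ◁ N.r† ≫ (α_ _ _ _).inv ≫ ((incl M N)† ≫ incl M N) ▷ H.alg.X ≫
          (α_ _ _ _).hom ≫ M.X ◁ N.r := by monoidal
    _ = incl M N ⊗≫ M.X ◁ (N.r† ≫ N.r) ≫ proj M N := by
        rw [dag_incl, proj_r]; monoidal
    _ = incl M N ≫ proj M N := by rw [N.special_right]; monoidal
    _ = _ := by simp

/-- The relative tensor product `M ⊗_H N` of special bimodules. -/
noncomputable def rel (M N : SpecialBimod H) : SpecialBimod H where
  toBimod :=
    { X := relObj M N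
      actLeft := relL M N
      actRight := relR M N
      one_actLeft := by
        rw [← cancel_mono (incl M N), Category.assoc, relL_incl, ← whisker_exchange_assoc]
        have h := M.toBimod.one_actLeft
        calc _ = 𝟙_ C ◁ incl M N ⊗≫ (η[H.alg.X] ▷ M.X ≫ M.l) ▷ N.X := by monoidal
          _ = (λ_ _).hom ≫ incl M N := by rw [h]; monoidal
      left_assoc := by
        rw [← cancel_mono (incl M N)]
        simp only [Category.assoc]
        rw [relL_incl, ← whisker_exchange_assoc]
        have h := M.toBimod.left_assoc
        calc _ = (H.alg.X ⊗ H.alg.X) ◁ incl M N ⊗≫ (μ[H.alg.X] ▷ M.X ≫ M.l) ▷ N.X := by monoidal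
          _ = 𝟙 _ ⊗≫ H.alg.X ◁ (H.alg.X ◁ incl M N ≫ (α_ _ _ _).inv ≫ M.l ▷ N.X) ⊗≫
                M.l ▷ N.X := by rw [h]; monoidal
          _ = (α_ _ _ _).hom ≫ H.alg.X ◁ relL M N ≫
                (H.alg.X ◁ incl M N ≫ (α_ _ _ _).inv ≫ M.l ▷ N.X) := by
            rw [← relL_incl M N, whiskerLeft_comp, relL_incl M N]; monoidal
          _ = _ := by rw [← relL_incl]
      actRight_one := by
        rw [← cancel_mono (incl M N), Category.assoc, relR_incl, whisker_exchange_assoc]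
        have h := N.toBimod.actRight_one
        calc _ = incl M N ▷ 𝟙_ C ⊗≫ M.X ◁ (N.X ◁ η[H.alg.X] ≫ N.r) := by monoidal
          _ = (ρ_ _).hom ≫ incl M N := by rw [h]; monoidal
      right_assoc := by
        rw [← cancel_mono (incl M N)]
        simp only [Category.assoc]
        rw [relR_incl, whisker_exchange_assoc]
        have h := N.toBimod.right_assoc
        calc _ = incl M N ▷ (H.alg.X ⊗ H.alg.X) ⊗≫ M.X ◁ (N.X ◁ μ[H.alg.X] ≫ N.r) := by monoidal
          _ = 𝟙 _ ⊗≫ (incl M N ▷ H.alg.X ≫ (α_ _ _ _).hom ≫ M.X ◁ N.r) ▷ H.alg.X ⊗≫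
                M.X ◁ N.r := by rw [h]; monoidal
          _ = (α_ _ _ _).inv ≫ relR M N ▷ H.alg.X ≫
                (incl M N ▷ H.alg.X ≫ (α_ _ _ _).hom ≫ M.X ◁ N.r) := by
            rw [← relR_incl M N, comp_whiskerRight, relR_incl M N]; monoidal
          _ = _ := by rw [← relR_incl]
      middle_assoc := by
        rw [← cancel_mono (incl M N)]
        simp only [Category.assoc]
        rw [relR_incl, relL_incl]
        calc _ = (relL M N ≫ incl M N) ▷ H.alg.X ⊗≫ M.X ◁ N.r := by monoidal
          _ = 𝟙 _ ⊗≫ (H.alg.X ◁ incl M N) ▷ H.alg.X ⊗≫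
                (M.l ▷ (N.X ⊗ H.alg.X) ≫ M.X ◁ N.r) := by rw [relL_incl]; monoidal
          _ = 𝟙 _ ⊗≫ H.alg.X ◁ (incl M N ▷ H.alg.X ≫ (α_ _ _ _).hom ≫ M.X ◁ N.r) ⊗≫
                M.l ▷ N.X := by rw [← whisker_exchange]; monoidal
          _ = _ := by rw [← relR_incl]; monoidal }
  special_left := relL_special M N
  special_right := relR_special M N

/-- The chosen isometry `M ⊗_H N ⟶ M ⊗ N`, with source the object underlying `rel M N`. -/
noncomputable def emb (M N : SpecialBimod H) : (rel M N).X ⟶ M.X ⊗ N.X := incl M N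

@[simp] lemma emb_dag (M N : SpecialBimod H) : emb M N ≫ (emb M N)† = 𝟙 _ := incl_dag M N

@[simp] lemma dag_emb (M N : SpecialBimod H) : (emb M N)† ≫ emb M N = proj M N := dag_incl M N

@[simp] lemma emb_dag_assoc (M N : SpecialBimod H) {Z : C} (f : (rel M N).X ⟶ Z) :
    emb M N ≫ (emb M N)† ≫ f = f := by
  rw [← Category.assoc, emb_dag, Category.id_comp]

@[simp] lemma emb_proj (M N : SpecialBimod H) : emb M N ≫ proj M N = emb M N := by
  rw [← dag_emb, emb_dag_assoc]

lemma l_emb (M N : SpecialBimod H) :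
    (rel M N).l ≫ emb M N = H.alg.X ◁ emb M N ≫ (α_ _ _ _).inv ≫ M.l ▷ N.X := relL_incl M N

lemma r_emb (M N : SpecialBimod H) :
    (rel M N).r ≫ emb M N = emb M N ▷ H.alg.X ≫ (α_ _ _ _).hom ≫ M.X ◁ N.r := relR_incl M N

instance (M N : SpecialBimod H) : Mono (emb M N) :=
  inferInstanceAs (Mono (incl M N))

instance mono_whiskerLeft_emb (Z : C) (M N : SpecialBimod H) : Mono (Z ◁ emb M N) :=
  ⟨fun f g h => by
    have := congrArg (· ≫ Z ◁ (emb M N)†) h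
    simpa only [Category.assoc, ← whiskerLeft_comp, emb_dag, whiskerLeft_id, Category.comp_id]
      using this⟩

instance mono_whiskerRight_emb (Z : C) (M N : SpecialBimod H) : Mono (emb M N ▷ Z) :=
  ⟨fun f g h => by
    have := congrArg (· ≫ (emb M N)† ▷ Z) h
    simpa only [Category.assoc, ← comp_whiskerRight, emb_dag, id_whiskerRight, Category.comp_id]
      using this⟩

/-- `M ⊗_H g`. -/
noncomputable def relLeft (M : SpecialBimod H) {N N' : SpecialBimod H} (g : N ⟶ N') :
    (rel M N).X ⟶ (rel M N').X :=
  emb M N ≫ M.X ◁ hom g ≫ (emb M N')†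

/-- `f ⊗_H N`. -/
noncomputable def relRight {M M' : SpecialBimod H} (f : M ⟶ M') (N : SpecialBimod H) :
    (rel M N).X ⟶ (rel M' N).X :=
  emb M N ≫ hom f ▷ N.X ≫ (emb M' N)†

lemma relLeft_emb (M : SpecialBimod H) {N N' : SpecialBimod H} (g : N ⟶ N') :
    relLeft M g ≫ emb M N' = emb M N ≫ M.X ◁ hom g := by
  simp only [relLeft, Category.assoc, dag_emb]
  rw [← proj_right, ← Category.assoc, emb_proj]

lemma relRight_emb {M M' : SpecialBimod H} (f : M ⟶ M') (N : SpecialBimod H) :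
    relRight f N ≫ emb M' N = emb M N ≫ hom f ▷ N.X := by
  simp only [relRight, Category.assoc, dag_emb]
  rw [← proj_left, ← Category.assoc, emb_proj]

/-- `M ⊗_H g` as a bimodule map. -/
noncomputable def whiskL (M : SpecialBimod H) {N N' : SpecialBimod H} (g : N ⟶ N') :
    rel M N ⟶ rel M N' where
  hom := relLeft M g
  left_act_hom := by
    rw [← cancel_mono (emb M N')]
    simp only [Category.assoc]
    rw [relLeft_emb, l_emb, ← whiskerLeft_comp_assoc, relLeft_emb, ← Category.assoc,
      l_emb]
    simp only [Category.assoc, whiskerLeft_comp]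
    rw [← whisker_exchange]
    monoidal
  right_act_hom := by
    rw [← cancel_mono (emb M N')]
    simp only [Category.assoc]
    rw [relLeft_emb, r_emb, ← comp_whiskerRight_assoc, relLeft_emb, ← Category.assoc,
      r_emb]
    simp only [Category.assoc, comp_whiskerRight]
    rw [← whiskerLeft_comp, r_hom]
    monoidal

/-- `f ⊗_H N` as a bimodule map. -/
noncomputable def whiskR {M M' : SpecialBimod H} (f : M ⟶ M') (N : SpecialBimod H) :
    rel M N ⟶ rel M' N where
  hom := relRight f N
  left_act_hom := by
    rw [← cancel_mono (emb M' N)]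
    simp only [Category.assoc]
    rw [relRight_emb, l_emb, ← whiskerLeft_comp_assoc, relRight_emb, ← Category.assoc,
      l_emb]
    simp only [Category.assoc, whiskerLeft_comp]
    rw [← comp_whiskerRight, l_hom]
    monoidal
  right_act_hom := by
    rw [← cancel_mono (emb M' N)]
    simp only [Category.assoc]
    rw [relRight_emb, r_emb, ← comp_whiskerRight_assoc, relRight_emb, ← Category.assoc,
      r_emb]
    simp only [Category.assoc, comp_whiskerRight]
    rw [whisker_exchange]
    monoidal

lemma assoc_proj (M N P : SpecialBimod H) :
    proj (rel M N) P ≫ emb M N ▷ P.X ≫ (α_ _ _ _).hom =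
      emb M N ▷ P.X ≫ (α_ _ _ _).hom ≫ M.X ◁ proj N P := by
  calc _ = (rel M N).X ◁ P.l† ⊗≫ ((rel M N).r ≫ emb M N) ▷ P.X ⊗≫ 𝟙 _ := by
        rw [proj]
        monoidal
    _ = ((rel M N).X ◁ P.l† ≫ emb M N ▷ (H.alg.X ⊗ P.X)) ⊗≫ (M.X ◁ N.r) ▷ P.X ⊗≫ 𝟙 _ := by
        rw [r_emb]; monoidal
    _ = _ := by rw [whisker_exchange, proj]; monoidal

lemma assoc_proj' (M N P : SpecialBimod H) :
    proj M (rel N P) ≫ M.X ◁ emb N P ≫ (α_ _ _ _).inv =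
      M.X ◁ emb N P ≫ (α_ _ _ _).inv ≫ proj M N ▷ P.X := by
  calc _ = M.r† ▷ (rel N P).X ⊗≫ M.X ◁ ((rel N P).l ≫ emb N P) ⊗≫ 𝟙 _ := by
        rw [proj_eq]
        monoidal
    _ = (M.r† ▷ (rel N P).X ≫ (M.X ⊗ H.alg.X) ◁ emb N P) ⊗≫ (M.X ◁ N.l ▷ P.X) ⊗≫ 𝟙 _ := by
        rw [l_emb]; monoidal
    _ = _ := by rw [← whisker_exchange, proj_eq]; monoidal

/-- The isometry `(M ⊗_H N) ⊗_H P ⟶ (M ⊗ N) ⊗ P`. -/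
noncomputable def inclL (M N P : SpecialBimod H) :
    (rel (rel M N) P).X ⟶ (M.X ⊗ N.X) ⊗ P.X := emb (rel M N) P ≫ emb M N ▷ P.X

/-- The isometry `M ⊗_H (N ⊗_H P) ⟶ M ⊗ (N ⊗ P)`. -/
noncomputable def inclR (M N P : SpecialBimod H) :
    (rel M (rel N P)).X ⟶ M.X ⊗ (N.X ⊗ P.X) := emb M (rel N P) ≫ M.X ◁ emb N P

instance (M N P : SpecialBimod H) : Mono (inclL M N P) := by
  have : Mono (emb M N ▷ P.X) := inferInstance
  exact mono_comp (emb (rel M N) P) (emb M N ▷ P.X)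

instance (M N P : SpecialBimod H) : Mono (inclR M N P) := by
  have : Mono (M.X ◁ emb N P) := inferInstance
  exact mono_comp (emb M (rel N P)) (M.X ◁ emb N P)

lemma inclL_proj (M N P : SpecialBimod H) :
    inclL M N P ≫ (α_ _ _ _).hom ≫ M.X ◁ proj N P = inclL M N P ≫ (α_ _ _ _).hom := by
  rw [inclL, Category.assoc, ← assoc_proj, Category.assoc, ← Category.assoc]
  rw [emb_proj]

lemma inclR_proj (M N P : SpecialBimod H) :
    inclR M N P ≫ (α_ _ _ _).inv ≫ proj M N ▷ P.X = inclR M N P ≫ (α_ _ _ _).inv := by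
  rw [inclR, Category.assoc, ← assoc_proj', Category.assoc, ← Category.assoc]
  rw [emb_proj]

lemma inclL_projL (M N P : SpecialBimod H) :
    inclL M N P ≫ proj M N ▷ P.X = inclL M N P := by
  rw [inclL, Category.assoc, ← comp_whiskerRight, emb_proj]

lemma inclR_projR (M N P : SpecialBimod H) :
    inclR M N P ≫ M.X ◁ proj N P = inclR M N P := by
  rw [inclR, Category.assoc, ← whiskerLeft_comp, emb_proj]

/-- The associator of the relative tensor product, on underlying objects. -/
noncomputable def relAssoc (M N P : SpecialBimod H) :
    (rel (rel M N) P).X ⟶ (rel M (rel N P)).X :=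
  inclL M N P ≫ (α_ _ _ _).hom ≫ (inclR M N P)†

/-- The inverse of the associator, on underlying objects. -/
noncomputable def relAssocInv (M N P : SpecialBimod H) :
    (rel M (rel N P)).X ⟶ (rel (rel M N) P).X :=
  inclR M N P ≫ (α_ _ _ _).inv ≫ (inclL M N P)†

lemma relAssoc_incl (M N P : SpecialBimod H) :
    relAssoc M N P ≫ inclR M N P = inclL M N P ≫ (α_ _ _ _).hom := by
  have h := congrArg StarNorm.dag (assoc_proj' M N P)
  simp only [dag_comp, proj_dag, dag_whiskerLeft, dag_whiskerRight, dag_associator_inv,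
    Category.assoc] at h
  have h' : (inclR M N P)† ≫ inclR M N P = M.X ◁ (emb N P)† ≫ proj M (rel N P) ≫
      M.X ◁ emb N P := by
    simp only [inclR, dag_comp, dag_whiskerLeft, Category.assoc]
    rw [← dag_emb M (rel N P)]
    simp only [Category.assoc]
  rw [relAssoc, Category.assoc, Category.assoc, h']
  calc _ = inclL M N P ≫ ((α_ _ _ _).hom ≫ M.X ◁ (emb N P)† ≫ proj M (rel N P)) ≫
        M.X ◁ emb N P := by simp only [Category.assoc]
    _ = (inclL M N P ≫ proj M N ▷ P.X) ≫ (α_ _ _ _).hom ≫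
        M.X ◁ ((emb N P)† ≫ emb N P) := by
        rw [h]; simp only [Category.assoc, whiskerLeft_comp]
    _ = _ := by rw [inclL_projL, dag_emb, inclL_proj]

lemma relAssocInv_incl (M N P : SpecialBimod H) :
    relAssocInv M N P ≫ inclL M N P = inclR M N P ≫ (α_ _ _ _).inv := by
  have h := congrArg StarNorm.dag (assoc_proj M N P)
  simp only [dag_comp, proj_dag, dag_whiskerLeft, dag_whiskerRight, dag_associator_hom,
    Category.assoc] at h
  have h' : (inclL M N P)† ≫ inclL M N P = (emb M N)† ▷ P.X ≫ proj (rel M N) P ≫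
      emb M N ▷ P.X := by
    simp only [inclL, dag_comp, dag_whiskerRight, Category.assoc]
    rw [← dag_emb (rel M N) P]
    simp only [Category.assoc]
  rw [relAssocInv, Category.assoc, Category.assoc, h']
  calc _ = inclR M N P ≫ ((α_ _ _ _).inv ≫ (emb M N)† ▷ P.X ≫ proj (rel M N) P) ≫
        emb M N ▷ P.X := by simp only [Category.assoc]
    _ = (inclR M N P ≫ M.X ◁ proj N P) ≫ (α_ _ _ _).inv ≫
        ((emb M N)† ≫ emb M N) ▷ P.X := by
        rw [h]; simp only [Category.assoc, comp_whiskerRight]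
    _ = _ := by rw [inclR_projR, dag_emb, inclR_proj]

/-- The associator `(M ⊗_H N) ⊗_H P ⟶ M ⊗_H (N ⊗_H P)`. -/
noncomputable def assocHom (M N P : SpecialBimod H) : rel (rel M N) P ⟶ rel M (rel N P) where
  hom := relAssoc M N P
  left_act_hom := by
    rw [← cancel_mono (inclR M N P)]
    simp only [Category.assoc]
    rw [relAssoc_incl]
    calc _ = ((rel (rel M N) P).l ≫ emb (rel M N) P) ≫ emb M N ▷ P.X ⊗≫ 𝟙 _ := by
          rw [inclL]; monoidal
      _ = H.alg.X ◁ emb (rel M N) P ⊗≫ ((rel M N).l ≫ emb M N) ▷ P.X ⊗≫ 𝟙 _ := by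
          rw [l_emb]; monoidal
      _ = H.alg.X ◁ (inclL M N P ≫ (α_ _ _ _).hom) ⊗≫ M.l ▷ N.X ▷ P.X ⊗≫ 𝟙 _ := by
          rw [l_emb, inclL]; monoidal
      _ = H.alg.X ◁ relAssoc M N P ⊗≫ H.alg.X ◁ emb M (rel N P) ⊗≫
            ((H.alg.X ⊗ M.X) ◁ emb N P ≫ M.l ▷ (N.X ⊗ P.X)) := by
          rw [← relAssoc_incl, inclR]; monoidal
      _ = H.alg.X ◁ relAssoc M N P ⊗≫ (H.alg.X ◁ emb M (rel N P) ≫ (α_ _ _ _).inv ≫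
            M.l ▷ (rel N P).X) ≫ M.X ◁ emb N P := by
          rw [whisker_exchange]; monoidal
      _ = _ := by
          rw [← l_emb, inclR]; monoidal
  right_act_hom := by
    rw [← cancel_mono (inclR M N P)]
    simp only [Category.assoc]
    rw [relAssoc_incl]
    calc _ = ((rel (rel M N) P).r ≫ emb (rel M N) P) ≫ emb M N ▷ P.X ⊗≫ 𝟙 _ := by
          rw [inclL]; monoidal
      _ = emb (rel M N) P ▷ H.alg.X ⊗≫
            ((rel M N).X ◁ P.r ≫ emb M N ▷ P.X) ⊗≫ 𝟙 _ := by
          rw [r_emb]; monoidal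
      _ = (inclL M N P ≫ (α_ _ _ _).hom) ▷ H.alg.X ⊗≫ M.X ◁ N.X ◁ P.r := by
          rw [whisker_exchange, inclL]; monoidal
      _ = relAssoc M N P ▷ H.alg.X ⊗≫ emb M (rel N P) ▷ H.alg.X ⊗≫
            M.X ◁ (emb N P ▷ H.alg.X ≫ (α_ _ _ _).hom ≫ N.X ◁ P.r) := by
          rw [← relAssoc_incl, inclR]; monoidal
      _ = relAssoc M N P ▷ H.alg.X ⊗≫ (emb M (rel N P) ▷ H.alg.X ≫ (α_ _ _ _).hom ≫
            M.X ◁ (rel N P).r) ≫ M.X ◁ emb N P := by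
          rw [← r_emb]; monoidal
      _ = _ := by
          rw [← r_emb, inclR]; monoidal

lemma relAssoc_dag (M N P : SpecialBimod H) : (relAssoc M N P)† = relAssocInv M N P := by
  simp [relAssoc, relAssocInv]

/-- The associator of the relative tensor product; its inverse is its adjoint. -/
noncomputable def assocIso (M N P : SpecialBimod H) : rel (rel M N) P ≅ rel M (rel N P) where
  hom := assocHom M N P
  inv := (assocHom M N P)†
  hom_inv_id := by
    apply hom_ext
    change relAssoc M N P ≫ (relAssoc M N P)† = 𝟙 _
    rw [relAssoc_dag, ← cancel_mono (inclL M N P), Category.assoc, relAssocInv_incl,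
      ← Category.assoc, relAssoc_incl]
    simp
  inv_hom_id := by
    apply hom_ext
    change (relAssoc M N P)† ≫ relAssoc M N P = 𝟙 _
    rw [relAssoc_dag, ← cancel_mono (inclR M N P), Category.assoc, relAssoc_incl,
      ← Category.assoc, relAssocInv_incl]
    simp

variable (H) in
/-- The unit bimodule `H`. -/
def unitBimod : SpecialBimod H where
  toBimod := Bimod.regular H.alg
  special_left := H.special
  special_right := H.special

lemma proj_unit_left (M : SpecialBimod H) : proj (unitBimod H) M = M.l ≫ M.l† := by
  rw [proj_eq, ← left_frob]; rfl

lemma proj_unit_right (M : SpecialBimod H) : proj M (unitBimod H) = M.r ≫ M.r† := by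
  rw [proj, ← right_frob]; rfl

/-- The isometry `H ⊗_H M ⟶ H ⊗ M`. -/
noncomputable def embU (M : SpecialBimod H) : (rel (unitBimod H) M).X ⟶ H.alg.X ⊗ M.X :=
  emb (unitBimod H) M

/-- The isometry `M ⊗_H H ⟶ M ⊗ H`. -/
noncomputable def embV (M : SpecialBimod H) : (rel M (unitBimod H)).X ⟶ M.X ⊗ H.alg.X :=
  emb M (unitBimod H)

lemma embU_dag (M : SpecialBimod H) : embU M ≫ (embU M)† = 𝟙 _ := emb_dag _ _

lemma embV_dag (M : SpecialBimod H) : embV M ≫ (embV M)† = 𝟙 _ := emb_dag _ _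

lemma dag_embU (M : SpecialBimod H) : (embU M)† ≫ embU M = M.l ≫ M.l† :=
  (dag_emb _ _).trans (proj_unit_left M)

lemma dag_embV (M : SpecialBimod H) : (embV M)† ≫ embV M = M.r ≫ M.r† :=
  (dag_emb _ _).trans (proj_unit_right M)

lemma embU_proj (M : SpecialBimod H) : embU M ≫ M.l ≫ M.l† = embU M := by
  rw [← dag_embU, ← Category.assoc, embU_dag, Category.id_comp]

lemma embV_proj (M : SpecialBimod H) : embV M ≫ M.r ≫ M.r† = embV M := by
  rw [← dag_embV, ← Category.assoc, embV_dag, Category.id_comp]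

lemma l_embU (M : SpecialBimod H) : (rel (unitBimod H) M).l ≫ embU M =
    H.alg.X ◁ embU M ≫ (α_ _ _ _).inv ≫ μ[H.alg.X] ▷ M.X := l_emb (unitBimod H) M

lemma r_embU (M : SpecialBimod H) : (rel (unitBimod H) M).r ≫ embU M =
    embU M ▷ H.alg.X ≫ (α_ _ _ _).hom ≫ H.alg.X ◁ M.r := r_emb (unitBimod H) M

lemma l_embV (M : SpecialBimod H) : (rel M (unitBimod H)).l ≫ embV M =
    H.alg.X ◁ embV M ≫ (α_ _ _ _).inv ≫ M.l ▷ H.alg.X := l_emb M (unitBimod H)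

lemma r_embV (M : SpecialBimod H) : (rel M (unitBimod H)).r ≫ embV M =
    embV M ▷ H.alg.X ≫ (α_ _ _ _).hom ≫ M.X ◁ μ[H.alg.X] := r_emb M (unitBimod H)

/-- The left unitor `H ⊗_H M ⟶ M`, induced by the left action. -/
noncomputable def leftUnitHom (M : SpecialBimod H) : rel (unitBimod H) M ⟶ M where
  hom := embU M ≫ M.l
  left_act_hom := by
    rw [← Category.assoc, l_embU]
    simp only [Category.assoc, whiskerLeft_comp]
    rw [M.toBimod.left_assoc, Iso.inv_hom_id_assoc]
  right_act_hom := by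
    rw [← Category.assoc, r_embU]
    simp only [Category.assoc, comp_whiskerRight]
    rw [M.toBimod.middle_assoc]

/-- The right unitor `M ⊗_H H ⟶ M`, induced by the right action. -/
noncomputable def rightUnitHom (M : SpecialBimod H) : rel M (unitBimod H) ⟶ M where
  hom := embV M ≫ M.r
  left_act_hom := by
    rw [← Category.assoc, l_embV]
    simp only [Category.assoc, whiskerLeft_comp]
    rw [M.toBimod.middle_assoc, Iso.inv_hom_id_assoc]
  right_act_hom := by
    rw [← Category.assoc, r_embV]
    simp only [Category.assoc, comp_whiskerRight]
    rw [M.toBimod.right_assoc, Iso.hom_inv_id_assoc]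

/-- The left unitor; its inverse is its adjoint. -/
noncomputable def leftUnitIso (M : SpecialBimod H) : rel (unitBimod H) M ≅ M where
  hom := leftUnitHom M
  inv := (leftUnitHom M)†
  hom_inv_id := by
    apply hom_ext
    change (embU M ≫ M.l) ≫ (embU M ≫ M.l)† = 𝟙 _
    rw [dag_comp, Category.assoc, ← Category.assoc M.l, ← Category.assoc, embU_proj, embU_dag]
  inv_hom_id := by
    apply hom_ext
    change (embU M ≫ M.l)† ≫ (embU M ≫ M.l) = 𝟙 _
    rw [dag_comp, Category.assoc, ← Category.assoc (embU M)†, dag_embU, Category.assoc,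
      M.special_left, Category.comp_id, M.special_left]

/-- The right unitor; its inverse is its adjoint. -/
noncomputable def rightUnitIso (M : SpecialBimod H) : rel M (unitBimod H) ≅ M where
  hom := rightUnitHom M
  inv := (rightUnitHom M)†
  hom_inv_id := by
    apply hom_ext
    change (embV M ≫ M.r) ≫ (embV M ≫ M.r)† = 𝟙 _
    rw [dag_comp, Category.assoc, ← Category.assoc M.r, ← Category.assoc, embV_proj, embV_dag]
  inv_hom_id := by
    apply hom_ext
    change (embV M ≫ M.r)† ≫ (embV M ≫ M.r) = 𝟙 _
    rw [dag_comp, Category.assoc, ← Category.assoc (embV M)†, dag_embV, Category.assoc,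
      M.special_right, Category.comp_id, M.special_right]

/-- The tensor structure on special `H`-`H`-bimodules given by the relative tensor product. -/
noncomputable instance : MonoidalCategoryStruct (SpecialBimod H) where
  tensorObj M N := rel M N
  whiskerLeft M _ _ g := whiskL M g
  whiskerRight f N := whiskR f N
  tensorUnit := unitBimod H
  associator := assocIso
  leftUnitor := leftUnitIso
  rightUnitor := rightUnitIso

/-- The isometry `M ⊗ N ⟶ M ⊗ N` from the relative tensor product to the tensor product in `C`. -/
noncomputable def j (M N : SpecialBimod H) : (M ⊗ N).X ⟶ M.X ⊗ N.X := emb M N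

/-- `j` for the unit bimodule on the left. -/
noncomputable def jU (M : SpecialBimod H) : (𝟙_ (SpecialBimod H) ⊗ M).X ⟶ H.alg.X ⊗ M.X := embU M

/-- `j` for the unit bimodule on the right. -/
noncomputable def jV (M : SpecialBimod H) : (M ⊗ 𝟙_ (SpecialBimod H)).X ⟶ M.X ⊗ H.alg.X := embV M

lemma j_dag (M N : SpecialBimod H) : j M N ≫ (j M N)† = 𝟙 _ := emb_dag M N

lemma j_proj (M N : SpecialBimod H) : j M N ≫ proj M N = j M N := emb_proj M N

lemma jU_proj (M : SpecialBimod H) : jU M ≫ M.l ≫ M.l† = jU M := embU_proj M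

lemma jV_proj (M : SpecialBimod H) : jV M ≫ M.r ≫ M.r† = jV M := embV_proj M

lemma j_mono (M N : SpecialBimod H) : Mono (j M N) := inferInstanceAs (Mono (emb M N))

lemma hom_whiskerLeft (M : SpecialBimod H) {N N' : SpecialBimod H} (g : N ⟶ N') :
    hom (M ◁ g) ≫ j M N' = j M N ≫ M.X ◁ hom g := relLeft_emb M g

lemma hom_whiskerRight {M M' : SpecialBimod H} (f : M ⟶ M') (N : SpecialBimod H) :
    hom (f ▷ N) ≫ j M' N = j M N ≫ hom f ▷ N.X := relRight_emb f N

lemma hom_unit_whiskerLeft {N N' : SpecialBimod H} (g : N ⟶ N') :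
    hom (𝟙_ (SpecialBimod H) ◁ g) ≫ jU N' = jU N ≫ H.alg.X ◁ hom g :=
  relLeft_emb (unitBimod H) g

lemma hom_whiskerRight_unit {M M' : SpecialBimod H} (f : M ⟶ M') :
    hom (f ▷ 𝟙_ (SpecialBimod H)) ≫ jV M' = jV M ≫ hom f ▷ H.alg.X :=
  relRight_emb f (unitBimod H)

lemma hom_tensorHom {M M' N N' : SpecialBimod H} (f : M ⟶ M') (g : N ⟶ N') :
    hom (f ⊗ₘ g) ≫ j M' N' = j M N ≫ (hom f ⊗ₘ hom g) := by
  change (hom (f ▷ N) ≫ hom (M' ◁ g)) ≫ _ = _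
  rw [Category.assoc, hom_whiskerLeft, ← Category.assoc, hom_whiskerRight,
    MonoidalCategory.tensorHom_def, Category.assoc]

lemma hom_associator (M N P : SpecialBimod H) :
    hom (α_ M N P).hom ≫ j M (N ⊗ P) ≫ M.X ◁ j N P =
      j (M ⊗ N) P ≫ j M N ▷ P.X ≫ (α_ _ _ _).hom := by
  have h := relAssoc_incl M N P
  simp only [inclR, inclL, Category.assoc] at h
  exact h

/-- The associator with the unit bimodule in the middle. -/
lemma hom_associator_unit (M N : SpecialBimod H) :
    hom (α_ M (𝟙_ (SpecialBimod H)) N).hom ≫ j M (𝟙_ (SpecialBimod H) ⊗ N) ≫ M.X ◁ jU N =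
      j (M ⊗ 𝟙_ (SpecialBimod H)) N ≫ jV M ▷ N.X ≫ (α_ _ _ _).hom :=
  hom_associator M (unitBimod H) N

lemma hom_leftUnitor (M : SpecialBimod H) : hom (λ_ M).hom = jU M ≫ M.l := rfl

lemma hom_rightUnitor (M : SpecialBimod H) : hom (ρ_ M).hom = jV M ≫ M.r := rfl

lemma ext_j {M N P : SpecialBimod H} {f g : M ⟶ N ⊗ P}
    (h : hom f ≫ j N P = hom g ≫ j N P) : f = g :=
  have := j_mono N P
  hom_ext ((cancel_mono (j N P)).1 h)

lemma ext_j₃ {M N P Q : SpecialBimod H} {f g : M ⟶ N ⊗ (P ⊗ Q)}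
    (h : hom f ≫ j N (P ⊗ Q) ≫ N.X ◁ j P Q = hom g ≫ j N (P ⊗ Q) ≫ N.X ◁ j P Q) :
    f = g :=
  hom_ext ((cancel_mono (inclR N P Q)).1 h)

lemma ext_j₄ {M N P Q R : SpecialBimod H} {f g : M ⟶ N ⊗ (P ⊗ (Q ⊗ R))}
    (h : hom f ≫ j N (P ⊗ (Q ⊗ R)) ≫ N.X ◁ j P (Q ⊗ R) ≫ N.X ◁ P.X ◁ j Q R =
      hom g ≫ j N (P ⊗ (Q ⊗ R)) ≫ N.X ◁ j P (Q ⊗ R) ≫ N.X ◁ P.X ◁ j Q R) :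
    f = g := by
  apply ext_j₃
  have h' := congrArg (· ≫ N.X ◁ P.X ◁ (j Q R)†) h
  simpa only [Category.assoc, ← whiskerLeft_comp, j_dag, whiskerLeft_id, Category.comp_id] using h'

lemma assoc_nat {M₁ M₂ M₃ N₁ N₂ N₃ : SpecialBimod H} (f₁ : M₁ ⟶ N₁) (f₂ : M₂ ⟶ N₂)
    (f₃ : M₃ ⟶ N₃) :
    ((f₁ ⊗ₘ f₂) ⊗ₘ f₃) ≫ (α_ N₁ N₂ N₃).hom = (α_ M₁ M₂ M₃).hom ≫ (f₁ ⊗ₘ (f₂ ⊗ₘ f₃)) := by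
  apply ext_j₃
  simp only [hom_comp, Category.assoc]
  rw [hom_associator]
  calc _ = (hom ((f₁ ⊗ₘ f₂) ⊗ₘ f₃) ≫ j (N₁ ⊗ N₂) N₃) ≫ j N₁ N₂ ▷ N₃.X ≫ (α_ _ _ _).hom := by
        rw [Category.assoc]
    _ = j (M₁ ⊗ M₂) M₃ ≫ ((hom (f₁ ⊗ₘ f₂) ≫ j N₁ N₂) ⊗ₘ hom f₃) ≫ (α_ _ _ _).hom := by
        rw [hom_tensorHom, Category.assoc, ← tensorHom_id, tensorHom_comp_tensorHom_assoc,
          Category.comp_id]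
    _ = j (M₁ ⊗ M₂) M₃ ≫ j M₁ M₂ ▷ M₃.X ≫ ((hom f₁ ⊗ₘ hom f₂) ⊗ₘ hom f₃) ≫
          (α_ _ _ _).hom := by
        rw [hom_tensorHom, ← tensorHom_id, tensorHom_comp_tensorHom_assoc, Category.id_comp]
    _ = (j (M₁ ⊗ M₂) M₃ ≫ j M₁ M₂ ▷ M₃.X ≫ (α_ _ _ _).hom) ≫
          (hom f₁ ⊗ₘ (hom f₂ ⊗ₘ hom f₃)) := by
        rw [associator_naturality]; simp only [Category.assoc]
    _ = hom (α_ M₁ M₂ M₃).hom ≫ j M₁ (M₂ ⊗ M₃) ≫ (hom f₁ ⊗ₘ (j M₂ M₃ ≫ (hom f₂ ⊗ₘ hom f₃))) := by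
        rw [← hom_associator]
        simp only [Category.assoc]
        rw [← id_tensorHom, tensorHom_comp_tensorHom, Category.id_comp]
    _ = hom (α_ M₁ M₂ M₃).hom ≫ (j M₁ (M₂ ⊗ M₃) ≫ (hom f₁ ⊗ₘ hom (f₂ ⊗ₘ f₃))) ≫
          N₁.X ◁ j N₂ N₃ := by
        rw [← hom_tensorHom, Category.assoc, ← id_tensorHom, tensorHom_comp_tensorHom,
          Category.comp_id]
    _ = _ := by
        rw [← hom_tensorHom, Category.assoc]

lemma pentagon_aux (M N P Q : SpecialBimod H) :
    (α_ M N P).hom ▷ Q ≫ (α_ M (N ⊗ P) Q).hom ≫ M ◁ (α_ N P Q).hom =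
      (α_ (M ⊗ N) P Q).hom ≫ (α_ M N (P ⊗ Q)).hom := by
  apply ext_j₄
  simp only [hom_comp, Category.assoc]
  have hL : hom ((α_ M N P).hom ▷ Q) ≫ hom (α_ M (N ⊗ P) Q).hom ≫ hom (M ◁ (α_ N P Q).hom) ≫
      j M (N ⊗ (P ⊗ Q)) ≫ M.X ◁ j N (P ⊗ Q) ≫ M.X ◁ N.X ◁ j P Q =
      j ((M ⊗ N) ⊗ P) Q ≫ j (M ⊗ N) P ▷ Q.X ≫ j M N ▷ P.X ▷ Q.X ≫ (α_ _ _ _).hom ▷ Q.X ≫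
        (α_ _ _ _).hom ≫ M.X ◁ (α_ _ _ _).hom := by
    calc _ = hom ((α_ M N P).hom ▷ Q) ≫ hom (α_ M (N ⊗ P) Q).hom ≫ (hom (M ◁ (α_ N P Q).hom) ≫
        j M (N ⊗ (P ⊗ Q))) ≫ M.X ◁ j N (P ⊗ Q) ≫ M.X ◁ N.X ◁ j P Q := by
          simp only [Category.assoc]
      _ = hom ((α_ M N P).hom ▷ Q) ≫ hom (α_ M (N ⊗ P) Q).hom ≫ j M ((N ⊗ P) ⊗ Q) ≫
          M.X ◁ (hom (α_ N P Q).hom ≫ j N (P ⊗ Q) ≫ N.X ◁ j P Q) := by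
          rw [hom_whiskerLeft]; simp only [Category.assoc, whiskerLeft_comp]
      _ = hom ((α_ M N P).hom ▷ Q) ≫ (hom (α_ M (N ⊗ P) Q).hom ≫ j M ((N ⊗ P) ⊗ Q) ≫
          M.X ◁ j (N ⊗ P) Q) ≫ M.X ◁ j N P ▷ Q.X ≫ M.X ◁ (α_ _ _ _).hom := by
          rw [hom_associator]; simp only [Category.assoc, whiskerLeft_comp]
      _ = (hom ((α_ M N P).hom ▷ Q) ≫ j (M ⊗ (N ⊗ P)) Q) ≫ j M (N ⊗ P) ▷ Q.X ≫
          (M.X ◁ j N P) ▷ Q.X ≫ (α_ _ _ _).hom ≫ M.X ◁ (α_ _ _ _).hom := by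
          rw [hom_associator]; simp only [Category.assoc]
          rw [associator_naturality_middle_assoc]
      _ = j ((M ⊗ N) ⊗ P) Q ≫ (hom (α_ M N P).hom ≫ j M (N ⊗ P) ≫ M.X ◁ j N P) ▷ Q.X ≫
          (α_ _ _ _).hom ≫ M.X ◁ (α_ _ _ _).hom := by
          rw [hom_whiskerRight]; simp only [Category.assoc, comp_whiskerRight]
      _ = _ := by
          rw [hom_associator]; simp only [Category.assoc, comp_whiskerRight]
  have hR : hom (α_ (M ⊗ N) P Q).hom ≫ hom (α_ M N (P ⊗ Q)).hom ≫
      j M (N ⊗ (P ⊗ Q)) ≫ M.X ◁ j N (P ⊗ Q) ≫ M.X ◁ N.X ◁ j P Q =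
      j ((M ⊗ N) ⊗ P) Q ≫ j (M ⊗ N) P ▷ Q.X ≫ j M N ▷ P.X ▷ Q.X ≫
        (α_ _ _ _).hom ≫ (α_ _ _ _).hom := by
    calc _ = hom (α_ (M ⊗ N) P Q).hom ≫ (hom (α_ M N (P ⊗ Q)).hom ≫
        j M (N ⊗ (P ⊗ Q)) ≫ M.X ◁ j N (P ⊗ Q)) ≫ M.X ◁ N.X ◁ j P Q := by
          simp only [Category.assoc]
      _ = hom (α_ (M ⊗ N) P Q).hom ≫ j (M ⊗ N) (P ⊗ Q) ≫ (j M N ▷ (P ⊗ Q).X ≫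
          (M.X ⊗ N.X) ◁ j P Q) ≫ (α_ _ _ _).hom := by
          rw [hom_associator]; simp only [Category.assoc, associator_naturality_right]
      _ = (hom (α_ (M ⊗ N) P Q).hom ≫ j (M ⊗ N) (P ⊗ Q) ≫ (M ⊗ N).X ◁ j P Q) ≫
          j M N ▷ (P.X ⊗ Q.X) ≫ (α_ _ _ _).hom := by
          rw [← whisker_exchange]; simp only [Category.assoc]
      _ = _ := by
          rw [hom_associator]; simp only [Category.assoc]
          rw [associator_naturality_left_assoc]
  rw [hL, hR, MonoidalCategory.pentagon]

lemma triangle_aux (M N : SpecialBimod H) :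
    (α_ M (𝟙_ (SpecialBimod H)) N).hom ≫ M ◁ (λ_ N).hom = (ρ_ M).hom ▷ N := by
  apply ext_j
  simp only [hom_comp, Category.assoc]
  have h1 : hom ((ρ_ M).hom ▷ N) ≫ j M N =
      j (M ⊗ 𝟙_ (SpecialBimod H)) N ≫ hom (ρ_ M).hom ▷ N.X := hom_whiskerRight _ _
  calc _ = (hom (α_ M (𝟙_ (SpecialBimod H)) N).hom ≫ j M (𝟙_ (SpecialBimod H) ⊗ N) ≫
        M.X ◁ jU N) ≫ M.X ◁ N.l := by
        rw [hom_whiskerLeft, hom_leftUnitor, whiskerLeft_comp]; simp only [Category.assoc]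
    _ = j (M ⊗ 𝟙_ (SpecialBimod H)) N ≫ (jV M ≫ M.r ≫ M.r†) ▷ N.X ≫ (α_ _ _ _).hom ≫
          M.X ◁ N.l := by
        rw [hom_associator_unit, jV_proj]; simp only [Category.assoc]
    _ = j (M ⊗ 𝟙_ (SpecialBimod H)) N ≫ hom (ρ_ M).hom ▷ N.X ≫ proj M N := by
        rw [hom_rightUnitor, proj_eq]; simp only [Category.assoc, comp_whiskerRight]
    _ = hom ((ρ_ M).hom ▷ N) ≫ j M N ≫ proj M N := by
        rw [← Category.assoc, ← h1, Category.assoc]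
    _ = _ := by rw [j_proj]

/-- Special `H`-`H`-bimodules with the relative tensor product over `H` form a monoidal
category. -/
noncomputable instance : MonoidalCategory (SpecialBimod H) where
  tensorHom_def _ _ := rfl
  id_tensorHom_id M N := by
    apply ext_j
    rw [hom_tensorHom, hom_id, hom_id, id_tensorHom_id, hom_id, Category.id_comp, Category.comp_id]
  tensorHom_comp_tensorHom f₁ f₂ g₁ g₂ := by
    apply ext_j
    rw [hom_comp, Category.assoc, hom_tensorHom, ← Category.assoc, hom_tensorHom, hom_tensorHom,
      Category.assoc, tensorHom_comp_tensorHom, hom_comp, hom_comp]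
  whiskerLeft_id M N := by
    apply ext_j
    rw [hom_whiskerLeft, hom_id, whiskerLeft_id, hom_id, Category.id_comp, Category.comp_id]
  id_whiskerRight M N := by
    apply ext_j
    rw [hom_whiskerRight, hom_id, id_whiskerRight, hom_id, Category.id_comp, Category.comp_id]
  associator_naturality := assoc_nat
  leftUnitor_naturality {M N} f := by
    apply hom_ext
    rw [hom_comp, hom_comp, hom_leftUnitor, hom_leftUnitor, ← Category.assoc,
      hom_unit_whiskerLeft, Category.assoc, Category.assoc, l_hom]
  rightUnitor_naturality {M N} f := by
    apply hom_ext
    rw [hom_comp, hom_comp, hom_rightUnitor, hom_rightUnitor, ← Category.assoc,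
      hom_whiskerRight_unit, Category.assoc, Category.assoc, r_hom]
  pentagon := pentagon_aux
  triangle := triangle_aux

section LinearStructure

variable (M N : SpecialBimod H)

/-- Bimodule maps as a linear subspace of the morphisms in `C`. -/
def homSubmodule : Submodule ℂ (M.X ⟶ N.X) where
  carrier := {f | M.l ≫ f = H.alg.X ◁ f ≫ N.l ∧ M.r ≫ f = f ▷ H.alg.X ≫ N.r}
  add_mem' := by
    rintro f g ⟨hf, hf'⟩ ⟨hg, hg'⟩
    constructor
    · rw [Preadditive.comp_add, hf, hg, MonoidalPreadditive.whiskerLeft_add, Preadditive.add_comp]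
    · rw [Preadditive.comp_add, hf', hg', MonoidalPreadditive.add_whiskerRight,
        Preadditive.add_comp]
  zero_mem' := by simp
  smul_mem' := by
    rintro c f ⟨hf, hf'⟩
    constructor
    · rw [Linear.comp_smul, hf, MonoidalLinear.whiskerLeft_smul, Linear.smul_comp]
    · rw [Linear.comp_smul, hf', MonoidalLinear.smul_whiskerRight, Linear.smul_comp]

/-- Bimodule maps are the elements of `homSubmodule`. -/
def homEquiv : (M ⟶ N) ≃ homSubmodule M N where
  toFun f := ⟨hom f, l_hom f, r_hom f⟩
  invFun f := { hom := f.1, left_act_hom := f.2.1, right_act_hom := f.2.2 }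
  left_inv _ := rfl
  right_inv _ := rfl

/-- The additive structure on bimodule maps is inherited from `C`. -/
instance : AddCommGroup (M ⟶ N) := (homEquiv M N).addCommGroup

/-- The linear structure on bimodule maps is inherited from `C`. -/
instance : Module ℂ (M ⟶ N) := (homEquiv M N).module ℂ

variable {M N}

@[simp] lemma hom_add (f g : M ⟶ N) : hom (f + g) = hom f + hom g := rfl

@[simp] lemma hom_smul (c : ℂ) (f : M ⟶ N) : hom (c • f) = c • hom f := rfl

instance : Preadditive (SpecialBimod H) where
  add_comp _ _ _ f f' g := by
    apply hom_ext
    change (hom f + hom f') ≫ hom g = hom f ≫ hom g + hom f' ≫ hom g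
    rw [Preadditive.add_comp]
  comp_add _ _ _ f g g' := by
    apply hom_ext
    change hom f ≫ (hom g + hom g') = hom f ≫ hom g + hom f ≫ hom g'
    rw [Preadditive.comp_add]

instance : Linear ℂ (SpecialBimod H) where
  smul_comp _ _ _ c f g := by
    apply hom_ext
    change (c • hom f) ≫ hom g = c • (hom f ≫ hom g)
    rw [Linear.smul_comp]
  comp_smul _ _ _ f c g := by
    apply hom_ext
    change hom f ≫ (c • hom g) = c • (hom f ≫ hom g)
    rw [Linear.comp_smul]

end LinearStructure

end SpecialBimod

end CStarTensor

/-!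
An indecomposable multitensor C*-category `C` behaves like an algebra of matrices of categories
`C i k`, indexed by the simple summands `U i` of the tensor unit, in which each diagonal corner
`C i i` is a tensor C*-category and none of the off-diagonal entries vanishes. The
theorem is a Morita equivalence between `C` and one of the diagonal corners `C₀ = Corner P`.

*Finiteness.* For `Z` supported on a simple summand `U` of the unit, `Hom(U, Z)` is a pre-Hilbert
space. The size of an orthonormal family in it is bounded by a solution of the conjugate equations
(`card_le_of_orthonormal`), so it is finite-dimensional; Frobenius reciprocity then makes `End Y`
finite-dimensional for `Y` supported on `U` (`finite_end_of_lact`). Spectral projections split such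
objects, and the unit itself, into orthogonal sums of objects with scalar endomorphisms
(`exists_orthogonal_decomposition`).

*The generator.* A projection of the unit which acts in the same way from the left and from the
right splits `C` as a direct sum of two corners (`equivalentMultitensor_corners`), so it is trivial
in an indecomposable category. Applied to the sum of all simple summands linked to a given one `P`
by a nonzero object, this shows that every summand `U k` is linked to `P` by an object `X k` with
scalar endomorphisms. The sum `X` of the `X k` satisfies `End X ≅ End 𝟙` through the right action
of `End 𝟙` (`exists_generator`). As this action is faithful, the positive element `ω* ω` of
`End 𝟙` is invertible, and a solution `(ω, ω')` of the conjugate equations for `X` can be normalized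
to `ω* ω = 1` (`exists_normalized_solution`).

*The equivalence.* The object `H = X ⊗ Xb` of the corner is a special C*-Frobenius algebra under
the contraction of `Xb ⊗ X` by `ω*` (`Generator.frob`), and `Y ↦ X ⊗ (Y ⊗ Xb)` is a functor from `C`
to special `H`-bimodules (`Generator.functor`). It is fully faithful because a bimodule map equals
its average over `H`, and monoidal with unitary structure maps because the contraction
`(X ⊗ Y ⊗ Xb) ⊗ (X ⊗ Z ⊗ Xb) ⟶ X ⊗ Y ⊗ Z ⊗ Xb` is a coisometry whose support is the projection
defining the relative tensor product (`Generator.tensorator_isRel`). Every special bimodule `M` is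
the image of a projection on the bimodule of `Xb ⊗ M ⊗ X`; this projection comes from `C` and splits
there (`Generator.exists_unitary`). The remaining axioms of a multitensor C*-category are carried
over to the bimodules along this equivalence (`Generator.multitensorCStar`).

*Standardness.* A solution of the conjugate equations whose left and right partial traces agree is
minimal, by a Cauchy-Schwarz argument (`isMinimalSolution_of_spherical`). For `H` the two traces
agree: the partial traces of an endomorphism of `X ⊗ Xb` lie in `End X` and `End Xb`, both of which
are copies of `End 𝟙`, and closing them up with the isometry `ω` shows that they are the same
element of `End 𝟙` (`trace_eq`).

The composition `f ≫ g` is written `g f` in the usual order, so an isometry `s` satisfies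
`s ≫ s† = 𝟙`. The dual of `X` is denoted `Xb`.
-/

namespace CStarTensor

/-! ### Norms and adjoints in C*-categories -/

namespace CStarCategory

variable {C : Type u} [Category.{v} C] [StarNorm C] [Preadditive C] [Linear ℂ C] [CStarCategory C]

@[simp] lemma dag_one (X : C) : (𝟙 X)† = 𝟙 X := by
  have h := dag_comp (𝟙 X)† (𝟙 X)
  simpa [dag_dag] using h.symm

@[simp] lemma dag_zero {X Y : C} : (0 : X ⟶ Y)† = 0 := by
  simpa using dag_smul (0 : ℂ) (0 : X ⟶ Y)

lemma dag_neg {X Y : C} (f : X ⟶ Y) : (-f)† = -f† := by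
  have h := dag_smul (-1 : ℂ) f
  simpa using h

lemma dag_sub {X Y : C} (f g : X ⟶ Y) : (f - g)† = f† - g† := by
  rw [sub_eq_add_neg, dag_add, dag_neg, sub_eq_add_neg]

lemma dag_sum {X Y : C} {ι : Type*} (s : Finset ι) (f : ι → (X ⟶ Y)) :
    (∑ i ∈ s, f i)† = ∑ i ∈ s, (f i)† := by
  classical
  induction s using Finset.induction_on with
  | empty => simp
  | insert a s ha ih => rw [Finset.sum_insert ha, Finset.sum_insert ha, dag_add, ih]

lemma dag_inj {X Y : C} {f g : X ⟶ Y} (h : f† = g†) : f = g := by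
  rw [← dag_dag f, h, dag_dag]

lemma nrm_zero {X Y : C} : nrm (0 : X ⟶ Y) = 0 := by
  simpa using nrm_smul (0 : ℂ) (0 : X ⟶ Y)

lemma nrm_neg {X Y : C} (f : X ⟶ Y) : nrm (-f) = nrm f := by
  simpa using nrm_smul (-1 : ℂ) f

lemma nrm_nonneg {X Y : C} (f : X ⟶ Y) : 0 ≤ nrm f := by
  have h := nrm_add_le f (-f)
  rw [add_neg_cancel, nrm_zero, nrm_neg] at h
  linarith

lemma nrm_dag {X Y : C} (f : X ⟶ Y) : nrm f† = nrm f := by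
  have key : ∀ {X Y : C} (f : X ⟶ Y), nrm f ≤ nrm f† := by
    intro X Y f
    rcases (nrm_nonneg f).eq_or_lt with h | h
    · rw [← h]; exact nrm_nonneg _
    · have h1 := nrm_comp_le f f†
      rw [nrm_comp_dag, sq] at h1
      exact le_of_mul_le_mul_left h1 h
  apply le_antisymm _ (key f)
  have := key f†
  rwa [dag_dag] at this

lemma eq_zero_of_comp_dag {X Y : C} {f : X ⟶ Y} (h : f ≫ f† = 0) : f = 0 := by
  apply eq_zero_of_nrm
  have := nrm_comp_dag f
  rw [h, nrm_zero] at this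
  exact pow_eq_zero_iff (two_ne_zero) |>.1 this.symm

lemma eq_zero_of_dag_comp {X Y : C} {f : X ⟶ Y} (h : f† ≫ f = 0) : f = 0 := by
  apply dag_inj
  rw [dag_zero]
  apply eq_zero_of_comp_dag
  rwa [dag_dag]

lemma nrm_le_one_of_proj {X : C} {p : X ⟶ X} (hp : p ≫ p† = p) : nrm p ≤ 1 := by
  have h := nrm_comp_dag p
  rw [hp] at h
  nlinarith [nrm_nonneg p]

lemma nrm_le_one_of_isometry {X Y : C} {s : X ⟶ Y} (hs : s ≫ s† = 𝟙 X) : nrm s ≤ 1 := by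
  have h := nrm_comp_dag s
  rw [hs] at h
  have h1 : nrm (𝟙 X) ≤ 1 := nrm_le_one_of_proj (by simp)
  nlinarith [nrm_nonneg s]

lemma nrm_one {X : C} (h : 𝟙 X ≠ 0) : nrm (𝟙 X) = 1 := by
  have h1 := nrm_comp_dag (𝟙 X)
  rw [dag_one, Category.comp_id] at h1
  have h2 : nrm (𝟙 X) ≠ 0 := fun h' => h (eq_zero_of_nrm _ h')
  have : nrm (𝟙 X) * (nrm (𝟙 X) - 1) = 0 := by linarith
  rcases mul_eq_zero.1 this with h | h
  · exact absurd h h2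
  · linarith

/-- The endomorphisms of `X` as an algebra, in the order of composition `f * g = f ≫ g`. -/
def EndAlg (X : C) : Type v := X ⟶ X

namespace EndAlg

variable (X : C)

instance : AddCommGroup (EndAlg X) := inferInstanceAs (AddCommGroup (X ⟶ X))

instance : Module ℂ (EndAlg X) := inferInstanceAs (Module ℂ (X ⟶ X))

instance : Ring (EndAlg X) :=
  { (inferInstance : AddCommGroup (EndAlg X)) with
    mul := fun f g => (show X ⟶ X from f) ≫ (show X ⟶ X from g)
    one := 𝟙 X
    mul_assoc := Category.assoc
    one_mul := Category.id_comp
    mul_one := Category.comp_id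
    left_distrib := fun f g h => Preadditive.comp_add X X X f g h
    right_distrib := fun f g h => Preadditive.add_comp X X X f g h
    zero_mul := fun _ => zero_comp
    mul_zero := fun _ => comp_zero }

instance : Algebra ℂ (EndAlg X) :=
  Algebra.ofModule (fun c f g => Linear.smul_comp X X X c f g)
    (fun c f g => Linear.comp_smul X X X f c g)

instance : StarRing (EndAlg X) where
  star f := (show X ⟶ X from f)†
  star_involutive f := dag_dag (show X ⟶ X from f)
  star_mul f g := dag_comp (show X ⟶ X from f) g
  star_add f g := dag_add (show X ⟶ X from f) g

instance : StarModule ℂ (EndAlg X) where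
  star_smul c f := dag_smul c (show X ⟶ X from f)

noncomputable instance : NormedAddCommGroup (EndAlg X) :=
  AddGroupNorm.toNormedAddCommGroup
    { toFun := fun f => nrm (show X ⟶ X from f)
      map_zero' := nrm_zero
      add_le' := fun f g => nrm_add_le (show X ⟶ X from f) g
      neg' := fun f => nrm_neg (show X ⟶ X from f)
      eq_zero_of_map_eq_zero' := fun f => eq_zero_of_nrm (show X ⟶ X from f) }

noncomputable instance : NormedRing (EndAlg X) :=
  { (inferInstance : NormedAddCommGroup (EndAlg X)), (inferInstance : Ring (EndAlg X)) with
    norm_mul_le := fun f g => nrm_comp_le (show X ⟶ X from f) g }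

noncomputable instance : NormedAlgebra ℂ (EndAlg X) where
  norm_smul_le c f := (nrm_smul c (show X ⟶ X from f)).le

instance : CStarRing (EndAlg X) where
  norm_mul_self_le f := by
    change nrm (show X ⟶ X from f) * nrm (show X ⟶ X from f) ≤
      nrm ((show X ⟶ X from f)† ≫ (show X ⟶ X from f))
    have h := nrm_comp_dag (show X ⟶ X from f)†
    rw [dag_dag, nrm_dag] at h
    rw [h, sq]

instance : CompleteSpace (EndAlg X) := by
  apply Metric.complete_of_cauchySeq_tendsto
  intro w hw
  rw [Metric.cauchySeq_iff] at hw
  obtain ⟨f, hf⟩ := complete (X := X) (Y := X) (fun n => w n) (fun ε hε => by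
    obtain ⟨N, hN⟩ := hw ε hε
    refine ⟨N, fun m n hm hn => ?_⟩
    have h := hN m hm n hn
    rwa [dist_eq_norm] at h)
  refine ⟨show EndAlg X from f, Metric.tendsto_atTop.2 fun ε hε => ?_⟩
  obtain ⟨N, hN⟩ := hf ε hε
  refine ⟨N, fun n hn => ?_⟩
  rw [dist_eq_norm]
  exact hN n hn

noncomputable instance : CStarAlgebra (EndAlg X) where

end EndAlg

end CStarCategory

namespace CStarMonoidal

open CStarCategory

variable {C : Type u} [Category.{v} C] [StarNorm C] [Preadditive C] [Linear ℂ C]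
  [MonoidalCategory C] [CStarMonoidal C]

/-- A `*`-homomorphism of C*-algebras is contractive; the C*-identity extends this to morphisms
between different objects. -/
lemma nrm_whiskerLeft_le (X : C) {Y Z : C} (f : Y ⟶ Z) : nrm (X ◁ f) ≤ nrm f := by
  let φ : EndAlg Y →⋆ₙₐ[ℂ] EndAlg (X ⊗ Y) :=
    { toFun := fun g => X ◁ (show Y ⟶ Y from g)
      map_smul' := fun c g => MonoidalLinear.whiskerLeft_smul X c (show Y ⟶ Y from g)
      map_zero' := MonoidalPreadditive.whiskerLeft_zero
      map_add' := fun g h => MonoidalPreadditive.whiskerLeft_add (Y := Y) (Z := Y) g h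
      map_mul' := fun g h => whiskerLeft_comp X (show Y ⟶ Y from g) (show Y ⟶ Y from h)
      map_star' := fun g => (dag_whiskerLeft X (show Y ⟶ Y from g)).symm }
  have h : nrm (X ◁ (f ≫ f†)) ≤ nrm (f ≫ f†) :=
    NonUnitalStarAlgHom.norm_apply_le φ (show EndAlg Y from f ≫ f†)
  rw [whiskerLeft_comp, ← dag_whiskerLeft, nrm_comp_dag, nrm_comp_dag] at h
  exact le_of_sq_le_sq h (nrm_nonneg f)

lemma nrm_whiskerRight_le {Y Z : C} (f : Y ⟶ Z) (X : C) : nrm (f ▷ X) ≤ nrm f := by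
  let φ : EndAlg Y →⋆ₙₐ[ℂ] EndAlg (Y ⊗ X) :=
    { toFun := fun g => (show Y ⟶ Y from g) ▷ X
      map_smul' := fun c g => MonoidalLinear.smul_whiskerRight c (show Y ⟶ Y from g) X
      map_zero' := MonoidalPreadditive.zero_whiskerRight
      map_add' := fun g h => MonoidalPreadditive.add_whiskerRight (Y := Y) (Z := Y) g h
      map_mul' := fun g h => comp_whiskerRight (show Y ⟶ Y from g) (show Y ⟶ Y from h) X
      map_star' := fun g => (dag_whiskerRight (show Y ⟶ Y from g) X).symm }
  have h : nrm ((f ≫ f†) ▷ X) ≤ nrm (f ≫ f†) :=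
    NonUnitalStarAlgHom.norm_apply_le φ (show EndAlg Y from f ≫ f†)
  rw [comp_whiskerRight, ← dag_whiskerRight, nrm_comp_dag, nrm_comp_dag] at h
  exact le_of_sq_le_sq h (nrm_nonneg f)

end CStarMonoidal

/-! ### Projections in finite-dimensional C*-algebras and decomposition of objects -/

section Algebra

variable {A : Type*} [CStarAlgebra A]

lemma eq_zero_of_sq_eq_zero_of_commute {b : A} (hb : Commute (star b) b) (h : b * b = 0) :
    b = 0 := by
  have hc : star (star b * b) * (star b * b) = 0 := by
    rw [star_mul, star_star]
    calc star b * b * (star b * b) = star b * (b * star b) * b := by noncomm_ring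
      _ = star b * star b * (b * b) := by rw [← hb.eq]; noncomm_ring
      _ = 0 := by rw [h, mul_zero]
  exact CStarRing.star_mul_self_eq_zero_iff b |>.1 (CStarRing.star_mul_self_eq_zero_iff _ |>.1 hc)

lemma isSelfAdjoint_of_idempotent_of_commute {e : A} (he : Commute (star e) e) (h : e * e = e) :
    star e = e := by
  have h' : star e * star e = star e := by rw [← star_mul, h]
  have h1 : star (e - star e * e) * (e - star e * e) = 0 := by
    have : star (e - star e * e) * (e - star e * e) =
        star e * e - star e * (star e * e) - (star e * (e * e)) + star e * (e * star e) * e := by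
      rw [star_sub, star_mul, star_star]; noncomm_ring
    rw [this, ← he.eq, ← mul_assoc, h', h]
    have : star e * e * e = star e * (e * e) := mul_assoc _ _ _
    rw [this, h]
    abel
  have h2 : e = star e * e := sub_eq_zero.1 (CStarRing.star_mul_self_eq_zero_iff _ |>.1 h1)
  rw [h2, star_mul, star_star]

lemma commute_aeval {x a : A} (h : Commute x a) (q : Polynomial ℂ) :
    Commute x (Polynomial.aeval a q) := by
  rw [Polynomial.aeval_eq_sum_range]
  exact Commute.sum_right _ _ _ fun i _ => (h.pow_right i).smul_right (q.coeff i)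

/-- In a finite-dimensional C*-algebra, a self-adjoint element which is not a scalar has a spectral
projection different from `0` and `1`: for a root `z` of the minimal polynomial `(X - z) q` of `a`,
a multiple of `q(a)` is the projection onto the eigenspace of `z`. -/
lemma exists_projection_of_isSelfAdjoint [Module.Finite ℂ A] {a : A} (ha : star a = a)
    (hs : ∀ c : ℂ, a ≠ algebraMap ℂ A c) :
    ∃ e : A, e * e = e ∧ star e = e ∧ e ≠ 0 ∧ e ≠ 1 := by
  have hint : IsIntegral ℂ a := IsIntegral.of_finite ℂ a
  have hA : Nontrivial A := ⟨a, algebraMap ℂ A 0, hs 0⟩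
  have hdeg : (minpoly ℂ a).degree ≠ 0 := (minpoly.degree_pos hint).ne'
  obtain ⟨z, hz⟩ := IsAlgClosed.exists_root (minpoly ℂ a) hdeg
  obtain ⟨q, hq⟩ := Polynomial.dvd_iff_isRoot.2 hz
  have hq0 : q ≠ 0 := by
    rintro rfl
    rw [mul_zero] at hq
    exact minpoly.ne_zero hint hq
  set b : A := Polynomial.aeval a q with hb
  have hb0 : b ≠ 0 := by
    intro h
    have h1 := Polynomial.natDegree_le_natDegree (minpoly.degree_le_of_ne_zero ℂ a hq0 h)
    rw [hq, Polynomial.natDegree_mul (Polynomial.X_sub_C_ne_zero z) hq0,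
      Polynomial.natDegree_X_sub_C] at h1
    lia
  have hab : a * b = algebraMap ℂ A z * b := by
    have h := minpoly.aeval ℂ a
    rw [hq, map_mul, ← hb, map_sub, Polynomial.aeval_X, Polynomial.aeval_C, sub_mul] at h
    exact sub_eq_zero.1 h
  have hbb : b * b = (q.eval z) • b := by
    obtain ⟨r, hr⟩ := Polynomial.X_sub_C_dvd_sub_C_eval (a := z) (p := q)
    have h := congrArg (Polynomial.aeval a) hr
    rw [map_sub, ← hb, Polynomial.aeval_C, mul_comm, map_mul, map_sub, Polynomial.aeval_X,
      Polynomial.aeval_C] at h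
    have h2 := congrArg (· * b) h
    simp only [mul_assoc, sub_mul, hab, sub_self, mul_zero] at h2
    rw [sub_eq_zero.1 h2, Algebra.smul_def]
  have hcomm : Commute (star b) b := by
    have h1 : Commute b a := (commute_aeval (Commute.refl a) q).symm
    have h2 : Commute (star b) a := by
      have : star b * star a = star a * star b := by rw [← star_mul, ← star_mul, h1.eq]
      rwa [ha] at this
    exact commute_aeval h2 q
  have hqz : q.eval z ≠ 0 := by
    intro h
    rw [h, zero_smul] at hbb
    exact hb0 (eq_zero_of_sq_eq_zero_of_commute hcomm hbb)
  set e : A := (q.eval z)⁻¹ • b with he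
  have hee : e * e = e := by
    rw [he, smul_mul_smul_comm, hbb, smul_smul]
    congr 1
    field_simp
  have he0 : e ≠ 0 := smul_ne_zero (inv_ne_zero hqz) hb0
  refine ⟨e, hee, isSelfAdjoint_of_idempotent_of_commute ?_ hee, he0, ?_⟩
  · rw [he, star_smul]
    exact (hcomm.smul_left _).smul_right _
  · intro h1
    apply hs z
    have : a * e = algebraMap ℂ A z * e := by
      rw [he, mul_smul_comm, hab, mul_smul_comm]
    rwa [h1, mul_one, mul_one] at this

end Algebra

section Decomposition

open CStarCategory

variable {C : Type u} [Category.{v} C] [StarNorm C] [Preadditive C] [Linear ℂ C]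

/-- Simple objects, in the form used below: nonzero objects all of whose endomorphisms are
scalars. -/
def IsScalarObj (Y : C) : Prop := 𝟙 Y ≠ 0 ∧ ∀ f : Y ⟶ Y, ∃ c : ℂ, f = c • 𝟙 Y

/-- `Z` is the orthogonal direct sum of a family `Y` indexed by a finite type. -/
def IsOrthoSum {ι : Type} [Fintype ι] {Y : ι → C} {Z : C} (s : ∀ i, Y i ⟶ Z) : Prop :=
  (∀ i, s i ≫ (s i)† = 𝟙 (Y i)) ∧ (∀ i j, i ≠ j → s i ≫ (s j)† = 0) ∧
    ∑ i, (s i)† ≫ s i = 𝟙 Z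

/-- An endomorphism which is not a scalar has a real or an imaginary part which is not a scalar,
and this part has a nontrivial spectral projection. -/
lemma exists_projection [CStarCategory C] {Y : C} [hY : Module.Finite ℂ (Y ⟶ Y)] (f : Y ⟶ Y)
    (hf : ∀ c : ℂ, f ≠ c • 𝟙 Y) :
    ∃ e : Y ⟶ Y, e ≫ e = e ∧ e† = e ∧ e ≠ 0 ∧ e ≠ 𝟙 Y := by
  have : Module.Finite ℂ (EndAlg Y) := hY
  have key : ∀ a : Y ⟶ Y, a† = a → (∀ c : ℂ, a ≠ c • 𝟙 Y) →
      ∃ e : Y ⟶ Y, e ≫ e = e ∧ e† = e ∧ e ≠ 0 ∧ e ≠ 𝟙 Y := by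
    intro a ha hs
    refine exists_projection_of_isSelfAdjoint (A := EndAlg Y) (a := a) ha fun c h => hs c ?_
    rw [Algebra.algebraMap_eq_smul_one] at h
    exact h
  by_contra hcon
  have h1 : ∃ c : ℂ, f + f† = c • 𝟙 Y := by
    by_contra h
    push Not at h
    exact hcon (key _ (by rw [dag_add, dag_dag, add_comm]) h)
  have h2 : ∃ c : ℂ, Complex.I • (f - f†) = c • 𝟙 Y := by
    by_contra h
    push Not at h
    refine hcon (key _ ?_ h)
    rw [dag_smul, dag_sub, dag_dag, Complex.conj_I, neg_smul, ← smul_neg, neg_sub]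
  obtain ⟨c, hc⟩ := h1
  obtain ⟨d, hd⟩ := h2
  apply hf ((1 / 2 : ℂ) * (c - Complex.I * d))
  have hd' : f - f† = (-Complex.I * d) • 𝟙 Y := by
    rw [mul_smul, ← hd, smul_smul, neg_mul, Complex.I_mul_I, neg_neg, one_smul]
  have h3 : f = (1 / 2 : ℂ) • ((f + f†) + (f - f†)) := by
    rw [add_add_sub_cancel, ← two_smul ℂ f, smul_smul]
    norm_num
  rw [h3, hc, hd', ← add_smul, smul_smul]
  congr 1
  ring

/-- Compression by a proper isometry strictly decreases the dimension of the endomorphism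
algebra. -/
lemma finrank_end_lt [CStarCategory C] {Y Z : C} [hY : Module.Finite ℂ (Y ⟶ Y)] {s : Z ⟶ Y}
    (hs : s ≫ s† = 𝟙 Z) (hne : s† ≫ s ≠ 𝟙 Y) :
    Module.Finite ℂ (Z ⟶ Z) ∧ Module.finrank ℂ (Z ⟶ Z) < Module.finrank ℂ (Y ⟶ Y) := by
  let φ : (Z ⟶ Z) →ₗ[ℂ] (Y ⟶ Y) :=
    { toFun := fun g => s† ≫ g ≫ s
      map_add' := fun g h => by simp
      map_smul' := fun c g => by simp }
  have hφ : Function.Injective φ := by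
    intro g h hgh
    have h1 : s† ≫ g ≫ s = s† ≫ h ≫ s := hgh
    have h2 := congrArg (fun x => s ≫ x ≫ s†) h1
    simp only [Category.assoc, hs, Category.comp_id] at h2
    rw [← Category.assoc, ← Category.assoc, hs] at h2
    simpa using h2
  refine ⟨Module.Finite.of_injective φ hφ, ?_⟩
  rw [← LinearMap.finrank_range_of_inj hφ]
  apply Submodule.finrank_lt
  intro htop
  obtain ⟨g, hg⟩ := LinearMap.range_eq_top.1 htop (𝟙 Y)
  apply hne
  have hg' : s† ≫ g ≫ s = 𝟙 Y := hg
  calc s† ≫ s = (s† ≫ g ≫ s) ≫ s† ≫ s := by rw [hg', Category.id_comp]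
    _ = s† ≫ g ≫ (s ≫ s†) ≫ s := by simp only [Category.assoc]
    _ = 𝟙 Y := by rw [hs, Category.id_comp, hg']

/-- An object with finite-dimensional endomorphism algebra is a finite orthogonal direct sum of
objects with scalar endomorphisms. -/
theorem exists_scalar_decomposition [CStarCategory C]
    (hsub : ∀ {X : C} (p : X ⟶ X), p ≫ p = p → p† = p →
      ∃ (Y : C) (s : Y ⟶ X), s ≫ s† = 𝟙 Y ∧ s† ≫ s = p)
    (Y : C) [hY : Module.Finite ℂ (Y ⟶ Y)] :
    ∃ (ι : Type) (_ : Fintype ι) (Z : ι → C) (s : ∀ i, Z i ⟶ Y),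
      (∀ i, IsScalarObj (Z i)) ∧ IsOrthoSum s := by
  induction hn : Module.finrank ℂ (Y ⟶ Y) using Nat.strong_induction_on generalizing Y with
  | _ n ih =>
    subst hn
    by_cases h0 : 𝟙 Y = 0
    · refine ⟨Empty, inferInstance, fun i => i.elim, fun i => i.elim, fun i => i.elim,
        fun i => i.elim, fun i => i.elim, ?_⟩
      simp [h0]
    by_cases hsc : ∀ f : Y ⟶ Y, ∃ c : ℂ, f = c • 𝟙 Y
    · refine ⟨Unit, inferInstance, fun _ => Y, fun _ => 𝟙 Y, fun _ => ⟨h0, hsc⟩, ?_, ?_, ?_⟩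
      · simp
      · intro i j h; exact absurd rfl h
      · simp
    push Not at hsc
    obtain ⟨f, hf⟩ := hsc
    obtain ⟨e, hee, hes, he0, he1⟩ := exists_projection f hf
    obtain ⟨A, a, ha, ha'⟩ := hsub e hee hes
    obtain ⟨B, b, hb, hb'⟩ := hsub (𝟙 Y - e) (by simp [hee]) (by rw [dag_sub, hes, dag_one])
    obtain ⟨hA, hA'⟩ := finrank_end_lt ha (by rw [ha']; exact he1)
    obtain ⟨hB, hB'⟩ := finrank_end_lt hb (by rw [hb']; simpa using he0)
    obtain ⟨ι, _, Z, s, hZ, hs⟩ := ih _ hA' A rfl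
    obtain ⟨κ, _, W, t, hW, ht⟩ := ih _ hB' B rfl
    have hab : a ≫ b† = 0 := by
      have h1 : a† ≫ a ≫ b† ≫ b = 0 := by
        rw [hb', ← Category.assoc, ha']; simp [hee]
      have h2 := congrArg (fun x => a ≫ x ≫ b†) h1
      simp only [Category.assoc, hb, comp_zero, zero_comp, Category.comp_id] at h2
      rwa [← Category.assoc, ha, Category.id_comp] at h2
    have hba : b ≫ a† = 0 := by
      apply dag_inj
      rw [dag_comp, dag_dag, hab, dag_zero]
    refine ⟨ι ⊕ κ, inferInstance, Sum.elim Z W,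
      fun i => match i with
        | Sum.inl i => s i ≫ a
        | Sum.inr j => t j ≫ b, ?_, ?_, ?_, ?_⟩
    · rintro (i | j)
      · exact hZ i
      · exact hW j
    · rintro (i | j)
      · change (s i ≫ a) ≫ (s i ≫ a)† = 𝟙 (Z i)
        rw [dag_comp, Category.assoc, ← Category.assoc a, ha, Category.id_comp, hs.1]
      · change (t j ≫ b) ≫ (t j ≫ b)† = 𝟙 (W j)
        rw [dag_comp, Category.assoc, ← Category.assoc b, hb, Category.id_comp, ht.1]
    · rintro (i | i) (j | j) hij
      · change (s i ≫ a) ≫ (s j ≫ a)† = 0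
        rw [dag_comp, Category.assoc, ← Category.assoc a, ha, Category.id_comp,
          hs.2.1 i j (fun h => hij (congrArg _ h))]
      · change (s i ≫ a) ≫ (t j ≫ b)† = 0
        rw [dag_comp, Category.assoc, ← Category.assoc a, hab, zero_comp, comp_zero]
      · change (t i ≫ b) ≫ (s j ≫ a)† = 0
        rw [dag_comp, Category.assoc, ← Category.assoc b, hba, zero_comp, comp_zero]
      · change (t i ≫ b) ≫ (t j ≫ b)† = 0
        rw [dag_comp, Category.assoc, ← Category.assoc b, hb, Category.id_comp,
          ht.2.1 i j (fun h => hij (congrArg _ h))]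
    · rw [Fintype.sum_sum_type]
      have h1 : ∑ i, (s i ≫ a)† ≫ (s i ≫ a) = e := by
        calc ∑ i, (s i ≫ a)† ≫ (s i ≫ a) = a† ≫ (∑ i, (s i)† ≫ s i) ≫ a := by
              rw [Preadditive.sum_comp, Preadditive.comp_sum]
              simp only [dag_comp, Category.assoc]
          _ = e := by rw [hs.2.2, Category.id_comp, ha']
      have h2 : ∑ i, (t i ≫ b)† ≫ (t i ≫ b) = 𝟙 Y - e := by
        calc ∑ i, (t i ≫ b)† ≫ (t i ≫ b) = b† ≫ (∑ i, (t i)† ≫ t i) ≫ b := by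
              rw [Preadditive.sum_comp, Preadditive.comp_sum]
              simp only [dag_comp, Category.assoc]
          _ = 𝟙 Y - e := by rw [ht.2.2, Category.id_comp, hb']
      refine (congrArg₂ (· + ·) h1 h2).trans ?_
      simp

/-- The decomposition into objects with scalar endomorphisms, indexed by `Fin n`. -/
theorem exists_orthogonal_decomposition [CStarCategory C]
    (hsub : ∀ {X : C} (p : X ⟶ X), p ≫ p = p → p† = p →
      ∃ (Y : C) (s : Y ⟶ X), s ≫ s† = 𝟙 Y ∧ s† ≫ s = p)
    (Y : C) [hY : Module.Finite ℂ (Y ⟶ Y)] :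
    ∃ (n : ℕ) (Z : Fin n → C) (s : ∀ i, Z i ⟶ Y),
      (∀ i, IsScalarObj (Z i)) ∧ IsOrthogonalSum s := by
  obtain ⟨ι, _, Z, s, hZ, h1, h2, h3⟩ := exists_scalar_decomposition hsub Y
  let e := (Fintype.equivFin ι).symm
  refine ⟨Fintype.card ι, fun i => Z (e i), fun i => s (e i), fun i => hZ _, fun i => h1 _,
    fun i j hij => h2 _ _ fun h => hij (e.injective h), ?_⟩
  rw [← h3]
  exact Equiv.sum_comp e fun i => (s i)† ≫ s i

end Decomposition

/-! ### The two actions of the endomorphisms of the tensor unit -/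

section Actions

open CStarCategory CStarMonoidal

variable {C : Type u} [Category.{v} C] [MonoidalCategory C]

/-- The endomorphism `z ⊗ 1_Y` of `Y ≅ 𝟙 ⊗ Y`. -/
def lact (z : 𝟙_ C ⟶ 𝟙_ C) (Y : C) : Y ⟶ Y := (λ_ Y).inv ≫ z ▷ Y ≫ (λ_ Y).hom

/-- The endomorphism `1_Y ⊗ z` of `Y ≅ Y ⊗ 𝟙`. -/
def ract (z : 𝟙_ C ⟶ 𝟙_ C) (Y : C) : Y ⟶ Y := (ρ_ Y).inv ≫ Y ◁ z ≫ (ρ_ Y).hom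

lemma lact_natural (z : 𝟙_ C ⟶ 𝟙_ C) {Y Z : C} (f : Y ⟶ Z) :
    f ≫ lact z Z = lact z Y ≫ f := by
  simp only [lact, Category.assoc, ← leftUnitor_naturality]
  rw [← whisker_exchange_assoc, leftUnitor_inv_naturality_assoc]

lemma ract_natural (z : 𝟙_ C ⟶ 𝟙_ C) {Y Z : C} (f : Y ⟶ Z) :
    f ≫ ract z Z = ract z Y ≫ f := by
  simp only [ract, Category.assoc, ← rightUnitor_naturality]
  rw [whisker_exchange_assoc, rightUnitor_inv_naturality_assoc]

lemma lact_comp (z w : 𝟙_ C ⟶ 𝟙_ C) (Y : C) : lact (z ≫ w) Y = lact z Y ≫ lact w Y := by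
  simp [lact]

lemma ract_comp (z w : 𝟙_ C ⟶ 𝟙_ C) (Y : C) : ract (z ≫ w) Y = ract z Y ≫ ract w Y := by
  simp [ract]

@[simp] lemma lact_id (Y : C) : lact (𝟙 _) Y = 𝟙 Y := by simp [lact]

@[simp] lemma ract_id (Y : C) : ract (𝟙 _) Y = 𝟙 Y := by simp [ract]

lemma lact_unit (z : 𝟙_ C ⟶ 𝟙_ C) : lact z (𝟙_ C) = z := by
  rw [lact, unitors_equal, rightUnitor_naturality, unitors_inv_equal, Iso.inv_hom_id_assoc]

lemma ract_unit (z : 𝟙_ C ⟶ 𝟙_ C) : ract z (𝟙_ C) = z := by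
  rw [ract, ← unitors_equal, leftUnitor_naturality, ← unitors_inv_equal, Iso.inv_hom_id_assoc]

lemma end_unit_comm (z w : 𝟙_ C ⟶ 𝟙_ C) : z ≫ w = w ≫ z := by
  have h := lact_natural w z
  rwa [lact_unit] at h

lemma lact_tensor (z : 𝟙_ C ⟶ 𝟙_ C) (Y Z : C) : lact z (Y ⊗ Z) = lact z Y ▷ Z := by
  simp only [lact]; monoidal

lemma ract_tensor (z : 𝟙_ C ⟶ 𝟙_ C) (Y Z : C) : ract z (Y ⊗ Z) = Y ◁ ract z Z := by
  simp only [ract]; monoidal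

lemma ract_whiskerRight (z : 𝟙_ C ⟶ 𝟙_ C) (Y Z : C) : ract z Y ▷ Z = Y ◁ lact z Z := by
  simp only [lact, ract]; monoidal

lemma comp_lact_unit (z : 𝟙_ C ⟶ 𝟙_ C) {Y : C} (f : 𝟙_ C ⟶ Y) : f ≫ lact z Y = z ≫ f := by
  rw [lact_natural, lact_unit]

lemma comp_ract_unit (z : 𝟙_ C ⟶ 𝟙_ C) {Y : C} (f : 𝟙_ C ⟶ Y) : f ≫ ract z Y = z ≫ f := by
  rw [ract_natural, ract_unit]

/-- Being supported on `z` from the left passes to retracts. -/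
lemma lact_eq_id_of_mono {z : 𝟙_ C ⟶ 𝟙_ C} {Y Z : C} (f : Y ⟶ Z) [Mono f]
    (h : lact z Z = 𝟙 Z) : lact z Y = 𝟙 Y := by
  rw [← cancel_mono f, ← lact_natural, h, Category.comp_id, Category.id_comp]

lemma ract_eq_id_of_mono {z : 𝟙_ C ⟶ 𝟙_ C} {Y Z : C} (f : Y ⟶ Z) [Mono f]
    (h : ract z Z = 𝟙 Z) : ract z Y = 𝟙 Y := by
  rw [← cancel_mono f, ← ract_natural, h, Category.comp_id, Category.id_comp]

variable [StarNorm C] [Preadditive C] [Linear ℂ C]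

section Linear

variable [MonoidalPreadditive C] [MonoidalLinear ℂ C]

lemma lact_add (z w : 𝟙_ C ⟶ 𝟙_ C) (Y : C) : lact (z + w) Y = lact z Y + lact w Y := by
  simp [lact, MonoidalPreadditive.add_whiskerRight]

lemma ract_add (z w : 𝟙_ C ⟶ 𝟙_ C) (Y : C) : ract (z + w) Y = ract z Y + ract w Y := by
  simp [ract, MonoidalPreadditive.whiskerLeft_add]

lemma ract_smul (c : ℂ) (z : 𝟙_ C ⟶ 𝟙_ C) (Y : C) : ract (c • z) Y = c • ract z Y := by
  simp [ract, MonoidalLinear.whiskerLeft_smul]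

@[simp] lemma lact_zero (Y : C) : lact (0 : 𝟙_ C ⟶ 𝟙_ C) Y = 0 := by simp [lact]

@[simp] lemma ract_zero (Y : C) : ract (0 : 𝟙_ C ⟶ 𝟙_ C) Y = 0 := by simp [ract]

lemma lact_sum {ι : Type*} (t : Finset ι) (z : ι → (𝟙_ C ⟶ 𝟙_ C)) (Y : C) :
    lact (∑ i ∈ t, z i) Y = ∑ i ∈ t, lact (z i) Y := by
  classical
  induction t using Finset.induction_on with
  | empty => simp
  | insert a t ha ih => rw [Finset.sum_insert ha, Finset.sum_insert ha, lact_add, ih]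

lemma ract_sum {ι : Type*} (t : Finset ι) (z : ι → (𝟙_ C ⟶ 𝟙_ C)) (Y : C) :
    ract (∑ i ∈ t, z i) Y = ∑ i ∈ t, ract (z i) Y := by
  classical
  induction t using Finset.induction_on with
  | empty => simp
  | insert a t ha ih => rw [Finset.sum_insert ha, Finset.sum_insert ha, ract_add, ih]

end Linear

variable [CStarMonoidal C]

lemma dag_lact (z : 𝟙_ C ⟶ 𝟙_ C) (Y : C) : (lact z Y)† = lact z† Y := by
  simp [lact]

lemma dag_ract (z : 𝟙_ C ⟶ 𝟙_ C) (Y : C) : (ract z Y)† = ract z† Y := by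
  simp [ract]

lemma mono_of_isometry {X Y : C} {s : X ⟶ Y} (hs : s ≫ s† = 𝟙 X) : Mono s :=
  ⟨fun f g h => by
    have := congrArg (· ≫ s†) h
    simpa [hs] using this⟩

/-! ### Finite-dimensionality of morphism spaces -/

/-- The adjoint form of the first conjugate equation. -/
lemma ConjugateEquations.dag_fst {X Xb : C} {ω : 𝟙_ C ⟶ Xb ⊗ X} {ω' : 𝟙_ C ⟶ X ⊗ Xb}
    (h : ConjugateEquations ω ω') :
    (λ_ X).inv ≫ ω' ▷ X ≫ (α_ X Xb X).hom ≫ X ◁ ω† ≫ (ρ_ X).hom = 𝟙 X := by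
  have := congrArg StarNorm.dag h.1
  simpa using this

/-- The adjoint form of the second conjugate equation. -/
lemma ConjugateEquations.dag_snd {X Xb : C} {ω : 𝟙_ C ⟶ Xb ⊗ X} {ω' : 𝟙_ C ⟶ X ⊗ Xb}
    (h : ConjugateEquations ω ω') :
    (ρ_ Xb).inv ≫ Xb ◁ ω' ≫ (α_ Xb X Xb).inv ≫ ω† ▷ Xb ≫ (λ_ Xb).hom = 𝟙 Xb := by
  have := congrArg StarNorm.dag h.2
  simpa using this

/-- If `Y` is supported on the summand `U` of the unit, a morphism from `Y` is recovered from its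
Frobenius transform, a morphism from `U`. -/
lemma eq_of_frobenius_transform {U Y Yb W : C} {s : U ⟶ 𝟙_ C}
    (hY : lact (s† ≫ s) Y = 𝟙 Y) {ω : 𝟙_ C ⟶ Yb ⊗ Y} {ω' : 𝟙_ C ⟶ Y ⊗ Yb}
    (h : ConjugateEquations ω ω') (f : Y ⟶ W) :
    f = (λ_ Y).inv ≫ s† ▷ Y ≫ (s ≫ ω' ≫ f ▷ Yb) ▷ Y ≫ (α_ _ _ _).hom ≫ W ◁ ω† ≫
      (ρ_ W).hom := by
  calc f = lact (s† ≫ s) Y ≫ ((λ_ Y).inv ≫ ω' ▷ Y ≫ (α_ Y Yb Y).hom ≫ Y ◁ ω† ≫ (ρ_ Y).hom) ≫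
        f := by
        rw [hY, h.dag_fst, Category.id_comp, Category.id_comp]
    _ = 𝟙 _ ⊗≫ (s† ≫ s ≫ ω') ▷ Y ⊗≫ (Y ◁ ω† ≫ f ▷ 𝟙_ C) ⊗≫ 𝟙 _ := by
        rw [lact]; monoidal
    _ = _ := by
        rw [whisker_exchange]; monoidal

/-- The scalar `f* f` is the number `‖f‖²`; that it is not negative is the positivity axiom of a
C*-category. -/
lemma IsScalarObj.comp_dag {U W : C} (hU : IsScalarObj U) (f : U ⟶ W) :
    f ≫ f† = ((nrm f ^ 2 : ℝ) : ℂ) • 𝟙 U := by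
  obtain ⟨g, hg⟩ := comp_dag_nonneg f
  obtain ⟨a, ha⟩ := hU.2 g
  have h1 : f ≫ f† = ((‖a‖ ^ 2 : ℝ) : ℂ) • 𝟙 U := by
    rw [hg, ha, dag_smul, dag_one, Linear.smul_comp, Linear.comp_smul, smul_smul,
      Category.comp_id, Complex.mul_conj, Complex.normSq_eq_norm_sq]
  have h2 := nrm_comp_dag f
  rw [h1, nrm_smul, nrm_one hU.1, mul_one, Complex.norm_real, Real.norm_of_nonneg (sq_nonneg _)]
    at h2
  rw [h1, h2]

lemma smul_one_inj {U : C} (hU : 𝟙 U ≠ 0) {a b : ℂ} (h : a • 𝟙 U = b • 𝟙 U) : a = b := by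
  by_contra hne
  rw [← sub_eq_zero, ← sub_smul] at h
  have : (a - b) ≠ 0 := sub_ne_zero.2 hne
  apply hU
  rw [← one_smul ℂ (𝟙 U), ← inv_mul_cancel₀ this, mul_smul, h, smul_zero]

/-- For `U` with scalar endomorphisms, `Hom(U, Z)` is an inner product space, with `⟨f, g⟩` the
scalar `f* g`. -/
@[reducible] noncomputable def homCore {U : C} (hU : IsScalarObj U) (Z : C) :
    InnerProductSpace.Core ℂ (U ⟶ Z) :=
  have spec : ∀ f g : U ⟶ Z, g ≫ f† = (hU.2 (g ≫ f†)).choose • 𝟙 U := fun f g =>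
    (hU.2 (g ≫ f†)).choose_spec
  { inner := fun f g => (hU.2 (g ≫ f†)).choose
    conj_inner_symm := fun f g => by
      apply smul_one_inj hU.1
      rw [← spec]
      have := congrArg StarNorm.dag (spec g f)
      simpa using this.symm
    re_inner_nonneg := fun f => by
      have h : (hU.2 (f ≫ f†)).choose = ((nrm f ^ 2 : ℝ) : ℂ) := by
        apply smul_one_inj hU.1
        rw [← spec, hU.comp_dag]
      change 0 ≤ RCLike.re (hU.2 (f ≫ f†)).choose
      rw [h]
      exact sq_nonneg (nrm f)
    add_left := fun f g k => by
      apply smul_one_inj hU.1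
      rw [← spec, add_smul, ← spec, ← spec, CStarCategory.dag_add, Preadditive.comp_add]
    smul_left := fun f g c => by
      apply smul_one_inj hU.1
      rw [← spec, mul_smul, ← spec, CStarCategory.dag_smul, Linear.comp_smul]
    definite := fun f hf => by
      apply eq_zero_of_comp_dag
      have h := spec f f
      rw [h]
      change (hU.2 (f ≫ f†)).choose = 0 at hf
      rw [hf, zero_smul] }

/-- Finitely many orthonormal elements `t i` of `Hom(U, Z)` sum to a projection on `Z`; closing it
up with a solution of the conjugate equations bounds their number. -/
lemma card_le_of_orthonormal {U Z Zb : C} (hU : IsScalarObj U) {s : U ⟶ 𝟙_ C} (hs : s ≫ s† = 𝟙 U)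
    (hZ : lact (s† ≫ s) Z = 𝟙 Z) {ω : 𝟙_ C ⟶ Zb ⊗ Z} {ω' : 𝟙_ C ⟶ Z ⊗ Zb}
    (h : ConjugateEquations ω ω') {n : ℕ} (t : Fin n → (U ⟶ Z))
    (ht : ∀ i, t i ≫ (t i)† = 𝟙 U) (ht' : ∀ i j, i ≠ j → t i ≫ (t j)† = 0) :
    (n : ℝ) ≤ nrm ω ^ 2 * nrm ω' ^ 2 := by
  -- the Frobenius transforms of the `t i`; each has norm at least `‖ω‖⁻¹`, while the sum of their
  -- squared norms is the scalar obtained by closing up the projection `∑ i, (t i)† ≫ t i`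
  set r : Fin n → (U ⟶ U ⊗ Zb) := fun i => s ≫ ω' ≫ (t i)† ▷ Zb with hr
  have hrt : ∀ i, (t i)† = (λ_ Z).inv ≫ s† ▷ Z ≫ r i ▷ Z ≫ (α_ _ _ _).hom ≫ U ◁ ω† ≫
      (ρ_ U).hom :=
    fun i => eq_of_frobenius_transform hZ h (t i)†
  have h1 : ∀ i, 1 ≤ nrm (r i) * nrm ω := by
    intro i
    have hn : nrm (t i)† = 1 := by
      have := nrm_comp_dag (t i)
      rw [ht, nrm_one hU.1] at this
      rw [nrm_dag]
      nlinarith [nrm_nonneg (t i)]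
    have e1 : nrm ((λ_ Z).inv ≫ s† ▷ Z) ≤ 1 := by
      refine (nrm_comp_le _ _).trans (mul_le_one₀ ?_ (nrm_nonneg _) ?_)
      · exact nrm_le_one_of_isometry (by simp)
      · refine (nrm_whiskerRight_le _ _).trans ?_
        rw [nrm_dag]; exact nrm_le_one_of_isometry hs
    have e2 : nrm ((α_ U Zb Z).hom ≫ U ◁ ω† ≫ (ρ_ U).hom) ≤ nrm ω := by
      have a1 : nrm (α_ U Zb Z).hom ≤ 1 := nrm_le_one_of_isometry (by simp)
      have a2 : nrm (ρ_ U).hom ≤ 1 := nrm_le_one_of_isometry (by simp)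
      have a3 : nrm (U ◁ ω†) ≤ nrm ω := (nrm_whiskerLeft_le _ _).trans (nrm_dag ω).le
      calc _ ≤ nrm (α_ U Zb Z).hom * (nrm (U ◁ ω†) * nrm (ρ_ U).hom) :=
            (nrm_comp_le _ _).trans (mul_le_mul_of_nonneg_left (nrm_comp_le _ _) (nrm_nonneg _))
        _ ≤ 1 * (nrm ω * 1) := by
            apply mul_le_mul a1 _ (mul_nonneg (nrm_nonneg _) (nrm_nonneg _)) zero_le_one
            exact mul_le_mul a3 a2 (nrm_nonneg _) (nrm_nonneg _)
        _ = nrm ω := by ring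
    calc 1 = nrm (t i)† := hn.symm
      _ = nrm (((λ_ Z).inv ≫ s† ▷ Z) ≫ r i ▷ Z ≫ ((α_ _ _ _).hom ≫ U ◁ ω† ≫ (ρ_ U).hom)) := by
          rw [hrt i]; simp only [Category.assoc]
      _ ≤ nrm ((λ_ Z).inv ≫ s† ▷ Z) * (nrm (r i ▷ Z) *
            nrm ((α_ _ _ _).hom ≫ U ◁ ω† ≫ (ρ_ U).hom)) :=
          (nrm_comp_le _ _).trans (mul_le_mul_of_nonneg_left (nrm_comp_le _ _) (nrm_nonneg _))
      _ ≤ 1 * (nrm (r i) * nrm ω) := by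
          apply mul_le_mul e1 _ (mul_nonneg (nrm_nonneg _) (nrm_nonneg _)) zero_le_one
          exact mul_le_mul (nrm_whiskerRight_le _ _) e2 (nrm_nonneg _) (nrm_nonneg _)
      _ = _ := one_mul _
  have h2 : ∑ i, nrm (r i) ^ 2 ≤ nrm ω' ^ 2 := by
    set p : Z ⟶ Z := ∑ i, (t i)† ≫ t i with hp
    have hpp : p ≫ p† = p := by
      rw [hp, dag_sum, Preadditive.sum_comp]
      refine Finset.sum_congr rfl fun i _ => ?_
      rw [Preadditive.comp_sum, Finset.sum_eq_single i]
      · rw [dag_comp, dag_dag, Category.assoc, ← Category.assoc (t i), ht, Category.id_comp]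
      · intro k _ hk
        rw [dag_comp, dag_dag, Category.assoc, ← Category.assoc (t i), ht' i k hk.symm, zero_comp,
          comp_zero]
      · simp
    have e1 : s ≫ ω' ≫ p ▷ Zb ≫ ω'† ≫ s† = ((∑ i, nrm (r i) ^ 2 : ℝ) : ℂ) • 𝟙 U := by
      have hw : p ▷ Zb = ∑ i, (t i)† ▷ Zb ≫ t i ▷ Zb := by
        rw [hp, sum_whiskerRight]
        simp
      rw [Complex.ofReal_sum, Finset.sum_smul, hw]
      simp only [Preadditive.sum_comp, Preadditive.comp_sum]
      refine Finset.sum_congr rfl fun i _ => ?_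
      rw [← hU.comp_dag (r i)]
      simp [hr]
    have e2 : nrm (s ≫ ω' ≫ p ▷ Zb ≫ ω'† ≫ s†) ≤ nrm ω' ^ 2 := by
      have a1 : nrm s ≤ 1 := nrm_le_one_of_isometry hs
      have a2 : nrm (p ▷ Zb) ≤ 1 := (nrm_whiskerRight_le _ _).trans (nrm_le_one_of_proj hpp)
      have b1 : nrm (ω'† ≫ s†) ≤ nrm ω' := by
        refine (nrm_comp_le _ _).trans ?_
        rw [nrm_dag, nrm_dag]
        nlinarith [nrm_nonneg ω']
      have b2 : nrm (p ▷ Zb ≫ ω'† ≫ s†) ≤ nrm ω' := by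
        refine (nrm_comp_le _ _).trans ?_
        nlinarith [nrm_nonneg (ω'† ≫ s†), nrm_nonneg (p ▷ Zb)]
      have b3 : nrm (ω' ≫ p ▷ Zb ≫ ω'† ≫ s†) ≤ nrm ω' ^ 2 := by
        refine (nrm_comp_le _ _).trans ?_
        rw [sq]
        exact mul_le_mul_of_nonneg_left b2 (nrm_nonneg _)
      refine (nrm_comp_le _ _).trans ?_
      nlinarith [nrm_nonneg (ω' ≫ p ▷ Zb ≫ ω'† ≫ s†), nrm_nonneg s]
    rw [e1, nrm_smul, nrm_one hU.1, mul_one, Complex.norm_real, Real.norm_of_nonneg] at e2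
    · exact e2
    · exact Finset.sum_nonneg fun i _ => sq_nonneg _
  calc (n : ℝ) = ∑ _i : Fin n, (1 : ℝ) := by simp
    _ ≤ ∑ i, nrm ω ^ 2 * nrm (r i) ^ 2 := by
        refine Finset.sum_le_sum fun i _ => ?_
        have := h1 i
        nlinarith [mul_nonneg (nrm_nonneg (r i)) (nrm_nonneg ω)]
    _ ≤ nrm ω ^ 2 * nrm ω' ^ 2 := by
        rw [← Finset.mul_sum]
        exact mul_le_mul_of_nonneg_left h2 (sq_nonneg _)

/-- An infinite-dimensional `Hom(U, Z)` would contain orthonormal families of any finite size, by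
the Gram-Schmidt process. -/
lemma finite_hom_of_isScalarObj {U Z Zb : C} (hU : IsScalarObj U) {s : U ⟶ 𝟙_ C}
    (hs : s ≫ s† = 𝟙 U) (hZ : lact (s† ≫ s) Z = 𝟙 Z) {ω : 𝟙_ C ⟶ Zb ⊗ Z} {ω' : 𝟙_ C ⟶ Z ⊗ Zb}
    (h : ConjugateEquations ω ω') : Module.Finite ℂ (U ⟶ Z) := by
  by_contra hfin
  let core := homCore hU Z
  let : NormedAddCommGroup (U ⟶ Z) := core.toNormedAddCommGroup
  let : InnerProductSpace ℂ (U ⟶ Z) := InnerProductSpace.ofCore core.toCore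
  have hspec : ∀ f g : U ⟶ Z, g ≫ f† = (inner ℂ f g) • 𝟙 U := fun f g =>
    (hU.2 (g ≫ f†)).choose_spec
  obtain ⟨n, hn⟩ := exists_nat_gt (nrm ω ^ 2 * nrm ω' ^ 2)
  have hrank : (n : Cardinal) ≤ Module.rank ℂ (U ⟶ Z) := by
    have : Cardinal.aleph0 ≤ Module.rank ℂ (U ⟶ Z) := by
      by_contra hlt
      exact hfin (Module.rank_lt_aleph0_iff.1 (not_le.1 hlt))
    exact (Cardinal.natCast_le_aleph0).trans this
  obtain ⟨f, hf⟩ : ∃ f : Fin n → (U ⟶ Z), LinearIndependent ℂ f := by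
    obtain ⟨S, hS, hli⟩ := le_rank_iff_exists_linearIndependent_finset.1 hrank
    refine ⟨fun i => (S.equivFinOfCardEq hS).symm i, ?_⟩
    exact hli.comp _ (S.equivFinOfCardEq hS).symm.injective
  have ho := InnerProductSpace.gramSchmidtNormed_orthonormal (𝕜 := ℂ) hf
  rw [orthonormal_iff_ite] at ho
  refine absurd (card_le_of_orthonormal hU hs hZ h
    (InnerProductSpace.gramSchmidtNormed ℂ f) (fun i => ?_) (fun i k hik => ?_)) (not_le.2 hn)
  · rw [hspec, ho, if_pos rfl, one_smul]
  · rw [hspec, ho, if_neg hik.symm, zero_smul]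

end Actions

section Actions

open CStarCategory CStarMonoidal

variable {C : Type u} [Category.{v} C] [MonoidalCategory C]
  [StarNorm C] [Preadditive C] [Linear ℂ C] [MultitensorCStar C]

/-- Frobenius reciprocity embeds `End Y` into `Hom(U, Y ⊗ Yb)`. -/
lemma finite_end_of_lact {U Y : C} (hU : IsScalarObj U) {s : U ⟶ 𝟙_ C}
    (hs : s ≫ s† = 𝟙 U) (hY : lact (s† ≫ s) Y = 𝟙 Y) : Module.Finite ℂ (Y ⟶ Y) := by
  obtain ⟨Yb, ω, ω', h⟩ := MultitensorCStar.rigid Y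
  obtain ⟨Zb, θ, θ', hθ⟩ := MultitensorCStar.rigid (Y ⊗ Yb)
  have hZ : lact (s† ≫ s) (Y ⊗ Yb) = 𝟙 (Y ⊗ Yb) := by rw [lact_tensor, hY, id_whiskerRight]
  have := finite_hom_of_isScalarObj hU hs hZ hθ
  let φ : (Y ⟶ Y) →ₗ[ℂ] (U ⟶ Y ⊗ Yb) :=
    { toFun := fun f => s ≫ ω' ≫ f ▷ Yb
      map_add' := fun f g => by simp [MonoidalPreadditive.add_whiskerRight]
      map_smul' := fun c f => by simp [MonoidalLinear.smul_whiskerRight] }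
  have key : ∀ f : Y ⟶ Y, f = (λ_ Y).inv ≫ s† ▷ Y ≫ φ f ▷ Y ≫ (α_ _ _ _).hom ≫ Y ◁ ω† ≫
      (ρ_ Y).hom :=
    fun f => eq_of_frobenius_transform hY h f
  refine Module.Finite.of_injective φ fun f g hfg => ?_
  rw [key f, key g, hfg]

end Actions

/-! ### Corners of a multitensor C*-category -/

section CornerDefs

variable (C : Type u) [Category.{v} C] [StarNorm C] [MonoidalCategory C]

/-- An orthogonal summand of the tensor unit, given by an isometry `s : U ⟶ 𝟙`. -/
structure UnitSummand where
  /-- the summand -/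
  U : C
  /-- the isometry into the tensor unit -/
  s : U ⟶ 𝟙_ C
  isometry : s ≫ s† = 𝟙 U

variable {C}

/-- The projection onto a summand of the tensor unit. -/
def UnitSummand.q (P : UnitSummand C) : 𝟙_ C ⟶ 𝟙_ C := P.s† ≫ P.s

/-- The corner `q ⊗ C ⊗ q`: the full subcategory of the objects supported on the summand `P` of
the unit from both sides. -/
structure Corner (P : UnitSummand C) where
  /-- the underlying object -/
  obj : C
  left : lact P.q obj = 𝟙 obj
  right : ract P.q obj = 𝟙 obj

instance (P : UnitSummand C) : Category (Corner P) where
  Hom X Y := X.obj ⟶ Y.obj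
  id X := 𝟙 X.obj
  comp f g := CategoryStruct.comp (obj := C) f g
  id_comp f := Category.id_comp (obj := C) f
  comp_id f := Category.comp_id (obj := C) f
  assoc f g h := Category.assoc (obj := C) f g h

instance (P : UnitSummand C) : StarNorm (Corner P) where
  dag f := StarNorm.dag (C := C) f
  nrm f := StarNorm.nrm (C := C) f

end CornerDefs

section CornerStructure

open CStarCategory CStarMonoidal

variable {C : Type u} [Category.{v} C] [StarNorm C] [Preadditive C] [Linear ℂ C]
  [MonoidalCategory C] [CStarMonoidal C] {P : UnitSummand C}

namespace UnitSummand

lemma q_idem (P : UnitSummand C) : P.q ≫ P.q = P.q := by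
  rw [q, Category.assoc, ← Category.assoc P.s, P.isometry, Category.id_comp]

lemma dag_q (P : UnitSummand C) : P.q† = P.q := by
  rw [q, dag_comp, dag_dag]

lemma s_q (P : UnitSummand C) : P.s ≫ P.q = P.s := by
  rw [q, ← Category.assoc, P.isometry, Category.id_comp]

instance (P : UnitSummand C) : Mono P.s := mono_of_isometry P.isometry

lemma lact_U (P : UnitSummand C) : lact P.q P.U = 𝟙 P.U := by
  rw [← cancel_mono P.s, ← lact_natural, lact_unit, s_q, Category.id_comp]

lemma ract_U (P : UnitSummand C) : ract P.q P.U = 𝟙 P.U := by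
  rw [← cancel_mono P.s, ← ract_natural, ract_unit, s_q, Category.id_comp]

end UnitSummand

namespace Corner

instance : Preadditive (Corner P) where
  homGroup X Y := inferInstanceAs (AddCommGroup (X.obj ⟶ Y.obj))
  add_comp X Y Z f f' g := Preadditive.add_comp (C := C) X.obj Y.obj Z.obj f f' g
  comp_add X Y Z f g g' := Preadditive.comp_add (C := C) X.obj Y.obj Z.obj f g g'

instance : Linear ℂ (Corner P) where
  homModule X Y := inferInstanceAs (Module ℂ (X.obj ⟶ Y.obj))
  smul_comp X Y Z c f g := Linear.smul_comp (C := C) X.obj Y.obj Z.obj c f g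
  comp_smul X Y Z f c g := Linear.comp_smul (C := C) X.obj Y.obj Z.obj f c g

/-- An isomorphism of the corner is an isomorphism in `C`. -/
def mkIso {X Y : Corner P} (e : X.obj ≅ Y.obj) : X ≅ Y where
  hom := e.hom
  inv := e.inv
  hom_inv_id := e.hom_inv_id
  inv_hom_id := e.inv_hom_id

/-- The left unitor of the corner. -/
def leftUnit (X : Corner P) : P.U ⊗ X.obj ≅ X.obj where
  hom := P.s ▷ X.obj ≫ (λ_ X.obj).hom
  inv := (λ_ X.obj).inv ≫ P.s† ▷ X.obj
  hom_inv_id := by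
    rw [Category.assoc, Iso.hom_inv_id_assoc, ← comp_whiskerRight, P.isometry, id_whiskerRight]
  inv_hom_id := by
    rw [Category.assoc, ← comp_whiskerRight_assoc]
    exact X.left

/-- The right unitor of the corner. -/
def rightUnit (X : Corner P) : X.obj ⊗ P.U ≅ X.obj where
  hom := X.obj ◁ P.s ≫ (ρ_ X.obj).hom
  inv := (ρ_ X.obj).inv ≫ X.obj ◁ P.s†
  hom_inv_id := by
    rw [Category.assoc, Iso.hom_inv_id_assoc, ← whiskerLeft_comp, P.isometry, whiskerLeft_id]
  inv_hom_id := by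
    rw [Category.assoc, ← whiskerLeft_comp_assoc]
    exact X.right

/-- The tensor product of the corner is that of `C`; its unit is the summand `P.U`, and its unitors
are those of `C` composed with the isometry `P.s`. -/
instance : MonoidalCategoryStruct (Corner P) where
  tensorObj X Y := ⟨X.obj ⊗ Y.obj, by rw [lact_tensor, X.left, id_whiskerRight],
    by rw [ract_tensor, Y.right, whiskerLeft_id]⟩
  whiskerLeft X _ _ f := MonoidalCategoryStruct.whiskerLeft (C := C) X.obj f
  whiskerRight f Y := MonoidalCategoryStruct.whiskerRight (C := C) f Y.obj
  tensorHom f g := MonoidalCategoryStruct.tensorHom (C := C) f g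
  tensorUnit := ⟨P.U, P.lact_U, P.ract_U⟩
  associator X Y Z := mkIso (α_ X.obj Y.obj Z.obj)
  leftUnitor X := mkIso (leftUnit X)
  rightUnitor X := mkIso (rightUnit X)

instance : MonoidalCategory (Corner P) where
  tensorHom_def f g := MonoidalCategory.tensorHom_def (C := C) f g
  id_tensorHom_id X Y := MonoidalCategory.id_tensorHom_id (C := C) X.obj Y.obj
  tensorHom_comp_tensorHom f₁ f₂ g₁ g₂ :=
    MonoidalCategory.tensorHom_comp_tensorHom (C := C) f₁ f₂ g₁ g₂
  whiskerLeft_id X Y := MonoidalCategory.whiskerLeft_id (C := C) X.obj Y.obj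
  id_whiskerRight X Y := MonoidalCategory.id_whiskerRight (C := C) X.obj Y.obj
  associator_naturality f g h := MonoidalCategory.associator_naturality (C := C) f g h
  leftUnitor_naturality {X Y} f := by
    let f' : X.obj ⟶ Y.obj := f
    change P.U ◁ f' ≫ P.s ▷ Y.obj ≫ (λ_ Y.obj).hom =
      (P.s ▷ X.obj ≫ (λ_ X.obj).hom) ≫ f'
    rw [whisker_exchange_assoc, leftUnitor_naturality, Category.assoc]
  rightUnitor_naturality {X Y} f := by
    let f' : X.obj ⟶ Y.obj := f
    change f' ▷ P.U ≫ Y.obj ◁ P.s ≫ (ρ_ Y.obj).hom =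
      (X.obj ◁ P.s ≫ (ρ_ X.obj).hom) ≫ f'
    rw [← whisker_exchange_assoc, rightUnitor_naturality, Category.assoc]
  pentagon W X Y Z := MonoidalCategory.pentagon (C := C) W.obj X.obj Y.obj Z.obj
  triangle X Y := by
    change (α_ X.obj P.U Y.obj).hom ≫ X.obj ◁ (P.s ▷ Y.obj ≫ (λ_ Y.obj).hom) =
      (X.obj ◁ P.s ≫ (ρ_ X.obj).hom) ▷ Y.obj
    monoidal

/-- A morphism of `C` as a morphism of the corner. -/
abbrev ofHom {X Y : Corner P} (f : X.obj ⟶ Y.obj) : X ⟶ Y := f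

instance : CStarCategory (Corner P) where
  dag_add f g := CStarCategory.dag_add (C := C) f g
  dag_smul c f := CStarCategory.dag_smul (C := C) c f
  dag_dag f := CStarCategory.dag_dag (C := C) f
  dag_comp f g := CStarCategory.dag_comp (C := C) f g
  nrm_add_le f g := CStarCategory.nrm_add_le (C := C) f g
  nrm_smul c f := CStarCategory.nrm_smul (C := C) c f
  eq_zero_of_nrm f := CStarCategory.eq_zero_of_nrm (C := C) f
  complete w hw := CStarCategory.complete (C := C) w hw
  nrm_comp_le f g := CStarCategory.nrm_comp_le (C := C) f g
  nrm_comp_dag f := CStarCategory.nrm_comp_dag (C := C) f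
  comp_dag_nonneg f := CStarCategory.comp_dag_nonneg (C := C) f

instance : MonoidalPreadditive (Corner P) where
  whiskerLeft_zero {X Y Z} :=
    MonoidalPreadditive.whiskerLeft_zero (C := C) (X := X.obj) (Y := Y.obj) (Z := Z.obj)
  zero_whiskerRight {X Y Z} :=
    MonoidalPreadditive.zero_whiskerRight (C := C) (X := X.obj) (Y := Y.obj) (Z := Z.obj)
  whiskerLeft_add {X Y Z} f g :=
    MonoidalPreadditive.whiskerLeft_add (C := C) (X := X.obj) (Y := Y.obj) (Z := Z.obj) f g
  add_whiskerRight {X Y Z} f g :=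
    MonoidalPreadditive.add_whiskerRight (C := C) (X := X.obj) (Y := Y.obj) (Z := Z.obj) f g

instance : MonoidalLinear ℂ (Corner P) where
  whiskerLeft_smul X _ _ c f := MonoidalLinear.whiskerLeft_smul (C := C) X.obj c f
  smul_whiskerRight c _ _ f X := MonoidalLinear.smul_whiskerRight (C := C) c f X.obj

/-- An orthogonal sum of objects supported on `q` is supported on `q`. -/
lemma lact_of_orthogonalSum {n : ℕ} {X : Fin n → C} {Z : C} {s : ∀ i, X i ⟶ Z}
    (hs : IsOrthogonalSum s) {z : 𝟙_ C ⟶ 𝟙_ C} (hX : ∀ i, lact z (X i) = 𝟙 (X i)) :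
    lact z Z = 𝟙 Z := by
  rw [← Category.id_comp (lact z Z), ← hs.2.2, Preadditive.sum_comp]
  refine Finset.sum_congr rfl fun i _ => ?_
  rw [Category.assoc, lact_natural, hX, Category.id_comp]

lemma ract_of_orthogonalSum {n : ℕ} {X : Fin n → C} {Z : C} {s : ∀ i, X i ⟶ Z}
    (hs : IsOrthogonalSum s) {z : 𝟙_ C ⟶ 𝟙_ C} (hX : ∀ i, ract z (X i) = 𝟙 (X i)) :
    ract z Z = 𝟙 Z := by
  rw [← Category.id_comp (ract z Z), ← hs.2.2, Preadditive.sum_comp]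
  refine Finset.sum_congr rfl fun i _ => ?_
  rw [Category.assoc, ract_natural, hX, Category.id_comp]

instance : CStarMonoidal (Corner P) where
  exists_sum {n} X := by
    obtain ⟨Z, s, hs⟩ := CStarMonoidal.exists_sum (C := C) (fun i => (X i).obj)
    exact ⟨⟨Z, lact_of_orthogonalSum hs fun i => (X i).left,
      ract_of_orthogonalSum hs fun i => (X i).right⟩, s, hs⟩
  exists_sub {X} p hp hp' := by
    obtain ⟨Y, s, hs, hs'⟩ := CStarMonoidal.exists_sub (C := C) (X := X.obj) p hp hp'
    have := mono_of_isometry hs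
    exact ⟨⟨Y, lact_eq_id_of_mono s X.left, ract_eq_id_of_mono s X.right⟩, s, hs, hs'⟩
  dag_tensor f g := CStarMonoidal.dag_tensor (C := C) f g
  associator_unitary X Y Z := CStarMonoidal.associator_unitary (C := C) X.obj Y.obj Z.obj
  leftUnitor_unitary X := by
    have h : (leftUnit X).hom† = (leftUnit X).inv := by simp [leftUnit]
    exact ⟨(congrArg ((leftUnit X).hom ≫ ·) h).trans (leftUnit X).hom_inv_id,
      (congrArg (· ≫ (leftUnit X).hom) h).trans (leftUnit X).inv_hom_id⟩
  rightUnitor_unitary X := by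
    have h : (rightUnit X).hom† = (rightUnit X).inv := by simp [rightUnit]
    exact ⟨(congrArg ((rightUnit X).hom ≫ ·) h).trans (rightUnit X).hom_inv_id,
      (congrArg (· ≫ (rightUnit X).hom) h).trans (rightUnit X).inv_hom_id⟩

end Corner

/-- The dual of an object supported on `z` from the right is supported on `z` from the left. -/
lemma ConjugateEquations.lact_dual {X Xb : C} {ω : 𝟙_ C ⟶ Xb ⊗ X} {ω' : 𝟙_ C ⟶ X ⊗ Xb}
    (h : ConjugateEquations ω ω') {z : 𝟙_ C ⟶ 𝟙_ C} (hX : ract z X = 𝟙 X) :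
    lact z Xb = 𝟙 Xb := by
  have h1 : z ≫ ω = ω := by
    rw [← comp_ract_unit, ract_tensor, hX, whiskerLeft_id, Category.comp_id]
  calc lact z Xb = lact z Xb ≫ (λ_ Xb).inv ≫ ω ▷ Xb ≫ (α_ Xb X Xb).hom ≫ Xb ◁ ω'† ≫
        (ρ_ Xb).hom := by rw [h.2, Category.comp_id]
    _ = 𝟙 _ ⊗≫ (z ≫ ω) ▷ Xb ⊗≫ Xb ◁ ω'† ⊗≫ 𝟙 _ := by
        rw [lact]; monoidal
    _ = (λ_ Xb).inv ≫ ω ▷ Xb ≫ (α_ Xb X Xb).hom ≫ Xb ◁ ω'† ≫ (ρ_ Xb).hom := by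
        rw [h1]; monoidal
    _ = 𝟙 Xb := h.2

lemma ConjugateEquations.ract_dual {X Xb : C} {ω : 𝟙_ C ⟶ Xb ⊗ X} {ω' : 𝟙_ C ⟶ X ⊗ Xb}
    (h : ConjugateEquations ω ω') {z : 𝟙_ C ⟶ 𝟙_ C} (hX : lact z X = 𝟙 X) :
    ract z Xb = 𝟙 Xb := by
  have h1 : z ≫ ω' = ω' := by
    rw [← comp_lact_unit, lact_tensor, hX, id_whiskerRight, Category.comp_id]
  calc ract z Xb = ract z Xb ≫ (ρ_ Xb).inv ≫ Xb ◁ ω' ≫ (α_ Xb X Xb).inv ≫ ω† ▷ Xb ≫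
        (λ_ Xb).hom := by rw [h.dag_snd, Category.comp_id]
    _ = 𝟙 _ ⊗≫ Xb ◁ (z ≫ ω') ⊗≫ ω† ▷ Xb ⊗≫ 𝟙 _ := by
        rw [ract]; monoidal
    _ = (ρ_ Xb).inv ≫ Xb ◁ ω' ≫ (α_ Xb X Xb).inv ≫ ω† ▷ Xb ≫ (λ_ Xb).hom := by
        rw [h1]; monoidal
    _ = 𝟙 Xb := h.dag_snd

/-- A solution of the conjugate equations in the corner, from one in `C`. -/
lemma Corner.conjugateEquations {X Xb : Corner P} {ω : 𝟙_ C ⟶ Xb.obj ⊗ X.obj}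
    {ω' : 𝟙_ C ⟶ X.obj ⊗ Xb.obj} (h : ConjugateEquations ω ω') :
    ConjugateEquations (C := Corner P) (X := X) (Xb := Xb)
      (Corner.ofHom (X := 𝟙_ (Corner P)) (Y := Xb ⊗ X) (P.s ≫ ω))
      (Corner.ofHom (X := 𝟙_ (Corner P)) (Y := X ⊗ Xb) (P.s ≫ ω')) := by
  have e1 : P.s† ≫ P.s ≫ ω = ω := by
    have : P.q ≫ ω = ω := by
      rw [← comp_lact_unit, lact_tensor, Xb.left, id_whiskerRight, Category.comp_id]
    rw [← this, UnitSummand.q]; simp only [Category.assoc]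
    rw [← Category.assoc P.s, P.isometry, Category.id_comp]
  have e2 : P.s† ≫ P.s ≫ ω' = ω' := by
    have : P.q ≫ ω' = ω' := by
      rw [← comp_lact_unit, lact_tensor, X.left, id_whiskerRight, Category.comp_id]
    rw [← this, UnitSummand.q]; simp only [Category.assoc]
    rw [← Category.assoc P.s, P.isometry, Category.id_comp]
  have e2' : ω'† ≫ P.s† ≫ P.s = ω'† := by
    have := congrArg StarNorm.dag e2
    simpa using this
  constructor
  · change ((ρ_ X.obj).inv ≫ X.obj ◁ P.s†) ≫ X.obj ◁ (P.s ≫ ω) ≫ (α_ X.obj Xb.obj X.obj).inv ≫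
      (P.s ≫ ω')† ▷ X.obj ≫ (P.s ▷ X.obj ≫ (λ_ X.obj).hom) = 𝟙 X.obj
    calc _ = (ρ_ X.obj).inv ≫ X.obj ◁ (P.s† ≫ P.s ≫ ω) ≫ (α_ X.obj Xb.obj X.obj).inv ≫
          (ω'† ≫ P.s† ≫ P.s) ▷ X.obj ≫ (λ_ X.obj).hom := by simp
      _ = 𝟙 _ := by rw [e1, e2', h.1]
  · change ((λ_ Xb.obj).inv ≫ P.s† ▷ Xb.obj) ≫ (P.s ≫ ω) ▷ Xb.obj ≫
      (α_ Xb.obj X.obj Xb.obj).hom ≫ Xb.obj ◁ (P.s ≫ ω')† ≫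
        (Xb.obj ◁ P.s ≫ (ρ_ Xb.obj).hom) = 𝟙 Xb.obj
    calc _ = (λ_ Xb.obj).inv ≫ (P.s† ≫ P.s ≫ ω) ▷ Xb.obj ≫ (α_ Xb.obj X.obj Xb.obj).hom ≫
          Xb.obj ◁ (ω'† ≫ P.s† ≫ P.s) ≫ (ρ_ Xb.obj).hom := by simp
      _ = 𝟙 _ := by rw [e1, e2', h.2]

end CornerStructure

section CornerMultitensor

open CStarCategory CStarMonoidal

variable {C : Type u} [Category.{v} C] [StarNorm C] [Preadditive C] [Linear ℂ C]
  [MonoidalCategory C] [MultitensorCStar C]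

instance Corner.multitensor (P : UnitSummand C) : MultitensorCStar (Corner P) where
  rigid X := by
    obtain ⟨Xb, ω, ω', h⟩ := MultitensorCStar.rigid (C := C) X.obj
    exact ⟨⟨Xb, h.lact_dual X.right, h.ract_dual X.left⟩, _, _,
      Corner.conjugateEquations (X := X) (Xb := ⟨Xb, _, _⟩) h⟩
  finite_center := by
    have := MultitensorCStar.finite_center (C := C)
    let φ : (P.U ⟶ P.U) →ₗ[ℂ] (𝟙_ C ⟶ 𝟙_ C) :=
      { toFun := fun g => P.s† ≫ g ≫ P.s
        map_add' := fun g h => by simp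
        map_smul' := fun c g => by simp }
    have hφ : ∀ g, P.s ≫ φ g ≫ P.s† = g := by
      intro g
      change P.s ≫ (P.s† ≫ g ≫ P.s) ≫ P.s† = g
      simp only [Category.assoc, P.isometry, Category.comp_id]
      rw [← Category.assoc, P.isometry, Category.id_comp]
    exact Module.Finite.of_injective φ fun g h hgh => by rw [← hφ g, ← hφ h, hgh]

lemma simple_of_isScalarObj {U : C} (hU : IsScalarObj U) : Simple U where
  mono_isIso_iff_nonzero {Y} f hf := by
    constructor
    · rintro h rfl
      apply hU.1
      rw [← IsIso.inv_hom_id (0 : Y ⟶ U), comp_zero]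
    · intro h0
      obtain ⟨c, hc⟩ := hU.2 (f† ≫ f)
      have hc0 : c ≠ 0 := by
        rintro rfl
        rw [zero_smul] at hc
        exact h0 (eq_zero_of_dag_comp hc)
      have h1 : (c⁻¹ • f†) ≫ f = 𝟙 U := by
        rw [Linear.smul_comp, hc, smul_smul, inv_mul_cancel₀ hc0, one_smul]
      refine ⟨c⁻¹ • f†, ?_, h1⟩
      rw [← cancel_mono f, Category.assoc, h1, Category.comp_id, Category.id_comp]

lemma Corner.tensorCStar (P : UnitSummand C) (hP : IsScalarObj P.U) : TensorCStar (Corner P) where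
  simple_unit := simple_of_isScalarObj (C := Corner P) (U := 𝟙_ (Corner P)) hP

end CornerMultitensor

/-! ### Splitting off a central summand of the unit -/

section Cut

open CStarCategory CStarMonoidal

variable {C : Type u} [Category.{v} C] [StarNorm C] [Preadditive C] [Linear ℂ C]
  [MonoidalCategory C] [CStarMonoidal C]

/-- The summand `P` of the unit is central if it acts on every object in the same way from the left
and from the right. -/
def UnitSummand.IsCentral (P : UnitSummand C) : Prop := ∀ Y : C, lact P.q Y = ract P.q Y

variable (P : UnitSummand C)

lemma lact_q_idem (Y : C) : lact P.q Y ≫ lact P.q Y = lact P.q Y := by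
  rw [← lact_comp, P.q_idem]

lemma lact_q_dag (Y : C) : (lact P.q Y)† = lact P.q Y := by
  rw [dag_lact, P.dag_q]

/-- A chosen subobject `q ⊗ Y` of `Y`. -/
noncomputable def cutObj (Y : C) : C :=
  (exists_sub (lact P.q Y) (lact_q_idem P Y) (lact_q_dag P Y)).choose

/-- The chosen isometry `q ⊗ Y ⟶ Y`. -/
noncomputable def cutIncl (Y : C) : cutObj P Y ⟶ Y :=
  (exists_sub (lact P.q Y) (lact_q_idem P Y) (lact_q_dag P Y)).choose_spec.choose

@[simp] lemma cutIncl_dag (Y : C) : cutIncl P Y ≫ (cutIncl P Y)† = 𝟙 _ :=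
  (exists_sub (lact P.q Y) (lact_q_idem P Y) (lact_q_dag P Y)).choose_spec.choose_spec.1

@[simp] lemma cutIncl_dag_assoc (Y : C) {Z : C} (f : cutObj P Y ⟶ Z) :
    cutIncl P Y ≫ (cutIncl P Y)† ≫ f = f := by
  rw [← Category.assoc, cutIncl_dag, Category.id_comp]

lemma dag_cutIncl (Y : C) : (cutIncl P Y)† ≫ cutIncl P Y = lact P.q Y :=
  (exists_sub (lact P.q Y) (lact_q_idem P Y) (lact_q_dag P Y)).choose_spec.choose_spec.2

instance (Y : C) : Mono (cutIncl P Y) := mono_of_isometry (cutIncl_dag P Y)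

@[simp] lemma cutIncl_lact (Y : C) : cutIncl P Y ≫ lact P.q Y = cutIncl P Y := by
  rw [← dag_cutIncl, cutIncl_dag_assoc]

lemma lact_cutObj (Y : C) : lact P.q (cutObj P Y) = 𝟙 _ := by
  rw [← cancel_mono (cutIncl P Y), ← lact_natural, cutIncl_lact, Category.id_comp]

/-- The compression of `f` to `q ⊗ Y ⟶ q ⊗ Z`. -/
noncomputable def cutMap {Y Z : C} (f : Y ⟶ Z) : cutObj P Y ⟶ cutObj P Z :=
  cutIncl P Y ≫ f ≫ (cutIncl P Z)†

lemma cutMap_incl {Y Z : C} (f : Y ⟶ Z) : cutMap P f ≫ cutIncl P Z = cutIncl P Y ≫ f := by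
  rw [cutMap, Category.assoc, Category.assoc, dag_cutIncl, lact_natural, ← Category.assoc,
    cutIncl_lact]

lemma incl_dag_cutMap {Y Z : C} (f : Y ⟶ Z) :
    (cutIncl P Y)† ≫ cutMap P f ≫ cutIncl P Z = lact P.q Y ≫ f := by
  rw [cutMap_incl, ← Category.assoc, dag_cutIncl]

variable {P} (hP : P.IsCentral)

lemma tensor_incl_lact (Y Z : C) :
    (cutIncl P Y ⊗ₘ cutIncl P Z) ≫ lact P.q (Y ⊗ Z) = cutIncl P Y ⊗ₘ cutIncl P Z := by
  rw [lact_natural, lact_tensor, lact_cutObj, id_whiskerRight, Category.id_comp]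

/-- Centrality of `P` makes the subobject `q ⊗ Y` an object of the corner. -/
lemma ract_cutObj {P : UnitSummand C} (hP : P.IsCentral) (Y : C) :
    ract P.q (cutObj P Y) = 𝟙 _ := by
  rw [← hP, lact_cutObj]

/-- For central `P`, the tensorator of the functor `Y ↦ q ⊗ Y`. -/
noncomputable def cutμ (hP : P.IsCentral) (Y Z : C) :
    cutObj P Y ⊗ cutObj P Z ≅ cutObj P (Y ⊗ Z) where
  hom := (cutIncl P Y ⊗ₘ cutIncl P Z) ≫ (cutIncl P (Y ⊗ Z))†
  inv := cutIncl P (Y ⊗ Z) ≫ ((cutIncl P Y)† ⊗ₘ (cutIncl P Z)†)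
  hom_inv_id := by
    rw [Category.assoc, ← Category.assoc (cutIncl P (Y ⊗ Z))†, dag_cutIncl, ← Category.assoc,
      tensor_incl_lact]
    simp [tensorHom_comp_tensorHom]
  inv_hom_id := by
    have h : (lact P.q Y ⊗ₘ lact P.q Z) = lact P.q (Y ⊗ Z) := by
      rw [MonoidalCategory.tensorHom_def, ← ract_whiskerRight, ← hP, ← lact_tensor, lact_q_idem]
    rw [Category.assoc, ← Category.assoc _ _ (cutIncl P (Y ⊗ Z))†, tensorHom_comp_tensorHom,
      dag_cutIncl, dag_cutIncl, h, ← Category.assoc, cutIncl_lact, cutIncl_dag]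

lemma cutμ_incl (Y Z : C) :
    (cutμ hP Y Z).hom ≫ cutIncl P (Y ⊗ Z) = cutIncl P Y ⊗ₘ cutIncl P Z := by
  rw [cutμ, Category.assoc, dag_cutIncl, tensor_incl_lact]

lemma cutμ_dag (Y Z : C) : (cutμ hP Y Z).hom† = (cutμ hP Y Z).inv := by
  simp [cutμ, dag_tensor]

/-- The unit isomorphism of the functor `Y ↦ q ⊗ Y`. -/
noncomputable def cutε (P : UnitSummand C) : P.U ≅ cutObj P (𝟙_ C) where
  hom := P.s ≫ (cutIncl P (𝟙_ C))†
  inv := cutIncl P (𝟙_ C) ≫ P.s†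
  hom_inv_id := by
    rw [Category.assoc, ← Category.assoc (cutIncl P (𝟙_ C))†, dag_cutIncl, lact_unit,
      ← Category.assoc, P.s_q, P.isometry]
  inv_hom_id := by
    rw [Category.assoc, ← Category.assoc P.s†]
    change cutIncl P (𝟙_ C) ≫ P.q ≫ _ = _
    rw [← lact_unit P.q, ← Category.assoc, cutIncl_lact, cutIncl_dag]

lemma cutε_incl : (cutε P).hom ≫ cutIncl P (𝟙_ C) = P.s := by
  rw [cutε, Category.assoc, dag_cutIncl, lact_unit, P.s_q]

lemma cutε_dag : (cutε P).hom† = (cutε P).inv := by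
  simp [cutε]

/-- The functor `Y ↦ q ⊗ Y` to the corner of a central summand. -/
noncomputable def cut (hP : P.IsCentral) : C ⥤ Corner P where
  obj Y := ⟨cutObj P Y, lact_cutObj P Y, ract_cutObj hP Y⟩
  map f := cutMap P f
  map_id Y := by
    change cutMap P (𝟙 Y) = 𝟙 _
    rw [← cancel_mono (cutIncl P Y), cutMap_incl, Category.comp_id, Category.id_comp]
  map_comp {X Y Z} f g := by
    change cutMap P (f ≫ g) = cutMap P f ≫ cutMap P g
    rw [← cancel_mono (cutIncl P Z), cutMap_incl, Category.assoc, cutMap_incl, ← Category.assoc,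
      ← Category.assoc, cutMap_incl]

/-- The monoidal structure of `cut`. -/
noncomputable def cutCore : (cut hP).CoreMonoidal where
  εIso := Corner.mkIso (cutε P)
  μIso Y Z := Corner.mkIso (cutμ hP Y Z)
  μIso_hom_natural_left {Y Z} f W := by
    change cutMap P f ▷ cutObj P W ≫ (cutμ hP Z W).hom = (cutμ hP Y W).hom ≫ cutMap P (f ▷ W)
    rw [← cancel_mono (cutIncl P (Z ⊗ W)), Category.assoc, Category.assoc, cutμ_incl, cutMap_incl,
      ← Category.assoc _ _ (f ▷ W), cutμ_incl, ← tensorHom_id, ← tensorHom_id,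
      tensorHom_comp_tensorHom, tensorHom_comp_tensorHom, cutMap_incl, Category.id_comp,
      Category.comp_id]
  μIso_hom_natural_right {Y Z} W f := by
    change cutObj P W ◁ cutMap P f ≫ (cutμ hP W Z).hom = (cutμ hP W Y).hom ≫ cutMap P (W ◁ f)
    rw [← cancel_mono (cutIncl P (W ⊗ Z)), Category.assoc, Category.assoc, cutμ_incl, cutMap_incl,
      ← Category.assoc _ _ (W ◁ f), cutμ_incl, ← id_tensorHom, ← id_tensorHom,
      tensorHom_comp_tensorHom, tensorHom_comp_tensorHom, cutMap_incl, Category.id_comp,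
      Category.comp_id]
  associativity X Y Z := by
    change (cutμ hP X Y).hom ▷ cutObj P Z ≫ (cutμ hP (X ⊗ Y) Z).hom ≫ cutMap P (α_ X Y Z).hom =
      (α_ _ _ _).hom ≫ cutObj P X ◁ (cutμ hP Y Z).hom ≫ (cutμ hP X (Y ⊗ Z)).hom
    rw [← cancel_mono (cutIncl P (X ⊗ (Y ⊗ Z)))]
    simp only [Category.assoc, cutμ_incl, cutMap_incl]
    rw [← Category.assoc _ _ (α_ X Y Z).hom, cutμ_incl, ← tensorHom_id, ← id_tensorHom,
      ← Category.assoc, tensorHom_comp_tensorHom, tensorHom_comp_tensorHom, cutμ_incl, cutμ_incl,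
      Category.id_comp, Category.id_comp, associator_naturality]
  left_unitality X := by
    change P.s ▷ cutObj P X ≫ (λ_ _).hom =
      (cutε P).hom ▷ cutObj P X ≫ (cutμ hP (𝟙_ C) X).hom ≫ cutMap P (λ_ X).hom
    rw [← cancel_mono (cutIncl P X)]
    simp only [Category.assoc, cutMap_incl]
    rw [← Category.assoc _ _ (λ_ X).hom, cutμ_incl, ← tensorHom_id (cutε P).hom,
      tensorHom_comp_tensorHom_assoc, cutε_incl, Category.id_comp, tensorHom_def_assoc,
      leftUnitor_naturality]
  right_unitality X := by
    change cutObj P X ◁ P.s ≫ (ρ_ _).hom =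
      cutObj P X ◁ (cutε P).hom ≫ (cutμ hP X (𝟙_ C)).hom ≫ cutMap P (ρ_ X).hom
    rw [← cancel_mono (cutIncl P X)]
    simp only [Category.assoc, cutMap_incl]
    rw [← Category.assoc _ _ (ρ_ X).hom, cutμ_incl, ← id_tensorHom _ (cutε P).hom,
      tensorHom_comp_tensorHom_assoc, cutε_incl, Category.id_comp, tensorHom_def'_assoc,
      rightUnitor_naturality]

/-- Two objects have an orthogonal direct sum. -/
lemma exists_sum_two (A B : C) : ∃ (Z : C) (a : A ⟶ Z) (b : B ⟶ Z),
    a ≫ a† = 𝟙 A ∧ b ≫ b† = 𝟙 B ∧ a ≫ b† = 0 ∧ b ≫ a† = 0 ∧ a† ≫ a + b† ≫ b = 𝟙 Z := by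
  obtain ⟨Z, s, h1, h2, h3⟩ := exists_sum (C := C) ![A, B]
  refine ⟨Z, s 0, s 1, h1 0, h1 1, h2 0 1 (by simp), h2 1 0 (by simp), ?_⟩
  rw [← h3, Fin.sum_univ_two]
  rfl

/-- Complementary summands of the unit. -/
def UnitSummand.Complementary (P Q : UnitSummand C) : Prop := P.q + Q.q = 𝟙 _

namespace UnitSummand.Complementary

variable {Q : UnitSummand C} (h : P.Complementary Q)

include h

lemma symm : Q.Complementary P := by
  rw [Complementary, add_comm]; exact h

lemma q_eq : Q.q = 𝟙 _ - P.q := eq_sub_of_add_eq' h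

lemma isCentral (hP : P.IsCentral) : Q.IsCentral := by
  intro Y
  have e1 : lact P.q Y + lact Q.q Y = 𝟙 Y := by rw [← lact_add, h, lact_id]
  have e2 : ract P.q Y + ract Q.q Y = 𝟙 Y := by rw [← ract_add, h, ract_id]
  rw [← hP] at e2
  exact add_left_cancel (e1.trans e2.symm)

lemma mul_eq_zero : P.q ≫ Q.q = 0 := by
  rw [h.q_eq, Preadditive.comp_sub, Category.comp_id, P.q_idem, sub_self]

lemma incl_dag_incl (Y : C) : cutIncl P Y ≫ (cutIncl Q Y)† = 0 := by
  have e : (cutIncl Q Y)† = lact Q.q Y ≫ (cutIncl Q Y)† := by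
    rw [← dag_cutIncl, Category.assoc, cutIncl_dag, Category.comp_id]
  rw [e, ← cutIncl_lact P Y, Category.assoc, ← Category.assoc (lact P.q Y), ← lact_comp,
    h.mul_eq_zero]
  simp

lemma eq_sum {Y Z : C} (f : Y ⟶ Z) :
    f = (cutIncl P Y)† ≫ cutMap P f ≫ cutIncl P Z + (cutIncl Q Y)† ≫ cutMap Q f ≫ cutIncl Q Z := by
  rw [incl_dag_cutMap, incl_dag_cutMap, ← Preadditive.add_comp, ← lact_add, h, lact_id,
    Category.id_comp]

lemma cutMap_sum {Y Z : C} (a : cutObj P Y ⟶ cutObj P Z) (b : cutObj Q Y ⟶ cutObj Q Z) :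
    cutMap P ((cutIncl P Y)† ≫ a ≫ cutIncl P Z + (cutIncl Q Y)† ≫ b ≫ cutIncl Q Z) = a := by
  rw [cutMap, Preadditive.add_comp, Preadditive.comp_add]
  simp only [Category.assoc, cutIncl_dag, cutIncl_dag_assoc, Category.comp_id]
  rw [← Category.assoc _ _ (b ≫ _), h.incl_dag_incl, zero_comp, add_zero]

/-- Cutting a sum of an object supported on `P` and one supported on `Q` recovers the former. -/
lemma cut_sum_iso {A B Z : C} (hA : lact P.q A = 𝟙 A) (hB : lact Q.q B = 𝟙 B) {a : A ⟶ Z}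
    {b : B ⟶ Z} (ha : a ≫ a† = 𝟙 A) (hab : a† ≫ a + b† ≫ b = 𝟙 Z) :
    Nonempty (cutObj P Z ≅ A) := by
  have e1 : cutIncl P Z ≫ b† = 0 := by
    rw [← Category.comp_id (cutIncl P Z ≫ b†), ← hB, Category.assoc, lact_natural,
      ← cutIncl_lact P Z, Category.assoc, ← Category.assoc (lact P.q Z), ← lact_comp,
      h.mul_eq_zero]
    simp
  refine ⟨⟨cutIncl P Z ≫ a†, a ≫ (cutIncl P Z)†, ?_, ?_⟩⟩
  · have e2 := congrArg (fun x => cutIncl P Z ≫ x ≫ (cutIncl P Z)†) hab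
    simp only [Preadditive.add_comp, Preadditive.comp_add, Category.assoc] at e2
    rw [← Category.assoc _ b†, e1, zero_comp, add_zero, Category.id_comp, cutIncl_dag] at e2
    rw [Category.assoc]; exact e2
  · rw [Category.assoc, ← Category.assoc _ (cutIncl P Z), dag_cutIncl, ← Category.assoc,
      lact_natural, hA, Category.id_comp, ha]

end UnitSummand.Complementary

end Cut

section Decompose

open CStarCategory CStarMonoidal

variable {C : Type u} [Category.{v} C] [StarNorm C] [Preadditive C] [Linear ℂ C]
  [MonoidalCategory C] [MultitensorCStar C]

/-- Complementary central summands of the unit decompose the category as a direct sum of two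
corners. -/
theorem equivalentMultitensor_corners {P Q : UnitSummand C} (hP : P.IsCentral)
    (h : P.Complementary Q) : EquivalentMultitensor C (Corner P × Corner Q) := by
  have hQ := h.isCentral hP
  let : (cut hP).Monoidal := (cutCore hP).toMonoidal
  let : (cut hQ).Monoidal := (cutCore hQ).toMonoidal
  refine ⟨Functor.prod' (cut hP) (cut hQ), inferInstance, ?_, ?_, ?_, ?_, ?_, ?_⟩
  · have hfaithful : (Functor.prod' (cut hP) (cut hQ)).Faithful := by
      constructor
      intro Y Z f g hfg
      have h1 : cutMap P f = cutMap P g := congrArg Prod.fst hfg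
      have h2 : cutMap Q f = cutMap Q g := congrArg Prod.snd hfg
      rw [h.eq_sum f, h.eq_sum g, h1, h2]
    have hfull : (Functor.prod' (cut hP) (cut hQ)).Full := by
      constructor
      intro Y Z f
      obtain ⟨a, b⟩ := f
      let a' : cutObj P Y ⟶ cutObj P Z := a
      let b' : cutObj Q Y ⟶ cutObj Q Z := b
      refine ⟨(cutIncl P Y)† ≫ a' ≫ cutIncl P Z + (cutIncl Q Y)† ≫ b' ≫ cutIncl Q Z, ?_⟩
      apply Prod.ext
      · exact h.cutMap_sum a' b'
      · exact (congrArg (cutMap Q) (add_comm _ _)).trans (h.symm.cutMap_sum b' a')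
    have hess : (Functor.prod' (cut hP) (cut hQ)).EssSurj := by
      constructor
      rintro ⟨A, B⟩
      obtain ⟨Z, a, b, ha, hb, -, -, hab⟩ := exists_sum_two A.obj B.obj
      obtain ⟨e1⟩ := h.cut_sum_iso A.left B.left ha hab
      obtain ⟨e2⟩ := h.symm.cut_sum_iso B.left A.left hb ((add_comm _ _).trans hab)
      exact ⟨Z, ⟨Iso.prod (Corner.mkIso e1) (Corner.mkIso e2)⟩⟩
    exact { }
  · constructor
    intro Y Z f g
    apply Prod.ext
    · change cutMap P (f + g) = cutMap P f + cutMap P g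
      simp [cutMap]
    · change cutMap Q (f + g) = cutMap Q f + cutMap Q g
      simp [cutMap]
  · constructor
    intro Y Z f c
    apply Prod.ext
    · change cutMap P (c • f) = c • cutMap P f
      simp [cutMap]
    · change cutMap Q (c • f) = c • cutMap Q f
      simp [cutMap]
  · intro Y Z f
    apply Prod.ext
    · change cutMap P f† = (cutMap P f)†
      simp [cutMap]
    · change cutMap Q f† = (cutMap Q f)†
      simp [cutMap]
  · have e1 : ∀ (R : UnitSummand C), (cutε R).hom ≫ (cutε R).hom† = 𝟙 _ ∧
        (cutε R).hom† ≫ (cutε R).hom = 𝟙 _ := fun R => by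
      rw [cutε_dag]; exact ⟨Iso.hom_inv_id _, Iso.inv_hom_id _⟩
    have h1 : IsUnitary (Functor.LaxMonoidal.ε (cut hP)) := e1 P
    have h2 : IsUnitary (Functor.LaxMonoidal.ε (cut hQ)) := e1 Q
    rw [← Functor.prod'_ε_fst (cut hP) (cut hQ)] at h1
    rw [← Functor.prod'_ε_snd (cut hP) (cut hQ)] at h2
    exact ⟨Prod.ext h1.1 h2.1, Prod.ext h1.2 h2.2⟩
  · intro X Y
    have e1 : ∀ {R : UnitSummand C} (hR : R.IsCentral),
        (cutμ hR X Y).hom ≫ (cutμ hR X Y).hom† = 𝟙 _ ∧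
        (cutμ hR X Y).hom† ≫ (cutμ hR X Y).hom = 𝟙 _ := fun hR => by
      rw [cutμ_dag]; exact ⟨Iso.hom_inv_id _, Iso.inv_hom_id _⟩
    have h1 : IsUnitary (Functor.LaxMonoidal.μ (cut hP) X Y) := e1 hP
    have h2 : IsUnitary (Functor.LaxMonoidal.μ (cut hQ) X Y) := e1 hQ
    rw [← Functor.prod'_μ_fst (cut hP) (cut hQ)] at h1
    rw [← Functor.prod'_μ_snd (cut hP) (cut hQ)] at h2
    exact ⟨Prod.ext h1.1 h2.1, Prod.ext h1.2 h2.2⟩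

lemma Corner.nonzero {P : UnitSummand C} (hP : P.q ≠ 0) : NonzeroCategory (Corner P) := by
  refine ⟨𝟙_ (Corner P), fun h => hP ?_⟩
  have h0 : 𝟙 P.U = 0 := (IsZero.iff_id_eq_zero (𝟙_ (Corner P))).1 h
  rw [UnitSummand.q, ← Category.id_comp P.s, h0]
  simp

/-- In an indecomposable multitensor C*-category, a central projection of the unit is trivial. -/
theorem Indecomposable.eq_id_of_central (hC : Indecomposable C) {q : 𝟙_ C ⟶ 𝟙_ C}
    (hq : q ≫ q = q) (hq' : q† = q) (hq0 : q ≠ 0) (hcen : ∀ Y : C, lact q Y = ract q Y) :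
    q = 𝟙 _ := by
  by_contra hq1
  obtain ⟨U, s, hs, hsq⟩ := exists_sub q hq hq'
  obtain ⟨V, t, ht, htq⟩ := exists_sub (𝟙 _ - q) (by simp [hq]) (by rw [dag_sub, hq', dag_one])
  let P : UnitSummand C := ⟨U, s, hs⟩
  let Q : UnitSummand C := ⟨V, t, ht⟩
  have hPq : P.q = q := hsq
  have hQq : Q.q = 𝟙 _ - q := htq
  have hPQ : P.Complementary Q := by
    rw [UnitSummand.Complementary, hPq, hQq]; simp
  have hP : P.IsCentral := by
    intro Y; rw [hPq]; exact hcen Y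
  apply hC.2
  refine ⟨Corner P, inferInstance, inferInstance, inferInstance, inferInstance, inferInstance,
    Corner Q, inferInstance, inferInstance, inferInstance, inferInstance, inferInstance,
    inferInstance, inferInstance, Corner.nonzero ?_, Corner.nonzero ?_,
    equivalentMultitensor_corners hP hPQ⟩
  · rw [hPq]; exact hq0
  · rw [hQq]; exact fun h => hq1 (sub_eq_zero.1 h).symm

end Decompose

/-! ### A generating object of an indecomposable multitensor C*-category -/

section Generator

open CStarCategory CStarMonoidal

variable {C : Type u} [Category.{v} C] [StarNorm C] [Preadditive C] [Linear ℂ C]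
  [MonoidalCategory C] [MultitensorCStar C]

/-- A right action by `z` which kills `ω` kills `X`, by the first conjugate equation. -/
lemma ract_eq_zero_of_comp {X Xb : C} {ω : 𝟙_ C ⟶ Xb ⊗ X} {ω' : 𝟙_ C ⟶ X ⊗ Xb}
    (h : ConjugateEquations ω ω') {z : 𝟙_ C ⟶ 𝟙_ C} (hz : z ≫ ω = 0) : ract z X = 0 := by
  calc ract z X = ract z X ≫ (ρ_ X).inv ≫ X ◁ ω ≫ (α_ X Xb X).inv ≫ ω'† ▷ X ≫ (λ_ X).hom := by
        rw [h.1, Category.comp_id]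
    _ = 𝟙 _ ⊗≫ X ◁ (z ≫ ω) ⊗≫ ω'† ▷ X ⊗≫ 𝟙 _ := by
        rw [ract]; monoidal
    _ = 0 := by rw [hz]; simp [monoidalComp]

lemma dual_ne_zero {X Xb : C} {ω : 𝟙_ C ⟶ Xb ⊗ X} {ω' : 𝟙_ C ⟶ X ⊗ Xb}
    (h : ConjugateEquations ω ω') (hX : 𝟙 X ≠ 0) : 𝟙 Xb ≠ 0 := by
  intro h0
  have h1 : ω = 0 := by
    rw [← Category.comp_id ω, ← id_whiskerRight, h0]; simp
  apply hX
  rw [← ract_id X]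
  exact ract_eq_zero_of_comp h (by rw [h1, comp_zero])

/-- The tensor product of two nonzero objects supported on the same simple summand of the unit is
nonzero. -/
lemma tensor_ne_zero {P : UnitSummand C} (hP : IsScalarObj P.U) {X Y : C} (hX : 𝟙 X ≠ 0)
    (hX' : ract P.q X = 𝟙 X) (hY : 𝟙 Y ≠ 0) (hY' : lact P.q Y = 𝟙 Y) : 𝟙 (X ⊗ Y) ≠ 0 := by
  intro h0
  obtain ⟨Xb, ω, ω', h⟩ := MultitensorCStar.rigid X
  -- `g* g` is a nonzero scalar on `P.U`, so `X ⊗ Y = 0` forces `P.U ⊗ Y ≅ Y` to vanish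
  set g := P.s ≫ ω with hg
  have hg0 : g ≠ 0 := by
    intro hg0
    apply hX
    rw [← hX']
    apply ract_eq_zero_of_comp h
    rw [UnitSummand.q, Category.assoc, ← hg, hg0, comp_zero]
  have hgY : g ▷ Y = 0 := by
    have : 𝟙 ((Xb ⊗ X) ⊗ Y) = 0 := by
      rw [← Iso.hom_inv_id (α_ Xb X Y), ← Category.id_comp (α_ Xb X Y).inv, ← whiskerLeft_id, h0]
      simp
    rw [← Category.comp_id (g ▷ Y), this, comp_zero]
  obtain ⟨c, hc⟩ := hP.2 (g ≫ g†)
  have hc0 : c ≠ 0 := by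
    rintro rfl
    rw [zero_smul] at hc
    exact hg0 (eq_zero_of_comp_dag hc)
  have h1 : (𝟙 P.U) ▷ Y = 0 := by
    have : c • (𝟙 P.U) ▷ Y = 0 := by
      rw [← MonoidalLinear.smul_whiskerRight, ← hc, comp_whiskerRight, hgY, zero_comp]
    exact (smul_eq_zero.1 this).resolve_left hc0
  apply hY
  rw [← hY', lact, UnitSummand.q, ← Category.id_comp P.s, comp_whiskerRight, comp_whiskerRight, h1]
  simp

/-- A nonzero object supported on `P` from the left and on `Q` from the right. -/
def Linked (P Q : UnitSummand C) : Prop :=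
  ∃ X : C, 𝟙 X ≠ 0 ∧ lact P.q X = 𝟙 X ∧ ract Q.q X = 𝟙 X

lemma Linked.symm {P Q : UnitSummand C} (h : Linked P Q) : Linked Q P := by
  obtain ⟨X, h0, h1, h2⟩ := h
  obtain ⟨Xb, ω, ω', h⟩ := MultitensorCStar.rigid X
  exact ⟨Xb, dual_ne_zero h h0, h.lact_dual h2, h.ract_dual h1⟩

lemma Linked.trans {P Q R : UnitSummand C} (hQ : IsScalarObj Q.U) (h : Linked P Q)
    (h' : Linked Q R) : Linked P R := by
  obtain ⟨X, h0, h1, h2⟩ := h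
  obtain ⟨Y, h0', h1', h2'⟩ := h'
  exact ⟨X ⊗ Y, tensor_ne_zero hQ h0 h2 h0' h1', by rw [lact_tensor, h1, id_whiskerRight],
    by rw [ract_tensor, h2', whiskerLeft_id]⟩

/-- The range of the projection `q_P ⊗ 1_Y ⊗ q_Q` links `P` and `Q`. -/
lemma linked_of_comp_ne_zero {P Q : UnitSummand C} {Y : C} (h : lact P.q Y ≫ ract Q.q Y ≠ 0) :
    Linked P Q := by
  have hcomm : lact P.q Y ≫ ract Q.q Y = ract Q.q Y ≫ lact P.q Y := ract_natural _ _
  have hL : lact P.q Y ≫ lact P.q Y = lact P.q Y := by rw [← lact_comp, P.q_idem]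
  have hR : ract Q.q Y ≫ ract Q.q Y = ract Q.q Y := by rw [← ract_comp, Q.q_idem]
  obtain ⟨Z, t, ht, ht'⟩ := exists_sub (lact P.q Y ≫ ract Q.q Y)
    (by
      calc _ = lact P.q Y ≫ (ract Q.q Y ≫ lact P.q Y) ≫ ract Q.q Y := by
            simp only [Category.assoc]
        _ = (lact P.q Y ≫ lact P.q Y) ≫ ract Q.q Y ≫ ract Q.q Y := by
            rw [← hcomm]; simp only [Category.assoc]
        _ = _ := by rw [hL, hR])
    (by rw [dag_comp, dag_lact, dag_ract, P.dag_q, Q.dag_q, hcomm])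
  have hm := mono_of_isometry ht
  have htp : t ≫ lact P.q Y ≫ ract Q.q Y = t := by
    rw [← ht', ← Category.assoc, ht, Category.id_comp]
  refine ⟨Z, ?_, ?_, ?_⟩
  · intro h0
    apply h
    rw [← ht', ← Category.id_comp t, h0, zero_comp, comp_zero]
  · rw [← cancel_mono t, ← lact_natural, Category.id_comp]
    calc t ≫ lact P.q Y = (t ≫ lact P.q Y ≫ ract Q.q Y) ≫ lact P.q Y := by rw [htp]
      _ = t ≫ (lact P.q Y ≫ lact P.q Y) ≫ ract Q.q Y := by
          simp only [Category.assoc]; rw [← hcomm]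
      _ = t := by rw [hL, htp]
  · rw [← cancel_mono t, ← ract_natural, Category.id_comp]
    calc t ≫ ract Q.q Y = (t ≫ lact P.q Y ≫ ract Q.q Y) ≫ ract Q.q Y := by rw [htp]
      _ = t := by simp only [Category.assoc]; rw [hR, htp]

variable {n : ℕ} {P : Fin n → UnitSummand C}

lemma q_comp_q_of_ne (hP : IsOrthogonalSum fun i => (P i).s) {i k : Fin n} (h : i ≠ k) :
    (P i).q ≫ (P k).q = 0 := by
  have := hP.2.1 i k h
  simp only [UnitSummand.q, Category.assoc]
  rw [← Category.assoc (P i).s, this]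
  simp

/-- In an indecomposable category all simple summands of the unit are linked: the sum of those
linked to a given one is central. -/
lemma linked_of_indecomposable (hC : Indecomposable C)
    (hP : IsOrthogonalSum fun i => (P i).s) (hs : ∀ i, IsScalarObj (P i).U) (i k : Fin n) :
    Linked (P i) (P k) := by
  classical
  have hsum : ∑ i, (P i).q = 𝟙 (𝟙_ C) := hP.2.2
  have hne : ∀ i, (P i).q ≠ 0 := by
    intro i h
    apply (hs i).1
    rw [← (P i).isometry, ← (P i).s_q, h]; simp
  set S := Finset.univ.filter fun k => Linked (P i) (P k) with hS
  have hmem : ∀ k, k ∈ S ↔ Linked (P i) (P k) := fun k => by simp [hS]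
  set q := ∑ k ∈ S, (P k).q with hq
  have hqk : ∀ k, (P k).q ≫ q = if k ∈ S then (P k).q else 0 := by
    intro k
    rw [hq, Preadditive.comp_sum]
    split_ifs with hk
    · rw [Finset.sum_eq_single k]
      · exact (P k).q_idem
      · exact fun l _ hl => q_comp_q_of_ne hP hl.symm
      · exact fun h => absurd hk h
    · exact Finset.sum_eq_zero fun l hl => q_comp_q_of_ne hP fun h => hk (h ▸ hl)
  have hii : i ∈ S := by
    rw [hmem]
    exact ⟨(P i).U, (hs i).1, (P i).lact_U, (P i).ract_U⟩
  have hqq : q ≫ q = q := by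
    conv_lhs => arg 1; rw [hq]
    rw [Preadditive.sum_comp, hq]
    exact Finset.sum_congr rfl fun k hk => by rw [← hq, hqk, if_pos hk]
  have hqd : q† = q := by
    rw [hq, dag_sum]
    exact Finset.sum_congr rfl fun k _ => (P k).dag_q
  have hq0 : q ≠ 0 := by
    intro h
    have := hqk i
    rw [if_pos hii, h, comp_zero] at this
    exact hne i this.symm
  have hcen : ∀ Y : C, lact q Y = ract q Y := by
    intro Y
    -- no object has a nonzero component between a summand in `S` and one outside `S`
    have hzero : ∀ k l, (k ∈ S ∧ l ∉ S) ∨ (k ∉ S ∧ l ∈ S) →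
        lact (P k).q Y ≫ ract (P l).q Y = 0 := by
      intro k l h
      by_contra h0
      have hkl := linked_of_comp_ne_zero h0
      simp only [hmem] at h
      rcases h with ⟨h1, h2⟩ | ⟨h1, h2⟩
      · exact h2 (h1.trans (hs k) hkl)
      · exact h1 (h2.trans (hs l) hkl.symm)
    have e1 : lact q Y = ∑ k ∈ S, ∑ l ∈ S, lact (P k).q Y ≫ ract (P l).q Y := by
      rw [← Category.comp_id (lact q Y), ← ract_id Y, ← hsum, ract_sum, hq, lact_sum,
        Preadditive.sum_comp]
      refine Finset.sum_congr rfl fun k hk => ?_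
      rw [Preadditive.comp_sum]
      exact (Finset.sum_subset (Finset.subset_univ S) fun l _ hl => hzero k l (Or.inl ⟨hk, hl⟩)).symm
    have e2 : ract q Y = ∑ k ∈ S, ∑ l ∈ S, lact (P k).q Y ≫ ract (P l).q Y := by
      rw [← Category.id_comp (ract q Y), ← lact_id Y, ← hsum, lact_sum, hq, ract_sum,
        Finset.sum_comm, Preadditive.comp_sum]
      refine Finset.sum_congr rfl fun l hl => ?_
      rw [Preadditive.sum_comp]
      exact (Finset.sum_subset (Finset.subset_univ S) fun k _ hk => hzero k l (Or.inr ⟨hk, hl⟩)).symm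
    rw [e1, e2]
  have hq1 := hC.eq_id_of_central hqq hqd hq0 hcen
  by_contra hk
  have := hqk k
  rw [if_neg (fun h => hk ((hmem k).1 h)), hq1, Category.comp_id] at this
  exact hne k this

lemma unit_ne_zero (hC : Indecomposable C) : 𝟙 (𝟙_ C) ≠ 0 := by
  obtain ⟨X, hX⟩ := hC.1
  intro h
  apply hX
  rw [IsZero.iff_id_eq_zero, ← lact_id X, h, lact_zero]

/-- A nonzero object supported on `P` from the left has finite-dimensional endomorphisms, hence a
subobject with scalar endomorphisms. -/
lemma Linked.exists_scalar {P Q : UnitSummand C} (hP : IsScalarObj P.U) (h : Linked P Q) :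
    ∃ X : C, IsScalarObj X ∧ lact P.q X = 𝟙 X ∧ ract Q.q X = 𝟙 X := by
  obtain ⟨Y, h0, h1, h2⟩ := h
  have := finite_end_of_lact hP P.isometry h1
  obtain ⟨n, Z, s, hZ, hs⟩ := exists_orthogonal_decomposition exists_sub Y
  have hn : n ≠ 0 := by
    rintro rfl
    apply h0
    rw [← hs.2.2]; simp
  let i : Fin n := ⟨0, Nat.pos_of_ne_zero hn⟩
  have := mono_of_isometry (hs.1 i)
  exact ⟨Z i, hZ i, lact_eq_id_of_mono (s i) h1, ract_eq_id_of_mono (s i) h2⟩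

/-- In an indecomposable multitensor C*-category there are a simple summand `P` of the unit and an
object `X` supported on `P` from the left, such that `End 𝟙` acts on `X` from the right as the full
endomorphism algebra: `X` is the sum of one simple object for each simple summand of the unit. -/
theorem exists_generator (hC : Indecomposable C) :
    ∃ (P : UnitSummand C) (X : C), IsScalarObj P.U ∧ lact P.q X = 𝟙 X ∧
      Function.Bijective fun z : 𝟙_ C ⟶ 𝟙_ C => ract z X := by
  have := MultitensorCStar.finite_center (C := C)
  obtain ⟨n, U, s, hU, hs⟩ := exists_orthogonal_decomposition exists_sub (𝟙_ C)
  have hn : n ≠ 0 := by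
    rintro rfl
    apply unit_ne_zero hC
    rw [← hs.2.2]; simp
  let i₀ : Fin n := ⟨0, Nat.pos_of_ne_zero hn⟩
  let P : Fin n → UnitSummand C := fun i => ⟨U i, s i, hs.1 i⟩
  have hP : IsOrthogonalSum fun i => (P i).s := hs
  have hlink : ∀ k, ∃ X : C, IsScalarObj X ∧ lact (P i₀).q X = 𝟙 X ∧ ract (P k).q X = 𝟙 X :=
    fun k => (linked_of_indecomposable hC hP hU i₀ k).exists_scalar (hU i₀)
  choose Y hY hYl hYr using hlink
  obtain ⟨X, t, ht⟩ := exists_sum Y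
  have hYr' : ∀ k l, k ≠ l → ract (P l).q (Y k) = 0 := by
    intro k l hkl
    rw [← Category.id_comp (ract (P l).q (Y k)), ← hYr k, ← ract_comp, q_comp_q_of_ne hP hkl,
      ract_zero]
  have hq : ∀ k, ract (P k).q X = (t k)† ≫ t k := by
    intro k
    rw [← Category.id_comp (ract (P k).q X), ← ht.2.2, Preadditive.sum_comp,
      Finset.sum_eq_single k]
    · rw [Category.assoc, ract_natural, hYr, Category.id_comp]
    · intro l _ hl
      rw [Category.assoc, ract_natural, hYr' l k hl, zero_comp, comp_zero]
    · simp
  -- `End 𝟙` is commutative, hence diagonal with respect to the simple summands of the unit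
  have hz : ∀ z : 𝟙_ C ⟶ 𝟙_ C, ∃ c : Fin n → ℂ, z = ∑ k, c k • (P k).q := by
    intro z
    choose c hc using fun k => (hU k).2 (s k ≫ z ≫ (s k)†)
    refine ⟨c, ?_⟩
    rw [← Category.comp_id z, ← hs.2.2, Preadditive.comp_sum]
    refine Finset.sum_congr rfl fun k _ => ?_
    have e : (s k)† ≫ s k = (P k).q := rfl
    rw [e]
    calc z ≫ (P k).q = z ≫ (P k).q ≫ (P k).q := by rw [(P k).q_idem]
      _ = (P k).q ≫ z ≫ (P k).q := by
          conv_lhs => rw [← Category.assoc z, end_unit_comm z, Category.assoc]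
      _ = (s k)† ≫ (s k ≫ z ≫ (s k)†) ≫ s k := by
          rw [← e]; simp only [Category.assoc]
      _ = c k • (P k).q := by
          rw [hc, Linear.smul_comp, Linear.comp_smul, Category.id_comp, e]
  have hr : ∀ c : Fin n → ℂ, ract (∑ k, c k • (P k).q) X = ∑ k, c k • ((t k)† ≫ t k) := by
    intro c
    rw [ract_sum]
    exact Finset.sum_congr rfl fun k _ => by rw [ract_smul, hq]
  refine ⟨P i₀, X, hU i₀, Corner.lact_of_orthogonalSum ht hYl, ?_, ?_⟩
  · intro z w hzw
    obtain ⟨c, rfl⟩ := hz z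
    obtain ⟨d, rfl⟩ := hz w
    simp only [hr] at hzw
    refine Finset.sum_congr rfl fun k _ => ?_
    congr 1
    apply smul_one_inj (hY k).1
    have hcoef : ∀ c : Fin n → ℂ,
        t k ≫ (∑ l, c l • ((t l)† ≫ t l)) ≫ (t k)† = c k • 𝟙 (Y k) := by
      intro c
      rw [Preadditive.sum_comp, Preadditive.comp_sum, Finset.sum_eq_single k]
      · rw [Linear.smul_comp, Linear.comp_smul, Category.assoc, ht.1, Category.comp_id, ht.1]
      · intro l _ hl
        rw [Linear.smul_comp, Linear.comp_smul, Category.assoc, ht.2.1 l k hl]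
        simp
      · simp
    rw [← hcoef c, ← hcoef d, hzw]
  · intro f
    choose c hc using fun k => (hY k).2 (t k ≫ f ≫ (t k)†)
    refine ⟨∑ k, c k • (P k).q, ?_⟩
    have hoff : ∀ k l, k ≠ l → t k ≫ f ≫ (t l)† = 0 := by
      intro k l hkl
      rw [← Category.comp_id (t k ≫ f ≫ (t l)†), ← hYr l, ract_natural, hYr' k l hkl, zero_comp]
    change ract (∑ k, c k • (P k).q) X = f
    rw [hr]
    calc ∑ k, c k • ((t k)† ≫ t k) = ∑ k, (t k)† ≫ (t k ≫ f ≫ (t k)†) ≫ t k := by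
          refine Finset.sum_congr rfl fun k _ => ?_
          rw [hc, Linear.smul_comp, Linear.comp_smul, Category.id_comp]
      _ = ∑ k, ∑ l, (t k)† ≫ (t k ≫ f ≫ (t l)†) ≫ t l := by
          refine Finset.sum_congr rfl fun k _ => ?_
          rw [Finset.sum_eq_single k]
          · intro l _ hl
            rw [hoff k l hl.symm, zero_comp, comp_zero]
          · simp
      _ = (∑ k, (t k)† ≫ t k) ≫ f ≫ ∑ l, (t l)† ≫ t l := by
          simp only [Preadditive.sum_comp, Preadditive.comp_sum, Category.assoc]
          rw [Finset.sum_comm]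
      _ = f := by rw [ht.2.2, Category.id_comp, Category.comp_id]

/-- If `End 𝟙` acts faithfully on `X` from the right, a solution of the conjugate equations for `X`
can be chosen with `ω* ω = 1`. -/
lemma exists_normalized_solution {X : C}
    (hX : Function.Injective fun z : 𝟙_ C ⟶ 𝟙_ C => ract z X) :
    ∃ (Xb : C) (ω : 𝟙_ C ⟶ Xb ⊗ X) (ω' : 𝟙_ C ⟶ X ⊗ Xb),
      ConjugateEquations ω ω' ∧ ω ≫ ω† = 𝟙 _ := by
  obtain ⟨Xb, ω, ω', h⟩ := MultitensorCStar.rigid X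
  obtain ⟨g, hg⟩ := comp_dag_nonneg ω
  have := MultitensorCStar.finite_center (C := C)
  let φ : (𝟙_ C ⟶ 𝟙_ C) →ₗ[ℂ] (𝟙_ C ⟶ 𝟙_ C) :=
    { toFun := fun z => z ≫ g
      map_add' := fun z w => by simp
      map_smul' := fun c z => by simp }
  have hφ : Function.Injective φ := by
    rw [injective_iff_map_eq_zero]
    intro z hz
    have hz' : z ≫ g = 0 := hz
    apply hX
    change ract z X = ract 0 X
    rw [ract_zero]
    apply ract_eq_zero_of_comp h
    apply eq_zero_of_comp_dag
    rw [dag_comp, Category.assoc, ← Category.assoc ω, hg, Category.assoc, ← Category.assoc, hz',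
      zero_comp]
  -- `g` is invertible because `End 𝟙` is finite-dimensional; its inverse `k` normalizes `ω`, and
  -- letting `g` act on `X` in `ω'` compensates for it
  obtain ⟨k, hk⟩ := LinearMap.injective_iff_surjective.1 hφ (𝟙 _)
  have hkg : k ≫ g = 𝟙 _ := hk
  have hslide : k ≫ ω ≫ Xb ◁ ract g X = ω := by
    rw [← ract_tensor, comp_ract_unit, ← Category.assoc, hkg, Category.id_comp]
  have hd : (ω' ≫ ract g† X ▷ Xb)† = ract g X ▷ Xb ≫ ω'† := by
    simp [dag_ract]
  refine ⟨Xb, k ≫ ω, ω' ≫ (ract g† X) ▷ Xb, ⟨?_, ?_⟩, ?_⟩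
  · rw [hd]
    calc _ = (ρ_ X).inv ≫ X ◁ k ⊗≫ (X ◁ ω ≫ ract g X ▷ (Xb ⊗ X)) ⊗≫ ω'† ▷ X ≫ (λ_ X).hom := by
          monoidal
      _ = ract k X ≫ ract g X ≫ (ρ_ X).inv ≫ X ◁ ω ≫ (α_ X Xb X).inv ≫ ω'† ▷ X ≫ (λ_ X).hom := by
          rw [whisker_exchange]; simp only [ract]; monoidal
      _ = 𝟙 X := by
          rw [h.1, Category.comp_id, ← ract_comp, hkg, ract_id]
  · rw [hd]
    calc _ = (λ_ Xb).inv ≫ (k ≫ ω ≫ Xb ◁ ract g X) ▷ Xb ≫ (α_ Xb X Xb).hom ≫ Xb ◁ ω'† ≫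
          (ρ_ Xb).hom := by monoidal
      _ = 𝟙 Xb := by rw [hslide, h.2]
  · calc (k ≫ ω) ≫ (k ≫ ω)† = k ≫ (ω ≫ ω†) ≫ k† := by simp
      _ = (k ≫ g) ≫ (k ≫ g)† := by rw [hg]; simp
      _ = 𝟙 _ := by rw [hkg]; simp

end Generator

/-! ### Contractions -/

/-! In the lemmas of this part, disjoint contractions commute by the exchange law; everything else is
coherence. -/

section Contraction

variable {C : Type u} [Category.{v} C] [MonoidalCategory C] {X Xb : C} (e : Xb ⊗ X ⟶ 𝟙_ C)

/-- The contraction of the two inner factors of `(A ⊗ Xb) ⊗ (X ⊗ B)`. -/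
def contract (A B : C) : (A ⊗ Xb) ⊗ (X ⊗ B) ⟶ A ⊗ B :=
  (α_ A Xb (X ⊗ B)).hom ≫ A ◁ ((α_ Xb X B).inv ≫ e ▷ B ≫ (λ_ B).hom)

/-- The left action of `X ⊗ Xb` on `X ⊗ (Y ⊗ Xb)`. -/
def contractL (Y : C) : (X ⊗ Xb) ⊗ (X ⊗ (Y ⊗ Xb)) ⟶ X ⊗ (Y ⊗ Xb) := contract e X (Y ⊗ Xb)

/-- The right action of `X ⊗ Xb` on `X ⊗ (Y ⊗ Xb)`. -/
def contractR (Y : C) : (X ⊗ (Y ⊗ Xb)) ⊗ (X ⊗ Xb) ⟶ X ⊗ (Y ⊗ Xb) :=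
  (α_ X Y Xb).inv ▷ (X ⊗ Xb) ≫ contract e (X ⊗ Y) Xb ≫ (α_ X Y Xb).hom

/-- The contraction `(X ⊗ (Y ⊗ Xb)) ⊗ (X ⊗ (Z ⊗ Xb)) ⟶ X ⊗ ((Y ⊗ Z) ⊗ Xb)`. -/
def contractM (Y Z : C) : (X ⊗ (Y ⊗ Xb)) ⊗ (X ⊗ (Z ⊗ Xb)) ⟶ X ⊗ ((Y ⊗ Z) ⊗ Xb) :=
  (α_ X Y Xb).inv ▷ (X ⊗ (Z ⊗ Xb)) ≫ contract e (X ⊗ Y) (Z ⊗ Xb) ≫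
    (α_ X Y (Z ⊗ Xb)).hom ≫ X ◁ (α_ Y Z Xb).inv

/-- The functor `Y ↦ X ⊗ (Y ⊗ Xb)` on morphisms. -/
def sandwich (X Xb : C) {Y Z : C} (f : Y ⟶ Z) : X ⊗ (Y ⊗ Xb) ⟶ X ⊗ (Z ⊗ Xb) := X ◁ (f ▷ Xb)

lemma contract_assoc (A B : C) :
    contract e A Xb ▷ (X ⊗ B) ≫ contract e A B =
      (α_ _ _ _).hom ≫ (A ⊗ Xb) ◁ contract e X B ≫ contract e A B := by
  simp only [contract]
  calc _ = 𝟙 _ ⊗≫ A ◁ (e ▷ ((Xb ⊗ X) ⊗ B) ≫ 𝟙_ C ◁ (e ▷ B)) ⊗≫ 𝟙 _ := by monoidal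
    _ = 𝟙 _ ⊗≫ A ◁ ((Xb ⊗ X) ◁ (e ▷ B) ≫ e ▷ (𝟙_ C ⊗ B)) ⊗≫ 𝟙 _ := by rw [whisker_exchange]
    _ = _ := by monoidal

lemma contractL_assoc (Y : C) :
    contract e X Xb ▷ (X ⊗ (Y ⊗ Xb)) ≫ contractL e Y =
      (α_ _ _ _).hom ≫ (X ⊗ Xb) ◁ contractL e Y ≫ contractL e Y :=
  contract_assoc e X (Y ⊗ Xb)

lemma contractR_assoc (Y : C) :
    (X ⊗ (Y ⊗ Xb)) ◁ contract e X Xb ≫ contractR e Y =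
      (α_ _ _ _).inv ≫ contractR e Y ▷ (X ⊗ Xb) ≫ contractR e Y := by
  simp only [contract, contractR]
  symm
  calc _ = 𝟙 _ ⊗≫ (X ⊗ Y) ◁ (e ▷ ((Xb ⊗ X) ⊗ Xb) ≫ 𝟙_ C ◁ (e ▷ Xb)) ⊗≫ 𝟙 _ := by monoidal
    _ = 𝟙 _ ⊗≫ (X ⊗ Y) ◁ ((Xb ⊗ X) ◁ (e ▷ Xb) ≫ e ▷ (𝟙_ C ⊗ Xb)) ⊗≫ 𝟙 _ := by
        rw [whisker_exchange]
    _ = _ := by monoidal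

lemma contract_middle (Y : C) :
    contractL e Y ▷ (X ⊗ Xb) ≫ contractR e Y =
      (α_ _ _ _).hom ≫ (X ⊗ Xb) ◁ contractR e Y ≫ contractL e Y := by
  simp only [contractL, contractR, contract]
  calc _ = 𝟙 _ ⊗≫ X ◁ (e ▷ (Y ⊗ ((Xb ⊗ X) ⊗ Xb)) ≫ 𝟙_ C ◁ (Y ◁ (e ▷ Xb))) ⊗≫ 𝟙 _ := by monoidal
    _ = 𝟙 _ ⊗≫ X ◁ ((Xb ⊗ X) ◁ (Y ◁ (e ▷ Xb)) ≫ e ▷ (Y ⊗ (𝟙_ C ⊗ Xb))) ⊗≫ 𝟙 _ := by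
        rw [whisker_exchange]
    _ = _ := by monoidal

lemma contractM_assoc (Y Z W : C) :
    contractM e Y Z ▷ (X ⊗ (W ⊗ Xb)) ≫ contractM e (Y ⊗ Z) W ≫ sandwich X Xb (α_ Y Z W).hom =
      (α_ _ _ _).hom ≫ (X ⊗ (Y ⊗ Xb)) ◁ contractM e Z W ≫ contractM e Y (Z ⊗ W) := by
  simp only [contractM, contract, sandwich]
  calc _ = 𝟙 _ ⊗≫ (X ⊗ Y) ◁ (e ▷ (Z ⊗ ((Xb ⊗ X) ⊗ (W ⊗ Xb))) ≫
        𝟙_ C ◁ (Z ◁ (e ▷ (W ⊗ Xb)))) ⊗≫ 𝟙 _ := by monoidal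
    _ = 𝟙 _ ⊗≫ (X ⊗ Y) ◁ ((Xb ⊗ X) ◁ (Z ◁ (e ▷ (W ⊗ Xb))) ≫
        e ▷ (Z ⊗ (𝟙_ C ⊗ (W ⊗ Xb)))) ⊗≫ 𝟙 _ := by rw [whisker_exchange]
    _ = _ := by monoidal

lemma contractL_contractM (Y Z : C) :
    (X ⊗ Xb) ◁ contractM e Y Z ≫ contractL e (Y ⊗ Z) =
      (α_ _ _ _).inv ≫ contractL e Y ▷ (X ⊗ (Z ⊗ Xb)) ≫ contractM e Y Z := by
  simp only [contractM, contractL, contract]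
  symm
  calc _ = 𝟙 _ ⊗≫ X ◁ (e ▷ (Y ⊗ ((Xb ⊗ X) ⊗ (Z ⊗ Xb))) ≫
        𝟙_ C ◁ (Y ◁ (e ▷ (Z ⊗ Xb)))) ⊗≫ 𝟙 _ := by monoidal
    _ = 𝟙 _ ⊗≫ X ◁ ((Xb ⊗ X) ◁ (Y ◁ (e ▷ (Z ⊗ Xb))) ≫
        e ▷ (Y ⊗ (𝟙_ C ⊗ (Z ⊗ Xb)))) ⊗≫ 𝟙 _ := by rw [whisker_exchange]
    _ = _ := by monoidal

lemma contractR_contractM (Y Z : C) :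
    contractM e Y Z ▷ (X ⊗ Xb) ≫ contractR e (Y ⊗ Z) =
      (α_ _ _ _).hom ≫ (X ⊗ (Y ⊗ Xb)) ◁ contractR e Z ≫ contractM e Y Z := by
  simp only [contractM, contractR, contract]
  calc _ = 𝟙 _ ⊗≫ (X ⊗ Y) ◁ (e ▷ (Z ⊗ ((Xb ⊗ X) ⊗ Xb)) ≫
        𝟙_ C ◁ (Z ◁ (e ▷ Xb))) ⊗≫ 𝟙 _ := by monoidal
    _ = 𝟙 _ ⊗≫ (X ⊗ Y) ◁ ((Xb ⊗ X) ◁ (Z ◁ (e ▷ Xb)) ≫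
        e ▷ (Z ⊗ (𝟙_ C ⊗ Xb))) ⊗≫ 𝟙 _ := by rw [whisker_exchange]
    _ = _ := by monoidal

lemma contractL_natural {Y Z : C} (f : Y ⟶ Z) :
    contractL e Y ≫ sandwich X Xb f = (X ⊗ Xb) ◁ sandwich X Xb f ≫ contractL e Z := by
  simp only [contractL, contract, sandwich]
  calc _ = 𝟙 _ ⊗≫ X ◁ (e ▷ (Y ⊗ Xb) ≫ 𝟙_ C ◁ (f ▷ Xb)) ⊗≫ 𝟙 _ := by monoidal
    _ = 𝟙 _ ⊗≫ X ◁ ((Xb ⊗ X) ◁ (f ▷ Xb) ≫ e ▷ (Z ⊗ Xb)) ⊗≫ 𝟙 _ := by rw [whisker_exchange]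
    _ = _ := by monoidal

lemma contractR_natural {Y Z : C} (f : Y ⟶ Z) :
    contractR e Y ≫ sandwich X Xb f = sandwich X Xb f ▷ (X ⊗ Xb) ≫ contractR e Z := by
  simp only [contractR, contract, sandwich]
  calc _ = 𝟙 _ ⊗≫ X ◁ (Y ◁ (e ▷ Xb) ≫ f ▷ (𝟙_ C ⊗ Xb)) ⊗≫ 𝟙 _ := by monoidal
    _ = 𝟙 _ ⊗≫ X ◁ (f ▷ ((Xb ⊗ X) ⊗ Xb) ≫ Z ◁ (e ▷ Xb)) ⊗≫ 𝟙 _ := by rw [whisker_exchange]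
    _ = _ := by monoidal

lemma contractM_natural_left {Y Z : C} (f : Y ⟶ Z) (W : C) :
    sandwich X Xb f ▷ (X ⊗ (W ⊗ Xb)) ≫ contractM e Z W =
      contractM e Y W ≫ sandwich X Xb (f ▷ W) := by
  simp only [contractM, contract, sandwich]
  calc _ = 𝟙 _ ⊗≫ X ◁ (f ▷ ((Xb ⊗ X) ⊗ (W ⊗ Xb)) ≫ Z ◁ (e ▷ (W ⊗ Xb))) ⊗≫ 𝟙 _ := by monoidal
    _ = 𝟙 _ ⊗≫ X ◁ (Y ◁ (e ▷ (W ⊗ Xb)) ≫ f ▷ (𝟙_ C ⊗ (W ⊗ Xb))) ⊗≫ 𝟙 _ := by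
        rw [whisker_exchange]
    _ = _ := by monoidal

lemma contractM_natural_right {Y Z : C} (W : C) (f : Y ⟶ Z) :
    (X ⊗ (W ⊗ Xb)) ◁ sandwich X Xb f ≫ contractM e W Z =
      contractM e W Y ≫ sandwich X Xb (W ◁ f) := by
  simp only [contractM, contract, sandwich]
  calc _ = 𝟙 _ ⊗≫ (X ⊗ W) ◁ ((Xb ⊗ X) ◁ (f ▷ Xb) ≫ e ▷ (Z ⊗ Xb)) ⊗≫ 𝟙 _ := by monoidal
    _ = 𝟙 _ ⊗≫ (X ⊗ W) ◁ (e ▷ (Y ⊗ Xb) ≫ 𝟙_ C ◁ (f ▷ Xb)) ⊗≫ 𝟙 _ := by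
        rw [whisker_exchange]
    _ = _ := by monoidal

/-- The hypothesis is one of the conjugate equations for `c` and `e`: `c` is a left unit for
`contract`. -/
lemma unit_contract {c : 𝟙_ C ⟶ X ⊗ Xb}
    (h : (λ_ X).inv ≫ c ▷ X ≫ (α_ X Xb X).hom ≫ X ◁ e ≫ (ρ_ X).hom = 𝟙 X) (B : C) :
    c ▷ (X ⊗ B) ≫ contract e X B = (λ_ (X ⊗ B)).hom := by
  calc _ = 𝟙 _ ⊗≫ ((λ_ X).inv ≫ c ▷ X ≫ (α_ X Xb X).hom ≫ X ◁ e ≫ (ρ_ X).hom) ▷ B ⊗≫ 𝟙 _ := by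
        rw [contract]; monoidal
    _ = _ := by rw [h]; monoidal

/-- The other conjugate equation makes `c` a right unit for `contract`. -/
lemma contract_unit {c : 𝟙_ C ⟶ X ⊗ Xb}
    (h : (ρ_ Xb).inv ≫ Xb ◁ c ≫ (α_ Xb X Xb).inv ≫ e ▷ Xb ≫ (λ_ Xb).hom = 𝟙 Xb) (A : C) :
    (A ⊗ Xb) ◁ c ≫ contract e A Xb = (ρ_ (A ⊗ Xb)).hom := by
  calc _ = 𝟙 _ ⊗≫ A ◁ ((ρ_ Xb).inv ≫ Xb ◁ c ≫ (α_ Xb X Xb).inv ≫ e ▷ Xb ≫ (λ_ Xb).hom) ⊗≫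
        𝟙 _ := by
        rw [contract]; monoidal
    _ = _ := by rw [h]; monoidal

lemma contractR_unit {c : 𝟙_ C ⟶ X ⊗ Xb}
    (h : (ρ_ Xb).inv ≫ Xb ◁ c ≫ (α_ Xb X Xb).inv ≫ e ▷ Xb ≫ (λ_ Xb).hom = 𝟙 Xb) (Y : C) :
    (X ⊗ (Y ⊗ Xb)) ◁ c ≫ contractR e Y = (ρ_ (X ⊗ (Y ⊗ Xb))).hom := by
  calc _ = 𝟙 _ ⊗≫ (((X ⊗ Y) ⊗ Xb) ◁ c ≫ contract e (X ⊗ Y) Xb) ⊗≫ 𝟙 _ := by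
        rw [contractR]; monoidal
    _ = _ := by rw [contract_unit e h]; monoidal

lemma contractM_unit_left (Y : C) :
    (X ◁ (λ_ Xb).inv) ▷ (X ⊗ (Y ⊗ Xb)) ≫ contractM e (𝟙_ C) Y ≫ sandwich X Xb (λ_ Y).hom =
      contractL e Y := by
  simp only [contractM, contractL, contract, sandwich]; monoidal

lemma contractM_unit_right (Y : C) :
    (X ⊗ (Y ⊗ Xb)) ◁ (X ◁ (λ_ Xb).inv) ≫ contractM e Y (𝟙_ C) ≫ sandwich X Xb (ρ_ Y).hom =
      contractR e Y := by
  simp only [contractM, contractR, contract, sandwich]; monoidal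

end Contraction

/-! ### Adjoints of contractions -/

section ContractionStar

open CStarCategory CStarMonoidal

variable {C : Type u} [Category.{v} C] [StarNorm C] [Preadditive C] [Linear ℂ C]
  [MonoidalCategory C] [CStarMonoidal C] {X Xb : C} (e : Xb ⊗ X ⟶ 𝟙_ C)

lemma dag_contract (A B : C) :
    (contract e A B)† = A ◁ ((λ_ B).inv ≫ e† ▷ B ≫ (α_ Xb X B).hom) ≫
      (α_ A Xb (X ⊗ B)).inv := by
  simp [contract]

lemma dag_sandwich {Y Z : C} (f : Y ⟶ Z) : (sandwich X Xb f)† = sandwich X Xb (f†) := by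
  simp [sandwich]

variable {e}

lemma contract_isometry (he : e† ≫ e = 𝟙 _) (A B : C) :
    (contract e A B)† ≫ contract e A B = 𝟙 _ := by
  rw [dag_contract, contract]
  calc _ = 𝟙 _ ⊗≫ A ◁ ((e† ≫ e) ▷ B) ⊗≫ 𝟙 _ := by monoidal
    _ = 𝟙 _ := by rw [he]; monoidal

lemma contractR_isometry (he : e† ≫ e = 𝟙 _) (Y : C) :
    (contractR e Y)† ≫ contractR e Y = 𝟙 _ := by
  have h := contract_isometry he (X ⊗ Y) Xb
  simp only [contractR, dag_comp, dag_whiskerRight, dag_associator_hom, dag_associator_inv,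
    Category.assoc, ← comp_whiskerRight_assoc, Iso.hom_inv_id, id_whiskerRight, Category.id_comp]
  rw [reassoc_of% h, Iso.inv_hom_id]

lemma contractM_isometry (he : e† ≫ e = 𝟙 _) (Y Z : C) :
    (contractM e Y Z)† ≫ contractM e Y Z = 𝟙 _ := by
  have h := contract_isometry he (X ⊗ Y) (Z ⊗ Xb)
  simp only [contractM, dag_comp, dag_whiskerRight, dag_whiskerLeft, dag_associator_hom,
    dag_associator_inv, Category.assoc, ← comp_whiskerRight_assoc, Iso.hom_inv_id,
    id_whiskerRight, Category.id_comp]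
  rw [reassoc_of% h, Iso.inv_hom_id_assoc, ← whiskerLeft_comp, Iso.hom_inv_id, whiskerLeft_id]

variable (e)

/-- The Frobenius law for contractions: inserting `e†` and contracting with `e` elsewhere commute. -/
lemma contract_frobenius_left (A B : C) :
    (contract e A Xb)† ▷ (X ⊗ B) ≫ (α_ _ _ _).hom ≫ (A ⊗ Xb) ◁ contract e X B =
      contract e A B ≫ (contract e A B)† := by
  simp only [dag_contract]
  simp only [contract]
  calc _ = 𝟙 _ ⊗≫ A ◁ (e† ▷ ((Xb ⊗ X) ⊗ B) ≫ (Xb ⊗ X) ◁ (e ▷ B)) ⊗≫ 𝟙 _ := by monoidal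
    _ = 𝟙 _ ⊗≫ A ◁ (𝟙_ C ◁ (e ▷ B) ≫ e† ▷ (𝟙_ C ⊗ B)) ⊗≫ 𝟙 _ := by rw [whisker_exchange]
    _ = _ := by monoidal

lemma contract_frobenius_right (A B : C) :
    (A ⊗ Xb) ◁ (contract e X B)† ≫ (α_ _ _ _).inv ≫ contract e A Xb ▷ (X ⊗ B) =
      contract e A B ≫ (contract e A B)† := by
  have h := congrArg StarNorm.dag (contract_frobenius_left e A B)
  simpa using h

/-- The range projection of the relative tensor product of `X ⊗ (Y ⊗ Xb)` and `X ⊗ (Z ⊗ Xb)` over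
`X ⊗ Xb`. -/
lemma contractM_dag (Y Z : C) :
    (contractR e Y)† ▷ (X ⊗ (Z ⊗ Xb)) ≫ (α_ _ _ _).hom ≫ (X ⊗ (Y ⊗ Xb)) ◁ contractL e Z =
      contractM e Y Z ≫ (contractM e Y Z)† := by
  have h := contract_frobenius_left e (X ⊗ Y) (Z ⊗ Xb)
  calc _ = 𝟙 _ ⊗≫ ((contract e (X ⊗ Y) Xb)† ▷ (X ⊗ Z ⊗ Xb) ≫ (α_ _ _ _).hom ≫
        ((X ⊗ Y) ⊗ Xb) ◁ contract e X (Z ⊗ Xb)) ⊗≫ 𝟙 _ := by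
        simp only [contractR, contractL, dag_comp, dag_whiskerRight, dag_associator_hom,
          dag_associator_inv]
        monoidal
    _ = _ := by
        rw [h]
        simp only [contractM, dag_comp, dag_whiskerRight, dag_whiskerLeft, dag_associator_hom,
          dag_associator_inv]
        monoidal

variable {e}

/-- The inverse of `sandwich` on bimodule maps: both legs are closed with `e`. -/
def unsandwich (e : Xb ⊗ X ⟶ 𝟙_ C) {Y Z : C} (k : X ⊗ (Y ⊗ Xb) ⟶ X ⊗ (Z ⊗ Xb)) : Y ⟶ Z :=
  𝟙 _ ⊗≫ (e† ▷ Y) ⊗≫ (Xb ⊗ (X ⊗ Y)) ◁ e† ⊗≫ Xb ◁ (k ▷ X) ⊗≫ (Xb ⊗ (X ⊗ Z)) ◁ e ⊗≫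
    e ▷ Z ⊗≫ 𝟙 _

lemma unsandwich_sandwich (he : e† ≫ e = 𝟙 _) {Y Z : C} (f : Y ⟶ Z) :
    unsandwich e (sandwich X Xb f) = f := by
  calc _ = 𝟙 _ ⊗≫ (e† ▷ Y) ⊗≫ (Xb ⊗ X) ◁ (Y ◁ e† ≫ f ▷ (Xb ⊗ X)) ⊗≫ (Xb ⊗ (X ⊗ Z)) ◁ e ⊗≫
        e ▷ Z ⊗≫ 𝟙 _ := by
        rw [unsandwich, sandwich]; monoidal
    _ = 𝟙 _ ⊗≫ (e† ▷ Y ≫ (Xb ⊗ X) ◁ f) ⊗≫ (Xb ⊗ (X ⊗ Z)) ◁ (e† ≫ e) ⊗≫ e ▷ Z ⊗≫ 𝟙 _ := by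
        rw [whisker_exchange]; monoidal
    _ = 𝟙 _ ⊗≫ (𝟙_ C ◁ f ≫ e† ▷ Z) ⊗≫ e ▷ Z ⊗≫ 𝟙 _ := by
        rw [he, whisker_exchange]; monoidal
    _ = f ⊗≫ (e† ≫ e) ▷ Z ⊗≫ 𝟙 _ := by monoidal
    _ = f := by rw [he]; monoidal

/-- The right-hand side averages `k` over the actions of `X ⊗ Xb`, hence is `k` itself if `k` is a
bimodule map. -/
lemma sandwich_unsandwich {Y Z : C} (k : X ⊗ (Y ⊗ Xb) ⟶ X ⊗ (Z ⊗ Xb)) :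
    sandwich X Xb (unsandwich e k) =
      (contractL e Y)† ≫ (X ⊗ Xb) ◁ ((contractR e Y)† ≫ k ▷ (X ⊗ Xb) ≫ contractR e Z) ≫
        contractL e Z := by
  simp only [contractL, contractR, dag_comp, dag_contract, dag_whiskerRight, dag_associator_hom,
    dag_associator_inv, sandwich, unsandwich]
  simp only [contract]
  monoidal

end ContractionStar

section

open CStarCategory CStarMonoidal

variable {C : Type u} [Category.{v} C] [StarNorm C] [Preadditive C] [Linear ℂ C]
  [MonoidalCategory C] [CStarMonoidal C] {H : SpecialFrobenius C}

/-- A bimodule map is reproduced by its average with respect to both actions. -/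
lemma SpecialBimod.l_dag_hom_l {M N : SpecialBimod H} (f : M ⟶ N) :
    M.l† ≫ H.alg.X ◁ (M.r† ≫ hom f ▷ H.alg.X ≫ N.r) ≫ N.l = hom f := by
  have h := r_dag_hom f
  have h' := l_dag_hom f
  have h3 : N.l† ≫ N.l = 𝟙 _ := N.special_left
  have h4 : N.r† ≫ N.r = 𝟙 _ := N.special_right
  rw [reassoc_of% h, h4, Category.comp_id, reassoc_of% h', h3, Category.comp_id]

end

/-! ### The Frobenius algebra of a generator and the functor to its bimodules -/

section Generator

open CStarCategory CStarMonoidal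

variable {C : Type u} [Category.{v} C] [StarNorm C] [Preadditive C] [Linear ℂ C]
  [MonoidalCategory C]

/-- An object supported on the summand `P` of the unit from the left, together with a solution of
the conjugate equations for which `ω` is an isometry. -/
structure Generator (P : UnitSummand C) where
  /-- the object -/
  X : C
  /-- its dual -/
  Xb : C
  /-- the isometry `𝟙 ⟶ Xb ⊗ X` -/
  ω : 𝟙_ C ⟶ Xb ⊗ X
  /-- the other half of the solution -/
  ω' : 𝟙_ C ⟶ X ⊗ Xb
  conj : ConjugateEquations ω ω'
  isometry : ω ≫ ω† = 𝟙 _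
  left : lact P.q X = 𝟙 X

variable [CStarMonoidal C] {P : UnitSummand C} (D : Generator P)

namespace Generator

/-- The evaluation `Xb ⊗ X ⟶ 𝟙`. -/
abbrev e : D.Xb ⊗ D.X ⟶ 𝟙_ C := D.ω†

lemma e_isometry : D.e† ≫ D.e = 𝟙 _ := by rw [dag_dag, D.isometry]

lemma right : ract P.q D.Xb = 𝟙 D.Xb := D.conj.ract_dual D.left

/-- The object `X ⊗ (Y ⊗ Xb)` of the corner. -/
def obj (Y : C) : Corner P :=
  ⟨D.X ⊗ (Y ⊗ D.Xb), by rw [lact_tensor, D.left, id_whiskerRight],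
    by rw [ract_tensor, ract_tensor, D.right, whiskerLeft_id, whiskerLeft_id]⟩

/-- The object `X ⊗ Xb` of the corner. -/
def algObj : Corner P :=
  ⟨D.X ⊗ D.Xb, by rw [lact_tensor, D.left, id_whiskerRight],
    by rw [ract_tensor, D.right, whiskerLeft_id]⟩

/-- The unit of `X ⊗ Xb`. -/
def one : 𝟙_ (Corner P) ⟶ D.algObj :=
  Corner.ofHom (X := 𝟙_ (Corner P)) (Y := D.algObj) (P.s ≫ D.ω')

/-- The multiplication of `X ⊗ Xb`. -/
def mul : D.algObj ⊗ D.algObj ⟶ D.algObj :=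
  Corner.ofHom (X := D.algObj ⊗ D.algObj) (Y := D.algObj) (contract D.e D.X D.Xb)

/-- The algebra `X ⊗ Xb` in the corner. -/
def alg : Mon (Corner P) where
  X := D.algObj
  mon :=
    { one := D.one
      mul := D.mul
      one_mul := by
        change (P.s ≫ D.ω') ▷ (D.X ⊗ D.Xb) ≫ contract D.e D.X D.Xb =
          P.s ▷ (D.X ⊗ D.Xb) ≫ (λ_ _).hom
        rw [comp_whiskerRight, Category.assoc, unit_contract D.e D.conj.dag_fst]
      mul_one := by
        change (D.X ⊗ D.Xb) ◁ (P.s ≫ D.ω') ≫ contract D.e D.X D.Xb =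
          (D.X ⊗ D.Xb) ◁ P.s ≫ (ρ_ _).hom
        rw [whiskerLeft_comp, Category.assoc, contract_unit D.e D.conj.dag_snd]
      mul_assoc := contract_assoc D.e D.X D.Xb }

/-- The special C*-Frobenius algebra `X ⊗ Xb` in the corner. -/
def frob : SpecialFrobenius (Corner P) where
  alg := D.alg
  frobenius_left := contract_frobenius_left D.e D.X D.Xb
  frobenius_right := contract_frobenius_right D.e D.X D.Xb
  special := contract_isometry D.e_isometry D.X D.Xb

/-- The bimodule `X ⊗ (Y ⊗ Xb)`. -/
def bimod (Y : C) : SpecialBimod D.frob where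
  toBimod :=
    { X := D.obj Y
      actLeft := Corner.ofHom (X := D.algObj ⊗ D.obj Y) (Y := D.obj Y) (contractL D.e Y)
      actRight := Corner.ofHom (X := D.obj Y ⊗ D.algObj) (Y := D.obj Y) (contractR D.e Y)
      one_actLeft := by
        change (P.s ≫ D.ω') ▷ (D.X ⊗ (Y ⊗ D.Xb)) ≫ contractL D.e Y =
          P.s ▷ (D.X ⊗ (Y ⊗ D.Xb)) ≫ (λ_ _).hom
        rw [comp_whiskerRight, Category.assoc, contractL, unit_contract D.e D.conj.dag_fst]
      left_assoc := contractL_assoc D.e Y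
      actRight_one := by
        change (D.X ⊗ (Y ⊗ D.Xb)) ◁ (P.s ≫ D.ω') ≫ contractR D.e Y =
          (D.X ⊗ (Y ⊗ D.Xb)) ◁ P.s ≫ (ρ_ _).hom
        rw [whiskerLeft_comp, Category.assoc, contractR_unit D.e D.conj.dag_snd]
      right_assoc := contractR_assoc D.e Y
      middle_assoc := contract_middle D.e Y }
  special_left := contract_isometry D.e_isometry D.X (Y ⊗ D.Xb)
  special_right := contractR_isometry D.e_isometry Y

/-- The functor `Y ↦ X ⊗ (Y ⊗ Xb)` from `C` to special bimodules. -/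
def functor : C ⥤ SpecialBimod D.frob where
  obj := D.bimod
  map {Y Z} f :=
    { hom := Corner.ofHom (X := D.obj Y) (Y := D.obj Z) (sandwich D.X D.Xb f)
      left_act_hom := contractL_natural D.e f
      right_act_hom := contractR_natural D.e f }
  map_id Y := by
    apply SpecialBimod.hom_ext
    change D.X ◁ (𝟙 Y ▷ D.Xb) = 𝟙 (D.X ⊗ (Y ⊗ D.Xb))
    simp
  map_comp {Y Z W} f g := by
    apply SpecialBimod.hom_ext
    change D.X ◁ ((f ≫ g) ▷ D.Xb) = D.X ◁ (f ▷ D.Xb) ≫ D.X ◁ (g ▷ D.Xb)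
    simp

instance : D.functor.Additive where
  map_add {Y Z f g} := by
    apply SpecialBimod.hom_ext
    change D.X ◁ ((f + g) ▷ D.Xb) = D.X ◁ (f ▷ D.Xb) + D.X ◁ (g ▷ D.Xb)
    simp

instance : D.functor.Linear ℂ where
  map_smul {Y Z} f c := by
    apply SpecialBimod.hom_ext
    change D.X ◁ ((c • f) ▷ D.Xb) = c • D.X ◁ (f ▷ D.Xb)
    simp

lemma map_dag {Y Z : C} (f : Y ⟶ Z) : D.functor.map (f†) = (D.functor.map f)† := by
  apply SpecialBimod.hom_ext
  exact (dag_sandwich f).symm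

/-- The functor to bimodules is fully faithful. -/
def fullyFaithful : D.functor.FullyFaithful where
  preimage {Y Z} f := unsandwich D.e (Y := Y) (Z := Z) (SpecialBimod.hom f)
  preimage_map f := unsandwich_sandwich D.e_isometry f
  map_preimage {Y Z} f := by
    apply SpecialBimod.hom_ext
    exact (sandwich_unsandwich (Y := Y) (Z := Z) (SpecialBimod.hom f)).trans
      (SpecialBimod.l_dag_hom_l f)

end Generator

end Generator

/-! ### Recognizing relative tensor products -/

namespace SpecialBimod

open CStarCategory CStarMonoidal

variable {C : Type u} [Category.{v} C] [StarNorm C] [Preadditive C] [Linear ℂ C]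
  [MonoidalCategory C] [CStarMonoidal C] {H : SpecialFrobenius C}

/-- A coisometry of bimodules `M.X ⊗ N.X ⟶ Q.X` with support projection `proj M N`; it exhibits
`Q` as the relative tensor product of `M` and `N`. -/
structure IsRel {M N Q : SpecialBimod H} (m : M.X ⊗ N.X ⟶ Q.X) : Prop where
  left : H.alg.X ◁ m ≫ Q.l = (α_ _ _ _).inv ≫ M.l ▷ N.X ≫ m
  right : m ▷ H.alg.X ≫ Q.r = (α_ _ _ _).hom ≫ M.X ◁ N.r ≫ m
  dag_comp_self : m† ≫ m = 𝟙 _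
  comp_dag_self : m ≫ m† = proj M N

lemma dag_j (M N : SpecialBimod H) : (j M N)† ≫ j M N = proj M N := dag_emb M N

/-- The bimodule map `M ⊗ N ⟶ Q` induced by `m`. -/
noncomputable def relHom {M N Q : SpecialBimod H} {m : M.X ⊗ N.X ⟶ Q.X} (hm : IsRel m) :
    M ⊗ N ⟶ Q where
  hom := j M N ≫ m
  left_act_hom := by
    have h : (M ⊗ N).l ≫ j M N = H.alg.X ◁ j M N ≫ (α_ _ _ _).inv ≫ M.l ▷ N.X := l_emb M N
    rw [whiskerLeft_comp, Category.assoc, hm.left]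
    refine (Category.assoc _ _ _).symm.trans ((congrArg (· ≫ m) h).trans ?_)
    simp only [Category.assoc]
  right_act_hom := by
    have h : (M ⊗ N).r ≫ j M N = j M N ▷ H.alg.X ≫ (α_ _ _ _).hom ≫ M.X ◁ N.r := r_emb M N
    rw [comp_whiskerRight, Category.assoc, hm.right]
    refine (Category.assoc _ _ _).symm.trans ((congrArg (· ≫ m) h).trans ?_)
    simp only [Category.assoc]

section

variable {M N Q : SpecialBimod H} {m : M.X ⊗ N.X ⟶ Q.X} (hm : IsRel m)

lemma hom_relHom : hom (relHom hm) = j M N ≫ m := rfl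

/-- The unitary isomorphism `M ⊗ N ≅ Q` induced by `m`. -/
noncomputable def relIso : M ⊗ N ≅ Q where
  hom := relHom hm
  inv := (relHom hm)†
  hom_inv_id := by
    apply hom_ext
    rw [hom_comp, hom_dag, hom_relHom, dag_comp, Category.assoc, ← Category.assoc m,
      hm.comp_dag_self, ← Category.assoc, j_proj, j_dag, hom_id]
  inv_hom_id := by
    apply hom_ext
    rw [hom_comp, hom_dag, hom_relHom, dag_comp, Category.assoc, ← Category.assoc (j M N)†, dag_j,
      ← hm.comp_dag_self, Category.assoc, hm.dag_comp_self, Category.comp_id, hm.dag_comp_self,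
      hom_id]

lemma relIso_unitary : IsUnitary (relIso hm).hom :=
  ⟨(relIso hm).hom_inv_id, (relIso hm).inv_hom_id⟩

lemma hom_relIso : hom (relIso hm).hom = j M N ≫ m := rfl

end

lemma relIso_natural_left {M M' N Q Q' : SpecialBimod H} {m : M.X ⊗ N.X ⟶ Q.X}
    {m' : M'.X ⊗ N.X ⟶ Q'.X} (hm : IsRel m) (hm' : IsRel m') {f : M ⟶ M'} {g : Q ⟶ Q'}
    (h : hom f ▷ N.X ≫ m' = m ≫ hom g) :
    f ▷ N ≫ (relIso hm').hom = (relIso hm).hom ≫ g := by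
  apply hom_ext
  rw [hom_comp, hom_comp, hom_relIso, hom_relIso, ← Category.assoc, hom_whiskerRight,
    Category.assoc, h, Category.assoc]

lemma relIso_natural_right {M N N' Q Q' : SpecialBimod H} {m : M.X ⊗ N.X ⟶ Q.X}
    {m' : M.X ⊗ N'.X ⟶ Q'.X} (hm : IsRel m) (hm' : IsRel m') {f : N ⟶ N'} {g : Q ⟶ Q'}
    (h : M.X ◁ hom f ≫ m' = m ≫ hom g) :
    M ◁ f ≫ (relIso hm').hom = (relIso hm).hom ≫ g := by
  apply hom_ext
  rw [hom_comp, hom_comp, hom_relIso, hom_relIso, ← Category.assoc, hom_whiskerLeft,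
    Category.assoc, h, Category.assoc]

lemma relIso_associativity {M N P Q Q' R R' : SpecialBimod H} {m : M.X ⊗ N.X ⟶ Q.X}
    {m₁ : Q.X ⊗ P.X ⟶ R.X} {n : N.X ⊗ P.X ⟶ Q'.X} {n₁ : M.X ⊗ Q'.X ⟶ R'.X} (hm : IsRel m)
    (hm₁ : IsRel m₁) (hn : IsRel n) (hn₁ : IsRel n₁) {g : R ⟶ R'}
    (h : m ▷ P.X ≫ m₁ ≫ hom g = (α_ _ _ _).hom ≫ M.X ◁ n ≫ n₁) :
    (relIso hm).hom ▷ P ≫ (relIso hm₁).hom ≫ g =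
      (α_ M N P).hom ≫ M ◁ (relIso hn).hom ≫ (relIso hn₁).hom := by
  apply hom_ext
  calc hom ((relIso hm).hom ▷ P ≫ (relIso hm₁).hom ≫ g)
      = (hom ((relIso hm).hom ▷ P) ≫ j Q P) ≫ m₁ ≫ hom g := by
        rw [hom_comp, hom_comp, hom_relIso hm₁]; simp only [Category.assoc]
    _ = j (M ⊗ N) P ≫ (j M N ▷ P.X ≫ m ▷ P.X) ≫ m₁ ≫ hom g := by
        rw [hom_whiskerRight, hom_relIso, comp_whiskerRight]; simp only [Category.assoc]
    _ = (j (M ⊗ N) P ≫ j M N ▷ P.X ≫ (α_ _ _ _).hom) ≫ M.X ◁ n ≫ n₁ := by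
        simp only [Category.assoc, h]
    _ = hom (α_ M N P).hom ≫ (j M (N ⊗ P) ≫ M.X ◁ (j N P ≫ n)) ≫ n₁ := by
        rw [← hom_associator, whiskerLeft_comp]; simp only [Category.assoc]
    _ = hom (α_ M N P).hom ≫ (hom (M ◁ (relIso hn).hom) ≫ j M Q') ≫ n₁ := by
        rw [hom_whiskerLeft, hom_relIso]
    _ = _ := by
        rw [hom_comp, hom_comp, hom_relIso hn₁]; simp only [Category.assoc]

lemma relIso_left_unitality {E M Q : SpecialBimod H} {m : E.X ⊗ M.X ⟶ Q.X} (hm : IsRel m)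
    {ε : 𝟙_ (SpecialBimod H) ⟶ E} {g : Q ⟶ M} (h : hom ε ▷ M.X ≫ m ≫ hom g = M.l) :
    (λ_ M).hom = ε ▷ M ≫ (relIso hm).hom ≫ g := by
  apply hom_ext
  have h1 : hom (ε ▷ M) ≫ j E M = jU M ≫ hom ε ▷ M.X := hom_whiskerRight ε M
  rw [hom_leftUnitor, ← h, hom_comp, hom_comp, hom_relIso, Category.assoc, reassoc_of% h1]
  exact (Category.assoc _ _ _).symm

lemma relIso_right_unitality {E M Q : SpecialBimod H} {m : M.X ⊗ E.X ⟶ Q.X} (hm : IsRel m)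
    {ε : 𝟙_ (SpecialBimod H) ⟶ E} {g : Q ⟶ M} (h : M.X ◁ hom ε ≫ m ≫ hom g = M.r) :
    (ρ_ M).hom = M ◁ ε ≫ (relIso hm).hom ≫ g := by
  apply hom_ext
  have h1 : hom (M ◁ ε) ≫ j M E = jV M ≫ M.X ◁ hom ε := hom_whiskerLeft M ε
  rw [hom_rightUnitor, ← h, hom_comp, hom_comp, hom_relIso, Category.assoc, reassoc_of% h1]
  rfl

end SpecialBimod

/-! ### The equivalence with bimodules -/

namespace Generator

open CStarCategory CStarMonoidal SpecialBimod

variable {C : Type u} [Category.{v} C] [StarNorm C] [Preadditive C] [Linear ℂ C]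
  [MonoidalCategory C] [CStarMonoidal C] {P : UnitSummand C} (D : Generator P)

/-- The tensorator of the functor to bimodules, on underlying objects. -/
def tensorator (Y Z : C) : (D.bimod Y).X ⊗ (D.bimod Z).X ⟶ (D.bimod (Y ⊗ Z)).X :=
  Corner.ofHom (X := D.obj Y ⊗ D.obj Z) (Y := D.obj (Y ⊗ Z)) (contractM D.e Y Z)

lemma tensorator_isRel (Y Z : C) : IsRel (D.tensorator Y Z) where
  left := contractL_contractM D.e Y Z
  right := contractR_contractM D.e Y Z
  dag_comp_self := contractM_isometry D.e_isometry Y Z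
  comp_dag_self := by
    rw [proj_eq]
    exact (contractM_dag D.e Y Z).symm

/-- The unit isomorphism `X ⊗ Xb ⟶ X ⊗ (𝟙 ⊗ Xb)`. -/
def unitHom : 𝟙_ (SpecialBimod D.frob) ⟶ D.bimod (𝟙_ C) where
  hom := Corner.ofHom (X := D.algObj) (Y := D.obj (𝟙_ C)) (D.X ◁ (λ_ D.Xb).inv)
  left_act_hom := by
    change contract D.e D.X D.Xb ≫ D.X ◁ (λ_ D.Xb).inv =
      (D.X ⊗ D.Xb) ◁ (D.X ◁ (λ_ D.Xb).inv) ≫ contract D.e D.X (𝟙_ C ⊗ D.Xb)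
    simp only [contract]
    monoidal
  right_act_hom := by
    change contract D.e D.X D.Xb ≫ D.X ◁ (λ_ D.Xb).inv =
      (D.X ◁ (λ_ D.Xb).inv) ▷ (D.X ⊗ D.Xb) ≫ contractR D.e (𝟙_ C)
    simp only [contractR, contract]
    monoidal

/-- The unit isomorphism of the functor to bimodules. -/
noncomputable def unitIso : 𝟙_ (SpecialBimod D.frob) ≅ D.functor.obj (𝟙_ C) where
  hom := D.unitHom
  inv := D.unitHom†
  hom_inv_id := by
    apply SpecialBimod.hom_ext
    change D.X ◁ (λ_ D.Xb).inv ≫ (D.X ◁ (λ_ D.Xb).inv)† = 𝟙 (D.X ⊗ D.Xb)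
    simp
  inv_hom_id := by
    apply SpecialBimod.hom_ext
    change (D.X ◁ (λ_ D.Xb).inv)† ≫ D.X ◁ (λ_ D.Xb).inv = 𝟙 (D.X ⊗ (𝟙_ C ⊗ D.Xb))
    simp

/-- The monoidal structure on the functor to bimodules. -/
noncomputable def coreMonoidal : D.functor.CoreMonoidal where
  εIso := D.unitIso
  μIso Y Z := relIso (D.tensorator_isRel Y Z)
  μIso_hom_natural_left f W := relIso_natural_left _ _ (contractM_natural_left D.e f W)
  μIso_hom_natural_right W f := relIso_natural_right _ _ (contractM_natural_right D.e W f)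
  associativity Y Z W := relIso_associativity _ _ _ _ (contractM_assoc D.e Y Z W)
  left_unitality Y := relIso_left_unitality _ (contractM_unit_left D.e Y)
  right_unitality Y := relIso_right_unitality _ (contractM_unit_right D.e Y)

end Generator

section Induction

open CStarCategory CStarMonoidal

variable {C : Type u} [Category.{v} C] [MonoidalCategory C] {X Xb : C} (e : Xb ⊗ X ⟶ 𝟙_ C)

/-- For a bimodule `N` over `X ⊗ Xb`, the map `X ⊗ ((Xb ⊗ (N ⊗ X)) ⊗ Xb) ⟶ N` given by both
actions. -/
def bothActions {N : C} (l : (X ⊗ Xb) ⊗ N ⟶ N) (r : N ⊗ (X ⊗ Xb) ⟶ N) :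
    X ⊗ ((Xb ⊗ (N ⊗ X)) ⊗ Xb) ⟶ N :=
  ((α_ X (Xb ⊗ (N ⊗ X)) Xb).inv ≫ (α_ X Xb (N ⊗ X)).inv ▷ Xb ≫
    (α_ (X ⊗ Xb) (N ⊗ X) Xb).hom ≫ (X ⊗ Xb) ◁ (α_ N X Xb).hom) ≫ (X ⊗ Xb) ◁ r ≫ l

variable {N : C} {l : (X ⊗ Xb) ⊗ N ⟶ N} {r : N ⊗ (X ⊗ Xb) ⟶ N}

lemma contractL_bothActions
    (hl : contract e X Xb ▷ N ≫ l = (α_ _ _ _).hom ≫ (X ⊗ Xb) ◁ l ≫ l) :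
    contractL e (Xb ⊗ (N ⊗ X)) ≫ bothActions l r = (X ⊗ Xb) ◁ bothActions l r ≫ l := by
  symm
  calc _ = 𝟙 _ ⊗≫ ((X ⊗ Xb) ⊗ (X ⊗ Xb)) ◁ r ⊗≫ ((α_ _ _ _).hom ≫ (X ⊗ Xb) ◁ l ≫ l) := by
        rw [bothActions]; monoidal
    _ = 𝟙 _ ⊗≫ (((X ⊗ Xb) ⊗ (X ⊗ Xb)) ◁ r ≫ contract e X Xb ▷ N) ⊗≫ l := by
        rw [← hl]; monoidal
    _ = 𝟙 _ ⊗≫ contract e X Xb ▷ (N ⊗ (X ⊗ Xb)) ⊗≫ (X ⊗ Xb) ◁ r ≫ l := by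
        rw [whisker_exchange]; monoidal
    _ = _ := by
        rw [bothActions, contractL, contract, contract]; monoidal

lemma contractR_bothActions
    (hr : N ◁ contract e X Xb ≫ r = (α_ _ _ _).inv ≫ r ▷ (X ⊗ Xb) ≫ r)
    (hm : l ▷ (X ⊗ Xb) ≫ r = (α_ _ _ _).hom ≫ (X ⊗ Xb) ◁ r ≫ l) :
    contractR e (Xb ⊗ (N ⊗ X)) ≫ bothActions l r = bothActions l r ▷ (X ⊗ Xb) ≫ r := by
  symm
  calc _ = 𝟙 _ ⊗≫ ((X ⊗ Xb) ◁ r) ▷ (X ⊗ Xb) ⊗≫ (l ▷ (X ⊗ Xb) ≫ r) := by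
        rw [bothActions]; monoidal
    _ = 𝟙 _ ⊗≫ (X ⊗ Xb) ◁ ((α_ _ _ _).inv ≫ r ▷ (X ⊗ Xb) ≫ r) ⊗≫ l := by
        rw [hm]; monoidal
    _ = 𝟙 _ ⊗≫ (X ⊗ Xb) ◁ (N ◁ contract e X Xb) ⊗≫ (X ⊗ Xb) ◁ r ≫ l := by
        rw [← hr]; monoidal
    _ = _ := by
        rw [bothActions, contractR, contract, contract]; monoidal

lemma bothActions_isometry [StarNorm C] [Preadditive C] [Linear ℂ C] [CStarMonoidal C]
    (hl : l† ≫ l = 𝟙 _) (hr : r† ≫ r = 𝟙 _) :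
    (bothActions l r)† ≫ bothActions l r = 𝟙 _ := by
  calc _ = l† ≫ (X ⊗ Xb) ◁ (r† ≫ r) ≫ l := by
        simp only [bothActions, dag_comp, dag_whiskerLeft, dag_whiskerRight, dag_associator_hom,
          dag_associator_inv]
        monoidal
    _ = 𝟙 _ := by rw [hr, whiskerLeft_id, Category.id_comp, hl]

end Induction

namespace Generator

open CStarCategory CStarMonoidal SpecialBimod

variable {C : Type u} [Category.{v} C] [StarNorm C] [Preadditive C] [Linear ℂ C]
  [MonoidalCategory C] [CStarMonoidal C] {P : UnitSummand C} (D : Generator P)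

/-- The bimodule map from `X ⊗ ((Xb ⊗ (M ⊗ X)) ⊗ Xb)` onto the bimodule `M`. -/
def cover (M : SpecialBimod D.frob) : D.functor.obj (D.Xb ⊗ (M.X.obj ⊗ D.X)) ⟶ M where
  hom := Corner.ofHom (X := D.obj (D.Xb ⊗ (M.X.obj ⊗ D.X))) (Y := M.X)
    (bothActions (X := D.X) (Xb := D.Xb) (N := M.X.obj) M.l M.r)
  left_act_hom := contractL_bothActions D.e M.toBimod.left_assoc
  right_act_hom := contractR_bothActions D.e M.toBimod.right_assoc M.toBimod.middle_assoc

lemma cover_isometry (M : SpecialBimod D.frob) : (D.cover M)† ≫ D.cover M = 𝟙 M := by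
  apply SpecialBimod.hom_ext
  exact bothActions_isometry (C := C) M.special_left M.special_right

end Generator

/-! ### Conjugate equations under unitary monoidal functors and unitary isomorphisms -/

section Transport

open CStarCategory CStarMonoidal Functor.LaxMonoidal Functor.OplaxMonoidal

variable {C : Type u} [Category.{v} C] [StarNorm C] [Preadditive C] [Linear ℂ C]
  [MonoidalCategory C] {S : Type u₂} [Category.{v₂} S] [StarNorm S] [Preadditive S] [Linear ℂ S]
  [MonoidalCategory S]

lemma ConjugateEquations.map [CStarCategory S] (F : C ⥤ S) [F.Monoidal]
    (hF : ∀ {X Y : C} (f : X ⟶ Y), F.map (f†) = (F.map f)†)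
    (hε : IsUnitary (ε F)) (hμ : ∀ X Y : C, IsUnitary (μ F X Y)) {X Xb : C}
    {ω : 𝟙_ C ⟶ Xb ⊗ X} {ω' : 𝟙_ C ⟶ X ⊗ Xb} (h : ConjugateEquations ω ω') :
    ConjugateEquations (ε F ≫ F.map ω ≫ δ F Xb X) (ε F ≫ F.map ω' ≫ δ F X Xb) := by
  have h1 : (δ F X Xb)† = μ F X Xb := by
    have hd : (μ F X Xb)† = δ F X Xb := by
      rw [← cancel_epi (μ F X Xb), (hμ X Xb).1, Functor.Monoidal.μ_δ]
    rw [← hd, dag_dag]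
  have h2 : (ε F)† = η F := by
    rw [← cancel_epi (ε F), hε.1, Functor.Monoidal.ε_η]
  have h3 : (ε F ≫ F.map ω' ≫ δ F X Xb)† = μ F X Xb ≫ F.map (ω'†) ≫ η F := by
    rw [dag_comp, dag_comp, h1, h2, hF, Category.assoc]
  have e1 := congrArg F.map h.1
  have e2 := congrArg F.map h.2
  constructor
  · rw [h3]
    simp only [Functor.map_comp, Functor.Monoidal.map_whiskerLeft,
      Functor.Monoidal.map_whiskerRight,
      Functor.Monoidal.map_associator_inv, Functor.Monoidal.map_leftUnitor,
      Functor.Monoidal.map_rightUnitor_inv, Category.assoc, Functor.Monoidal.μ_δ_assoc,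
      CategoryTheory.Functor.map_id] at e1
    simp only [comp_whiskerRight, whiskerLeft_comp, Category.assoc]
    exact e1
  · rw [h3]
    simp only [Functor.map_comp, Functor.Monoidal.map_whiskerLeft,
      Functor.Monoidal.map_whiskerRight,
      Functor.Monoidal.map_associator, Functor.Monoidal.map_leftUnitor_inv,
      Functor.Monoidal.map_rightUnitor, Category.assoc, Functor.Monoidal.μ_δ_assoc,
      CategoryTheory.Functor.map_id] at e2
    simp only [comp_whiskerRight, whiskerLeft_comp, Category.assoc]
    exact e2

lemma ConjugateEquations.congr [CStarMonoidal S] {X Y Xb : S} {ω : 𝟙_ S ⟶ Xb ⊗ X}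
    {ω' : 𝟙_ S ⟶ X ⊗ Xb} (h : ConjugateEquations ω ω') {f : X ⟶ Y} (hf : IsUnitary f) :
    ConjugateEquations (ω ≫ Xb ◁ f) (ω' ≫ f ▷ Xb) := by
  constructor
  · rw [dag_comp, dag_whiskerRight]
    calc _ = 𝟙 _ ⊗≫ Y ◁ ω ⊗≫ ((Y ⊗ Xb) ◁ f ≫ (f† ▷ Xb) ▷ Y) ⊗≫ ω'† ▷ Y ⊗≫ 𝟙 _ := by monoidal
      _ = 𝟙 _ ⊗≫ (Y ◁ ω ≫ f† ▷ (Xb ⊗ X)) ⊗≫ ((X ⊗ Xb) ◁ f ≫ ω'† ▷ Y) ⊗≫ 𝟙 _ := by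
          rw [whisker_exchange]; monoidal
      _ = f† ≫ ((ρ_ X).inv ≫ X ◁ ω ≫ (α_ X Xb X).inv ≫ ω'† ▷ X ≫ (λ_ X).hom) ≫ f := by
          rw [whisker_exchange, whisker_exchange]; monoidal
      _ = 𝟙 _ := by rw [h.1, Category.id_comp, hf.2]
  · rw [dag_comp, dag_whiskerRight]
    calc _ = (λ_ Xb).inv ≫ ω ▷ Xb ≫ (α_ Xb X Xb).hom ≫ Xb ◁ ((f ≫ f†) ▷ Xb) ≫ Xb ◁ ω'† ≫
          (ρ_ Xb).hom := by monoidal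
      _ = 𝟙 _ := by
          rw [hf.1, id_whiskerRight, whiskerLeft_id, Category.id_comp, h.2]

end Transport

/-! ### The C*-structure of the category of special bimodules -/

section Bimodules

open CStarCategory CStarMonoidal

variable {C : Type u} [Category.{v} C] [StarNorm C] [Preadditive C] [Linear ℂ C]

lemma eq_of_forall_nrm_le [CStarCategory C] {X Y : C} {f g : X ⟶ Y} (K : ℝ)
    (h : ∀ ε : ℝ, 0 < ε → nrm (f - g) ≤ ε * K) : f = g := by
  refine sub_eq_zero.1 (eq_zero_of_nrm _ (le_antisymm ?_ (nrm_nonneg _)))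
  have hK : 0 ≤ K := (nrm_nonneg _).trans (by simpa using h 1 one_pos)
  refine le_of_forall_pos_le_add fun ε hε => ?_
  have h1 := h (ε / (K + 1)) (by positivity)
  have h2 : ε / (K + 1) * K ≤ ε := by
    rw [div_mul_eq_mul_div, div_le_iff₀ (by positivity)]
    nlinarith
  linarith

namespace SpecialBimod

variable [MonoidalCategory C] [CStarMonoidal C] {H : SpecialFrobenius C}

/-- Bimodule maps are closed under limits in norm. -/
lemma exists_limit {M N : SpecialBimod H} (w : ℕ → (M ⟶ N))
    (hw : ∀ ε : ℝ, 0 < ε → ∃ n₀, ∀ m n, n₀ ≤ m → n₀ ≤ n → nrm (w m - w n) < ε) :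
    ∃ f : M ⟶ N, ∀ ε : ℝ, 0 < ε → ∃ n₀, ∀ n, n₀ ≤ n → nrm (w n - f) < ε := by
  obtain ⟨f, hf⟩ := CStarCategory.complete (fun n => hom (w n)) hw
  refine ⟨{ hom := f, left_act_hom := ?_, right_act_hom := ?_ }, hf⟩
  · refine eq_of_forall_nrm_le (nrm M.l + nrm N.l) fun ε hε => ?_
    obtain ⟨n₀, hn₀⟩ := hf ε hε
    have h1 := (hn₀ n₀ le_rfl).le
    have h2 : M.l ≫ f - H.alg.X ◁ f ≫ N.l =
        H.alg.X ◁ (hom (w n₀) - f) ≫ N.l - M.l ≫ (hom (w n₀) - f) := by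
      have h := l_hom (w n₀)
      rw [← add_sub_cancel f (hom (w n₀)), MonoidalPreadditive.whiskerLeft_add,
        Preadditive.add_comp, Preadditive.comp_add] at h
      rw [sub_eq_sub_iff_add_eq_add, h, add_comm]
    have h3 : nrm (H.alg.X ◁ (hom (w n₀) - f) ≫ N.l) ≤ ε * nrm N.l :=
      (nrm_comp_le _ _).trans (mul_le_mul_of_nonneg_right
        ((nrm_whiskerLeft_le _ _).trans h1) (nrm_nonneg _))
    have h4 : nrm (M.l ≫ (hom (w n₀) - f)) ≤ nrm M.l * ε :=
      (nrm_comp_le _ _).trans (mul_le_mul_of_nonneg_left h1 (nrm_nonneg _))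
    have h5 := nrm_add_le (H.alg.X ◁ (hom (w n₀) - f) ≫ N.l) (-(M.l ≫ (hom (w n₀) - f)))
    rw [nrm_neg, ← sub_eq_add_neg] at h5
    rw [h2]; linarith
  · refine eq_of_forall_nrm_le (nrm M.r + nrm N.r) fun ε hε => ?_
    obtain ⟨n₀, hn₀⟩ := hf ε hε
    have h1 := (hn₀ n₀ le_rfl).le
    have h2 : M.r ≫ f - f ▷ H.alg.X ≫ N.r =
        (hom (w n₀) - f) ▷ H.alg.X ≫ N.r - M.r ≫ (hom (w n₀) - f) := by
      have h := r_hom (w n₀)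
      rw [← add_sub_cancel f (hom (w n₀)), MonoidalPreadditive.add_whiskerRight,
        Preadditive.add_comp, Preadditive.comp_add] at h
      rw [sub_eq_sub_iff_add_eq_add, h, add_comm]
    have h3 : nrm ((hom (w n₀) - f) ▷ H.alg.X ≫ N.r) ≤ ε * nrm N.r :=
      (nrm_comp_le _ _).trans (mul_le_mul_of_nonneg_right
        ((nrm_whiskerRight_le _ _).trans h1) (nrm_nonneg _))
    have h4 : nrm (M.r ≫ (hom (w n₀) - f)) ≤ nrm M.r * ε :=
      (nrm_comp_le _ _).trans (mul_le_mul_of_nonneg_left h1 (nrm_nonneg _))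
    have h5 := nrm_add_le ((hom (w n₀) - f) ▷ H.alg.X ≫ N.r) (-(M.r ≫ (hom (w n₀) - f)))
    rw [nrm_neg, ← sub_eq_add_neg] at h5
    rw [h2]; linarith

/-- All axioms of a C*-category but positivity pass to bimodules without further input. -/
lemma cStarCategory (hpos : ∀ {M N : SpecialBimod H} (f : M ⟶ N), ∃ g : M ⟶ M, f ≫ f† = g ≫ g†) :
    CStarCategory (SpecialBimod H) where
  dag_add f g := hom_ext (dag_add (hom f) (hom g))
  dag_smul c f := hom_ext (dag_smul c (hom f))
  dag_dag f := hom_ext (dag_dag (hom f))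
  dag_comp f g := hom_ext (dag_comp (hom f) (hom g))
  nrm_add_le f g := nrm_add_le (hom f) (hom g)
  nrm_smul c f := nrm_smul c (hom f)
  eq_zero_of_nrm f hf := hom_ext (eq_zero_of_nrm (hom f) hf)
  complete w hw := exists_limit w hw
  nrm_comp_le f g := nrm_comp_le (hom f) (hom g)
  nrm_comp_dag f := nrm_comp_dag (hom f)
  comp_dag_nonneg f := hpos f

instance : MonoidalPreadditive (SpecialBimod H) where
  whiskerLeft_zero {M N O} := by
    apply ext_j
    rw [hom_whiskerLeft]
    change j M N ≫ M.X ◁ (0 : N.X ⟶ O.X) = (0 : (M ⊗ N).X ⟶ (M ⊗ O).X) ≫ _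
    simp
  zero_whiskerRight {M N O} := by
    apply ext_j
    rw [hom_whiskerRight]
    change j N M ≫ (0 : N.X ⟶ O.X) ▷ M.X = (0 : (N ⊗ M).X ⟶ (O ⊗ M).X) ≫ _
    simp
  whiskerLeft_add f g := by
    apply ext_j
    rw [hom_whiskerLeft, hom_add, hom_add, Preadditive.add_comp, hom_whiskerLeft, hom_whiskerLeft,
      MonoidalPreadditive.whiskerLeft_add, Preadditive.comp_add]
  add_whiskerRight f g := by
    apply ext_j
    rw [hom_whiskerRight, hom_add, hom_add, Preadditive.add_comp, hom_whiskerRight,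
      hom_whiskerRight, MonoidalPreadditive.add_whiskerRight, Preadditive.comp_add]

instance : MonoidalLinear ℂ (SpecialBimod H) where
  whiskerLeft_smul M _ _ c f := by
    apply ext_j
    rw [hom_whiskerLeft, hom_smul, hom_smul, Linear.smul_comp, hom_whiskerLeft,
      MonoidalLinear.whiskerLeft_smul, Linear.comp_smul]
  smul_whiskerRight c _ _ f M := by
    apply ext_j
    rw [hom_whiskerRight, hom_smul, hom_smul, Linear.smul_comp, hom_whiskerRight,
      MonoidalLinear.smul_whiskerRight, Linear.comp_smul]

lemma dag_tensorHom {M M' N N' : SpecialBimod H} (f : M ⟶ M') (g : N ⟶ N') :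
    (f ⊗ₘ g)† = f† ⊗ₘ g† := by
  have h : ∀ {M M' N N' : SpecialBimod H} (f : M ⟶ M') (g : N ⟶ N'),
      hom (f ⊗ₘ g) = j M N ≫ (hom f ⊗ₘ hom g) ≫ (j M' N')† := by
    intro M M' N N' f g
    rw [← Category.assoc, ← hom_tensorHom, Category.assoc, j_dag, Category.comp_id]
  apply hom_ext
  rw [hom_dag, h, h]
  simp only [dag_comp, dag_dag, dag_tensor, hom_dag, Category.assoc]

end SpecialBimod

end Bimodules

namespace Generator

open CStarCategory CStarMonoidal SpecialBimod

variable {C : Type u} [Category.{v} C] [StarNorm C] [Preadditive C] [Linear ℂ C]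
  [MonoidalCategory C] {P : UnitSummand C}

section

variable [CStarMonoidal C] (D : Generator P)

lemma sdag_comp {M N O : SpecialBimod D.frob} (f : M ⟶ N) (g : N ⟶ O) : (f ≫ g)† = g† ≫ f† :=
  SpecialBimod.hom_ext (dag_comp (hom f) (hom g))

lemma sdag_dag {M N : SpecialBimod D.frob} (f : M ⟶ N) : f†† = f :=
  SpecialBimod.hom_ext (dag_dag (hom f))

/-- Every special bimodule is unitarily isomorphic to one in the image of the functor: the
projection `cover ≫ cover†` comes from `C`, and splits there. -/
lemma exists_unitary (M : SpecialBimod D.frob) :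
    ∃ (Y : C) (f : D.functor.obj Y ⟶ M), IsUnitary f := by
  set k := D.cover M with hk
  have hk1 : k† ≫ k = 𝟙 M := D.cover_isometry M
  set p := D.fullyFaithful.preimage (k ≫ k†) with hp
  have hFp : D.functor.map p = k ≫ k† := D.fullyFaithful.map_preimage _
  have hpp : p ≫ p = p := by
    apply D.fullyFaithful.map_injective
    rw [Functor.map_comp, hFp, Category.assoc, ← Category.assoc k†, hk1, Category.id_comp]
  have hpd : p† = p := by
    apply D.fullyFaithful.map_injective
    rw [map_dag, hFp, sdag_comp, sdag_dag]
  obtain ⟨Y, s, hs, hsp⟩ := exists_sub p hpp hpd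
  refine ⟨Y, D.functor.map s ≫ k, ?_, ?_⟩
  · calc (D.functor.map s ≫ k) ≫ (D.functor.map s ≫ k)†
        = D.functor.map s ≫ (k ≫ k†) ≫ (D.functor.map s)† := by
          rw [sdag_comp]; simp only [Category.assoc]
      _ = D.functor.map (s ≫ (s† ≫ s) ≫ s†) := by
          rw [← hFp, ← map_dag, hsp]; simp only [Functor.map_comp]
      _ = 𝟙 _ := by
          rw [Category.assoc, hs, Category.comp_id, hs, CategoryTheory.Functor.map_id]
  · calc (D.functor.map s ≫ k)† ≫ (D.functor.map s ≫ k)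
        = k† ≫ D.functor.map (s† ≫ s) ≫ k := by
          rw [sdag_comp, Functor.map_comp, map_dag]; simp only [Category.assoc]
      _ = (k† ≫ k) ≫ (k† ≫ k) := by rw [hsp, hFp]; simp only [Category.assoc]
      _ = 𝟙 M := by rw [hk1, Category.comp_id]

/-- The positivity axiom for bimodule maps, transported from `C`. -/
lemma exists_comp_dag_eq {M N : SpecialBimod D.frob} (f : M ⟶ N) :
    ∃ g : M ⟶ M, f ≫ f† = g ≫ g† := by
  obtain ⟨Y, a, ha⟩ := D.exists_unitary M
  obtain ⟨Z, b, hb⟩ := D.exists_unitary N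
  obtain ⟨g, hg⟩ := comp_dag_nonneg (D.fullyFaithful.preimage (a ≫ f ≫ b†))
  have h1 : D.functor.map (D.fullyFaithful.preimage (a ≫ f ≫ b†)) = a ≫ f ≫ b† :=
    D.fullyFaithful.map_preimage _
  have h2 : (a ≫ f ≫ b†) ≫ (a ≫ f ≫ b†)† = D.functor.map g ≫ (D.functor.map g)† := by
    rw [← h1, ← map_dag, ← Functor.map_comp, hg, Functor.map_comp, map_dag]
  refine ⟨a† ≫ D.functor.map g ≫ a, ?_⟩
  calc f ≫ f† = (a† ≫ a) ≫ f ≫ (b† ≫ b) ≫ f† ≫ (a† ≫ a) := by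
        rw [ha.2, hb.2, Category.id_comp, Category.id_comp, Category.comp_id]
    _ = a† ≫ ((a ≫ f ≫ b†) ≫ (a ≫ f ≫ b†)†) ≫ a := by
        simp only [sdag_comp, sdag_dag, Category.assoc]
    _ = (a† ≫ D.functor.map g) ≫ 𝟙 _ ≫ (D.functor.map g)† ≫ a := by
        rw [h2, Category.id_comp]; simp only [Category.assoc]
    _ = _ := by
        rw [← ha.1]; simp only [sdag_comp, sdag_dag, Category.assoc]

lemma cStarMonoidal : CStarMonoidal (SpecialBimod D.frob) where
  toCStarCategory := SpecialBimod.cStarCategory D.exists_comp_dag_eq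
  exists_sum {n} M := by
    choose Y a ha using fun i => D.exists_unitary (M i)
    obtain ⟨Z, s, hs⟩ := exists_sum Y
    refine ⟨D.functor.obj Z, fun i => (a i)† ≫ D.functor.map (s i), ?_, ?_, ?_⟩
    · intro i
      calc _ = (a i)† ≫ D.functor.map (s i ≫ (s i)†) ≫ a i := by
            rw [sdag_comp, sdag_dag, Functor.map_comp, map_dag]; simp only [Category.assoc]
        _ = 𝟙 _ := by rw [hs.1, CategoryTheory.Functor.map_id, Category.id_comp, (ha i).2]
    · intro i k hik
      calc _ = (a i)† ≫ D.functor.map (s i ≫ (s k)†) ≫ a k := by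
            rw [sdag_comp, sdag_dag, Functor.map_comp, map_dag]; simp only [Category.assoc]
        _ = 0 := by rw [hs.2.1 i k hik, Functor.map_zero, zero_comp, comp_zero]
    · have h : ∀ i, ((a i)† ≫ D.functor.map (s i))† ≫ (a i)† ≫ D.functor.map (s i) =
          D.functor.map ((s i)† ≫ s i) := by
        intro i
        calc _ = (D.functor.map (s i))† ≫ (a i ≫ (a i)†) ≫ D.functor.map (s i) := by
              rw [sdag_comp, sdag_dag]; simp only [Category.assoc]
          _ = _ := by rw [(ha i).1, Category.id_comp, Functor.map_comp, map_dag]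
      simp only [h]
      rw [← Functor.map_sum, hs.2.2, CategoryTheory.Functor.map_id]
  exists_sub {M} p hp hp' := by
    obtain ⟨Y, a, ha⟩ := D.exists_unitary M
    set q := D.fullyFaithful.preimage (a ≫ p ≫ a†) with hq
    have hFq : D.functor.map q = a ≫ p ≫ a† := D.fullyFaithful.map_preimage _
    have hqq : q ≫ q = q := by
      apply D.fullyFaithful.map_injective
      rw [Functor.map_comp, hFq]
      calc _ = a ≫ p ≫ (a† ≫ a) ≫ p ≫ a† := by simp only [Category.assoc]
        _ = a ≫ (p ≫ p) ≫ a† := by rw [ha.2, Category.id_comp, Category.assoc]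
        _ = _ := by rw [hp]
    have hqd : q† = q := by
      apply D.fullyFaithful.map_injective
      rw [map_dag, hFq, sdag_comp, sdag_comp, sdag_dag, hp', Category.assoc]
    obtain ⟨Z, s, hs, hsq⟩ := exists_sub q hqq hqd
    refine ⟨D.functor.obj Z, D.functor.map s ≫ a, ?_, ?_⟩
    · calc _ = D.functor.map s ≫ (a ≫ a†) ≫ (D.functor.map s)† := by
            rw [sdag_comp]; simp only [Category.assoc]
        _ = 𝟙 _ := by
            rw [ha.1, Category.id_comp, ← map_dag, ← Functor.map_comp, hs, CategoryTheory.Functor.map_id]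
    · calc _ = a† ≫ D.functor.map (s† ≫ s) ≫ a := by
            rw [sdag_comp, Functor.map_comp, map_dag]; simp only [Category.assoc]
        _ = (a† ≫ a) ≫ p ≫ (a† ≫ a) := by rw [hsq, hFq]; simp only [Category.assoc]
        _ = p := by rw [ha.2, Category.id_comp, Category.comp_id]
  dag_tensor f g := SpecialBimod.dag_tensorHom f g
  associator_unitary M N O := ⟨(α_ M N O).hom_inv_id, (α_ M N O).inv_hom_id⟩
  leftUnitor_unitary M := ⟨(λ_ M).hom_inv_id, (λ_ M).inv_hom_id⟩
  rightUnitor_unitary M := ⟨(ρ_ M).hom_inv_id, (ρ_ M).inv_hom_id⟩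

end

variable [MultitensorCStar C] (D : Generator P)

noncomputable instance : D.functor.Monoidal := D.coreMonoidal.toMonoidal

lemma ε_unitary : IsUnitary (Functor.LaxMonoidal.ε D.functor) :=
  ⟨D.unitIso.hom_inv_id, D.unitIso.inv_hom_id⟩

lemma μ_unitary (Y Z : C) : IsUnitary (Functor.LaxMonoidal.μ D.functor Y Z) :=
  relIso_unitary (D.tensorator_isRel Y Z)

lemma multitensorCStar : MultitensorCStar (SpecialBimod D.frob) where
  toCStarMonoidal := D.cStarMonoidal
  rigid M := by
    have := D.cStarMonoidal
    obtain ⟨Y, a, ha⟩ := D.exists_unitary M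
    obtain ⟨Yb, ω, ω', h⟩ := MultitensorCStar.rigid Y
    exact ⟨_, _, _, (h.map D.functor (fun f => D.map_dag f) D.ε_unitary D.μ_unitary).congr ha⟩
  finite_center := by
    have := MultitensorCStar.finite_center (C := C)
    let φ : (𝟙_ C ⟶ 𝟙_ C) →ₗ[ℂ] (𝟙_ (SpecialBimod D.frob) ⟶ 𝟙_ (SpecialBimod D.frob)) :=
      { toFun := fun z => D.unitIso.hom ≫ D.functor.map z ≫ D.unitIso.inv
        map_add' := fun z w => by
          rw [Functor.map_add, Preadditive.add_comp, Preadditive.comp_add]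
        map_smul' := fun c z => by
          rw [Functor.map_smul, Linear.smul_comp, Linear.comp_smul]; rfl }
    refine Module.Finite.of_surjective φ fun z =>
      ⟨D.fullyFaithful.preimage (D.unitIso.inv ≫ z ≫ D.unitIso.hom), ?_⟩
    change D.unitIso.hom ≫ D.functor.map _ ≫ D.unitIso.inv = z
    rw [D.fullyFaithful.map_preimage]
    simp

theorem equivalentMultitensor : EquivalentMultitensor C (SpecialBimod D.frob) := by
  refine ⟨D.functor, inferInstance, ?_, inferInstance, inferInstance, fun f => D.map_dag f,
    D.ε_unitary, D.μ_unitary⟩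
  have := D.fullyFaithful.full
  have := D.fullyFaithful.faithful
  have : D.functor.EssSurj := ⟨fun M => by
    obtain ⟨Y, a, ha⟩ := D.exists_unitary M
    exact ⟨Y, ⟨⟨a, a†, ha.1, ha.2⟩⟩⟩⟩
  exact { }

end Generator

/-! ### Standardness -/

section Minimal

open CStarCategory CStarMonoidal

variable {C : Type u} [Category.{v} C] [StarNorm C] [Preadditive C] [Linear ℂ C]
  [MonoidalCategory C] [CStarMonoidal C]

/-- A solution of the conjugate equations is minimal as soon as its left and right partial traces
agree on `End Y`. -/
theorem isMinimalSolution_of_spherical {Y Yb : C} {γ : 𝟙_ C ⟶ Yb ⊗ Y} {γ' : 𝟙_ C ⟶ Y ⊗ Yb}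
    (h : ConjugateEquations γ γ')
    (hs : ∀ T : Y ⟶ Y, γ ≫ Yb ◁ T ≫ γ† = γ' ≫ T ▷ Yb ≫ γ'†) : IsMinimalSolution γ γ' := by
  have h1 : nrm γ ^ 2 = nrm γ' ^ 2 := by
    rw [← nrm_comp_dag, ← nrm_comp_dag]
    simpa using congrArg nrm (hs (𝟙 Y))
  have h2 : nrm γ' = nrm γ := by
    rw [sq_eq_sq₀ (nrm_nonneg _) (nrm_nonneg _)] at h1; exact h1.symm
  -- the value `‖γ‖²` is attained at `(γ, γ')`, so it remains to see that it is a lower bound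
  refine ⟨h, h1, ?_, fun b hb => hb ⟨γ, γ', h, by rw [h2, sq]⟩⟩
  rintro d ⟨ω, ω', hω, rfl⟩
  -- every other solution is `ω = γ (1 ⊗ T)`, `ω' = γ' (S ⊗ 1)` with `S*` inverse to `T`
  let T : Y ⟶ Y := (ρ_ Y).inv ≫ Y ◁ ω ≫ (α_ Y Yb Y).inv ≫ γ'† ▷ Y ≫ (λ_ Y).hom
  let S : Y ⟶ Y := (λ_ Y).inv ≫ ω' ▷ Y ≫ (α_ Y Yb Y).hom ≫ Y ◁ γ† ≫ (ρ_ Y).hom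
  have hSd : S† = (ρ_ Y).inv ≫ Y ◁ γ ≫ (α_ Y Yb Y).inv ≫ ω'† ▷ Y ≫ (λ_ Y).hom := by
    simp [S]
  have hT : γ ≫ Yb ◁ T = ω := by
    calc _ = 𝟙 _ ⊗≫ (γ ▷ 𝟙_ C ≫ (Yb ⊗ Y) ◁ ω) ⊗≫ Yb ◁ γ'† ▷ Y ⊗≫ 𝟙 _ := by
          dsimp only [T]; monoidal
      _ = ω ≫ ((λ_ Yb).inv ≫ γ ▷ Yb ≫ (α_ Yb Y Yb).hom ≫ Yb ◁ γ'† ≫ (ρ_ Yb).hom) ▷ Y := by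
          rw [← whisker_exchange]; monoidal
      _ = ω := by rw [h.2, id_whiskerRight, Category.comp_id]
  have hS : γ' ≫ S ▷ Yb = ω' := by
    calc _ = 𝟙 _ ⊗≫ (𝟙_ C ◁ γ' ≫ ω' ▷ (Y ⊗ Yb)) ⊗≫ Y ◁ γ† ▷ Yb ⊗≫ 𝟙 _ := by
          dsimp only [S]; monoidal
      _ = ω' ≫ Y ◁ ((ρ_ Yb).inv ≫ Yb ◁ γ' ≫ (α_ Yb Y Yb).inv ≫ γ† ▷ Yb ≫ (λ_ Yb).hom) := by
          rw [whisker_exchange]; monoidal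
      _ = ω' := by rw [h.dag_snd, whiskerLeft_id, Category.comp_id]
  have hTS : T ≫ S† = 𝟙 Y := by
    calc T ≫ S† = 𝟙 _ ⊗≫ Y ◁ ω ⊗≫ (γ'† ▷ (Y ⊗ 𝟙_ C) ≫ 𝟙_ C ◁ (Y ◁ γ)) ⊗≫ ω'† ▷ Y ⊗≫ 𝟙 _ := by
          rw [hSd]; dsimp only [T]; monoidal
      _ = 𝟙 _ ⊗≫ Y ◁ (ω ▷ 𝟙_ C ≫ (Yb ⊗ Y) ◁ γ) ⊗≫ (γ'† ▷ ((Y ⊗ Yb) ⊗ Y) ≫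
            𝟙_ C ◁ (ω'† ▷ Y)) ⊗≫ 𝟙 _ := by
          rw [← whisker_exchange]; monoidal
      _ = (ρ_ Y).inv ≫ Y ◁ γ ≫ Y ◁ (((λ_ Yb).inv ≫ ω ▷ Yb ≫ (α_ Yb Y Yb).hom ≫ Yb ◁ ω'† ≫
            (ρ_ Yb).hom) ▷ Y) ≫ (α_ Y Yb Y).inv ≫ γ'† ▷ Y ≫ (λ_ Y).hom := by
          rw [← whisker_exchange, ← whisker_exchange]; monoidal
      _ = 𝟙 Y := by rw [hω.2, id_whiskerRight, whiskerLeft_id, Category.id_comp, h.1]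
  -- by sphericality `S` may be moved from `γ'` to `γ` without changing the norm, and
  -- `‖γ‖² = ‖ω (γ (1 ⊗ S))*‖` is then bounded by submultiplicativity
  have h3 : nrm (γ ≫ Yb ◁ S) = nrm ω' := by
    rw [← sq_eq_sq₀ (nrm_nonneg _) (nrm_nonneg _), ← nrm_comp_dag, ← nrm_comp_dag, ← hS]
    simpa using congrArg nrm (hs (S ≫ S†))
  have h4 : ω ≫ (γ ≫ Yb ◁ S)† = γ ≫ γ† := by
    rw [dag_comp, dag_whiskerLeft, ← hT, Category.assoc, ← whiskerLeft_comp_assoc, hTS,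
      whiskerLeft_id, Category.id_comp]
  rw [← nrm_comp_dag, ← h4, ← h3, ← nrm_dag (γ ≫ Yb ◁ S)]
  exact nrm_comp_le _ _

/-- Over a simple unit every object is connected. -/
lemma isConnectedObj_of_isScalarObj (hU : IsScalarObj (𝟙_ C)) (Y : C) : IsConnectedObj Y := by
  ext f
  constructor
  · rintro ⟨⟨z, rfl⟩, -⟩
    obtain ⟨c, rfl⟩ := hU.2 z
    exact ⟨c, by simp⟩
  · rintro ⟨c, rfl⟩
    exact ⟨⟨c • 𝟙 _, by simp⟩, ⟨c • 𝟙 _, by simp⟩⟩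

open MonObj in
/-- A Frobenius algebra is self-dual. -/
lemma SpecialFrobenius.conjugateEquations (H : SpecialFrobenius C) :
    ConjugateEquations (X := H.alg.X) (Xb := H.alg.X) (η[H.alg.X] ≫ (μ[H.alg.X])†)
      (η[H.alg.X] ≫ (μ[H.alg.X])†) := by
  have h1 : (μ[H.alg.X])† ≫ (η[H.alg.X])† ▷ H.alg.X = (λ_ H.alg.X).inv := by
    have := congrArg StarNorm.dag (MonObj.one_mul H.alg.X)
    simpa only [dag_comp, dag_whiskerRight, dag_leftUnitor_hom] using this
  have h2 : (μ[H.alg.X])† ≫ H.alg.X ◁ (η[H.alg.X])† = (ρ_ H.alg.X).inv := by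
    have := congrArg StarNorm.dag (MonObj.mul_one H.alg.X)
    simpa only [dag_comp, dag_whiskerLeft, dag_rightUnitor_hom] using this
  constructor
  · calc _ = (ρ_ _).inv ≫ H.alg.X ◁ η[H.alg.X] ≫ (H.alg.X ◁ (μ[H.alg.X])† ≫ (α_ _ _ _).inv ≫
          μ[H.alg.X] ▷ H.alg.X) ≫ (η[H.alg.X])† ▷ H.alg.X ≫ (λ_ _).hom := by simp
      _ = 𝟙 _ := by
          rw [H.frobenius_right, Category.assoc, reassoc_of% h1, MonObj.mul_one_assoc]
          simp
  · calc _ = (λ_ _).inv ≫ η[H.alg.X] ▷ H.alg.X ≫ ((μ[H.alg.X])† ▷ H.alg.X ≫ (α_ _ _ _).hom ≫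
          H.alg.X ◁ μ[H.alg.X]) ≫ H.alg.X ◁ (η[H.alg.X])† ≫ (ρ_ _).hom := by simp
      _ = 𝟙 _ := by
          rw [H.frobenius_left, Category.assoc, reassoc_of% h2, MonObj.one_mul_assoc]
          simp

open MonObj in
/-- Over a simple unit, a special C*-Frobenius algebra is standard if its trace is spherical. -/
lemma SpecialFrobenius.isStandard_of_spherical (hU : IsScalarObj (𝟙_ C)) (H : SpecialFrobenius C)
    (hs : ∀ T : H.alg.X ⟶ H.alg.X,
      (η[H.alg.X] ≫ (μ[H.alg.X])†) ≫ H.alg.X ◁ T ≫ (η[H.alg.X] ≫ (μ[H.alg.X])†)† =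
        (η[H.alg.X] ≫ (μ[H.alg.X])†) ≫ T ▷ H.alg.X ≫ (η[H.alg.X] ≫ (μ[H.alg.X])†)†) :
    H.IsStandard := by
  refine ⟨1, fun _ => H.alg.X, fun _ => H.alg.X, fun _ => 𝟙 _, fun _ => 𝟙 _, fun _ => _,
    fun _ => _, ?_, ?_, fun _ => ⟨isConnectedObj_of_isScalarObj hU _,
      isMinimalSolution_of_spherical H.conjugateEquations hs⟩,
    fun i j hij => (hij (Subsingleton.elim i j)).elim, ?_, ?_⟩
  · exact ⟨fun _ => by simp, fun i j hij => (hij (Subsingleton.elim i j)).elim, by simp⟩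
  · exact ⟨fun _ => by simp, fun i j hij => (hij (Subsingleton.elim i j)).elim, by simp⟩
  · simp
  · simp

end Minimal

section Sphericality

open CStarCategory CStarMonoidal

variable {C : Type u} [Category.{v} C] [StarNorm C] [Preadditive C] [Linear ℂ C]
  [MonoidalCategory C] [CStarMonoidal C] {X Xb : C} {ω : 𝟙_ C ⟶ Xb ⊗ X} {ω' : 𝟙_ C ⟶ X ⊗ Xb}

/-- If `End 𝟙` acts from the right onto `End X`, it acts from the left onto `End Xb`. -/
lemma ConjugateEquations.lact_surjective (h : ConjugateEquations ω ω')
    (hX : Function.Surjective fun z : 𝟙_ C ⟶ 𝟙_ C => ract z X) :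
    Function.Surjective fun z : 𝟙_ C ⟶ 𝟙_ C => lact z Xb := by
  intro f
  let g : X ⟶ X :=
    (λ_ X).inv ≫ (ω' ≫ X ◁ f) ▷ X ≫ (α_ X Xb X).hom ≫ X ◁ ω† ≫ (ρ_ X).hom
  obtain ⟨z, hz⟩ := hX g
  -- `g` is the transpose of `f`
  have hg : ω' ≫ g ▷ Xb = ω' ≫ X ◁ f := by
    calc _ = 𝟙 _ ⊗≫ (𝟙_ C ◁ ω' ≫ (ω' ≫ X ◁ f) ▷ (X ⊗ Xb)) ⊗≫ X ◁ ω† ▷ Xb ⊗≫ 𝟙 _ := by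
          dsimp only [g]; monoidal
      _ = (ω' ≫ X ◁ f) ≫ X ◁ ((ρ_ Xb).inv ≫ Xb ◁ ω' ≫ (α_ Xb X Xb).inv ≫ ω† ▷ Xb ≫
            (λ_ Xb).hom) := by
          rw [whisker_exchange]; monoidal
      _ = _ := by rw [h.dag_snd, whiskerLeft_id, Category.comp_id]
  have key : ∀ a : Xb ⟶ Xb, a = (ρ_ Xb).inv ≫ Xb ◁ (ω' ≫ X ◁ a) ≫ (α_ Xb X Xb).inv ≫ ω† ▷ Xb ≫
      (λ_ Xb).hom := by
    intro a
    symm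
    calc _ = 𝟙 _ ⊗≫ Xb ◁ ω' ⊗≫ ((Xb ⊗ X) ◁ a ≫ ω† ▷ Xb) ⊗≫ 𝟙 _ := by monoidal
      _ = ((ρ_ Xb).inv ≫ Xb ◁ ω' ≫ (α_ Xb X Xb).inv ≫ ω† ▷ Xb ≫ (λ_ Xb).hom) ≫ a := by
          rw [whisker_exchange]; monoidal
      _ = a := by rw [h.dag_snd, Category.id_comp]
  refine ⟨z, ?_⟩
  change lact z Xb = f
  rw [key f, key (lact z Xb), ← hg, ← hz, ract_whiskerRight]

/-- Each of the two partial traces of an endomorphism of `X ⊗ Xb` is the action of an element of `End 𝟙`,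
and both elements are equal, so the left and right traces agree. -/
lemma trace_eq (h : ConjugateEquations ω ω') (hω : ω ≫ ω† = 𝟙 _)
    (hX : Function.Surjective fun z : 𝟙_ C ⟶ 𝟙_ C => ract z X) (T : X ⊗ Xb ⟶ X ⊗ Xb) :
    ω' ≫ (contract (ω†) X Xb)† ≫ (X ⊗ Xb) ◁ T ≫ contract (ω†) X Xb ≫ ω'† =
      ω' ≫ (contract (ω†) X Xb)† ≫ T ▷ (X ⊗ Xb) ≫ contract (ω†) X Xb ≫ ω'† := by
  -- `E` and `E'` are the partial traces; closing up either of them with `ω` gives the same number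
  let E : Xb ⟶ Xb := (λ_ Xb).inv ≫ ω ▷ Xb ≫ (α_ Xb X Xb).hom ≫ Xb ◁ T ≫ (α_ Xb X Xb).inv ≫
    ω† ▷ Xb ≫ (λ_ Xb).hom
  let E' : X ⟶ X := (ρ_ X).inv ≫ X ◁ ω ≫ (α_ X Xb X).inv ≫ T ▷ X ≫ (α_ X Xb X).hom ≫
    X ◁ ω† ≫ (ρ_ X).hom
  obtain ⟨z, hz⟩ := h.lact_surjective hX E
  obtain ⟨z', hz'⟩ := hX E'
  replace hz : lact z Xb = E := hz
  replace hz' : ract z' X = E' := hz'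
  have h1 : ω ≫ E ▷ X ≫ ω† = z := by
    rw [← hz, ← lact_tensor, ← Category.assoc, comp_lact_unit, Category.assoc, hω,
      Category.comp_id]
  have h2 : ω ≫ Xb ◁ E' ≫ ω† = z' := by
    rw [← hz', ← ract_tensor, ← Category.assoc, comp_ract_unit, Category.assoc, hω,
      Category.comp_id]
  have h3 : ω ≫ E ▷ X ≫ ω† = ω ≫ Xb ◁ E' ≫ ω† := by
    calc _ = 𝟙 _ ⊗≫ (𝟙_ C ◁ ω ≫ ω ▷ (Xb ⊗ X)) ⊗≫ Xb ◁ T ▷ X ⊗≫ (ω† ▷ (Xb ⊗ X) ≫ 𝟙_ C ◁ ω†) ⊗≫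
          𝟙 _ := by dsimp only [E]; monoidal
      _ = 𝟙 _ ⊗≫ (ω ▷ 𝟙_ C ≫ (Xb ⊗ X) ◁ ω) ⊗≫ Xb ◁ T ▷ X ⊗≫ ((Xb ⊗ X) ◁ ω† ≫ ω† ▷ 𝟙_ C) ⊗≫
          𝟙 _ := by rw [whisker_exchange, ← whisker_exchange (ω†)]
      _ = _ := by dsimp only [E']; monoidal
  have h4 : z = z' := by rw [← h1, h3, h2]
  calc _ = ω' ≫ X ◁ E ≫ ω'† := by
        rw [dag_contract, dag_dag, contract]; dsimp only [E]; monoidal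
    _ = ω' ≫ E' ▷ Xb ≫ ω'† := by rw [← hz, h4, ← ract_whiskerRight, hz']
    _ = _ := by
        rw [dag_contract, dag_dag, contract]; dsimp only [E']; monoidal

/-- The Frobenius algebra of a generator `X` with `End X = End 𝟙` is standard. -/
theorem Generator.isStandard {P : UnitSummand C} (D : Generator P) (hP : IsScalarObj P.U)
    (hX : Function.Surjective fun z : 𝟙_ C ⟶ 𝟙_ C => ract z D.X) : D.frob.IsStandard := by
  refine SpecialFrobenius.isStandard_of_spherical (C := Corner P) hP D.frob fun T => ?_
  let T' : D.X ⊗ D.Xb ⟶ D.X ⊗ D.Xb := T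
  change ((P.s ≫ D.ω') ≫ (contract D.e D.X D.Xb)†) ≫ (D.X ⊗ D.Xb) ◁ T' ≫
      ((P.s ≫ D.ω') ≫ (contract D.e D.X D.Xb)†)† =
    ((P.s ≫ D.ω') ≫ (contract D.e D.X D.Xb)†) ≫ T' ▷ (D.X ⊗ D.Xb) ≫
      ((P.s ≫ D.ω') ≫ (contract D.e D.X D.Xb)†)†
  have h := congrArg (P.s ≫ · ≫ P.s†) (trace_eq D.conj D.isometry hX T')
  simpa only [dag_comp, dag_dag, Category.assoc] using h

end Sphericality

end CStarTensor

open CategoryTheory CStarTensor in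
theorem mainTheorem7 (C : Type u) [Category.{v} C] [StarNorm C] [Preadditive C] [Linear ℂ C]
    [MonoidalCategory C] [MultitensorCStar C] (hC : Indecomposable C) :
    ∃ (C₀ : Type u) (_ : Category.{v} C₀) (_ : StarNorm C₀) (_ : Preadditive C₀)
      (_ : Linear ℂ C₀) (_ : MonoidalCategory C₀) (_ : TensorCStar C₀)
      (H : SpecialFrobenius C₀),
      H.IsStandard ∧ MultitensorCStar (SpecialBimod H) ∧
        EquivalentMultitensor C (SpecialBimod H) := by
  obtain ⟨P, X, hP, hl, hX⟩ := exists_generator hC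
  obtain ⟨Xb, ω, ω', h, hω⟩ := exists_normalized_solution hX.1
  let D : Generator P := ⟨X, Xb, ω, ω', h, hω, hl⟩
  exact ⟨Corner P, inferInstance, inferInstance, inferInstance, inferInstance, inferInstance,
    Corner.tensorCStar P hP, D.frob, D.isStandard hP hX.2, D.multitensorCStar,
    D.equivalentMultitensor⟩
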